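/- Let $T\in(0,\infty)$ and $\kappa\in(0,1)$, and let $b\colon\mathbb R\to\mathbb R$ be measurable, bounded and integrable with finite Sobolev–Slobodeckij seminorm $$|b|_\kappa=\Big(\int_{\mathbb R}\int_{\mathbb R}\frac{|b(x)-b(y)|^2}{|x-y|^{2\kappa+1}}\,dx\,dy\Big)^{1/2}<\infty .$$ Then there exist constants $C^{equi}>0$ and $C^{*}>0$, depending only on $b$, $T$ and $\kappa$, such that the following holds. Let $W=(W_t)_{t\in[0,T]}$ be a standard Brownian motion on a probability space and let $\xi$ be a real random variable on it that is independent of $W$. For a grid $\pi_n=\{t_0,\dots,t_n\}$ with $0=t_0<t_1<\dots<t_n=T$ put $\underline s=\max\{t_k : t_k\le s\}$ and, for $t\in[0,T]$, $$\mathcal W_t^{(\pi_n)}=\mathbb E\left[\left|\int_0^t \exp\Big(-2\int_0^{W_s+\xi}b(z)\,dz\Big)\,\big[b(W_s+\xi)-b(W_{\underline s}+\xi)\big]\,ds\right|^2\right].$$ Then for every integer $n\ge 1$: for the equidistant grid $\pi_n^{equi}$ with $t_k=Tk/n$, $k=0,\dots,n$, $$\sup_{t\in[0,T]}\mathcal W_t^{(\pi_n^{equi})}\le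 C^{equi}\Big(\frac1{n^{1+\kappa}}+\frac1{n^{3/2}}\Big),$$ and for the grid $\pi_n^{*}$ with $t_k=T(k/n)^2$, $k=0,\dots,n$, $$\sup_{t\in[0,T]}\mathcal W_t^{(\pi_n^{*})}\le C^{*}\,\frac{1+\log n}{n^{1+\kappa}} .$$ -/

import Mathlib

open MeasureTheory ProbabilityTheory
open scoped ENNReal

noncomputable section

/-- `W = (W_t)_{t ∈ [0,T]}` is a standard Brownian motion on `[0,T]` under `P`: it starts at `0`,
has independent increments, `W_t - W_s ∼ N(0, t - s)` for `0 ≤ s ≤ t ≤ T`, and almost every path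
is continuous on `[0,T]`. Only the values `W t` with `t ∈ [0,T]` matter. -/
structure IsBrownianMotionOn {Ω : Type*} [MeasurableSpace Ω] (T : ℝ) (W : ℝ → Ω → ℝ)
    (P : Measure Ω) : Prop where
  measurable : ∀ t ∈ Set.Icc (0 : ℝ) T, Measurable (W t)
  zero : ∀ᵐ ω ∂P, W 0 ω = 0
  indepIncrements : HasIndepIncrements (fun t : Set.Icc (0 : ℝ) T ↦ W t) P
  hasLaw_sub : ∀ s t : ℝ, 0 ≤ s → s ≤ t → t ≤ T →
    HasLaw (fun ω ↦ W t ω - W s ω) (gaussianReal 0 (t - s).toNNReal) P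
  continuousOn : ∀ᵐ ω ∂P, ContinuousOn (fun t ↦ W t ω) (Set.Icc (0 : ℝ) T)

/-- The Sobolev–Slobodeckij seminorm
`|b|_κ = (∫ ∫ |b(x) - b(y)|² / |x - y|^(2κ+1) dx dy)^(1/2)`, with values in `[0, ∞]`. -/
def slobodeckijSeminorm (κ : ℝ) (b : ℝ → ℝ) : ℝ≥0∞ :=
  (∫⁻ y : ℝ, ∫⁻ x : ℝ, ENNReal.ofReal (|b x - b y| ^ 2 / |x - y| ^ (2 * κ + 1))) ^ (1 / 2 : ℝ)

/-- The last point `max {t_k : k ∈ {0, …, n}, t_k ≤ s}` of the grid `t_0, …, t_n` that is not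
after `s`. -/
def gridFloor (n : ℕ) (t : ℕ → ℝ) (s : ℝ) : ℝ :=
  sSup (t '' {k | k ≤ n ∧ t k ≤ s})

/-- As soon as `t_0 ≤ s`, the supremum in `gridFloor` is a maximum. -/
theorem gridFloor_isGreatest (n : ℕ) (t : ℕ → ℝ) (s : ℝ) (h : t 0 ≤ s) :
    IsGreatest (t '' {k | k ≤ n ∧ t k ≤ s}) (gridFloor n t s) := by
  have hfin : (t '' {k | k ≤ n ∧ t k ≤ s}).Finite :=
    ((Set.finite_Iic n).subset (fun k hk ↦ hk.1)).image t
  have hne : (t '' {k | k ≤ n ∧ t k ≤ s}).Nonempty := ⟨t 0, 0, ⟨Nat.zero_le n, h⟩, rfl⟩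
  exact ⟨hne.csSup_mem hfin, fun x hx ↦ le_csSup hfin.bddAbove hx⟩

/-- The equidistant grid `t_k = T k / n`. -/
def equiGrid (T : ℝ) (n k : ℕ) : ℝ := T * ((k : ℝ) / n)

/-- The non-equidistant grid `t_k = T (k / n)²`. -/
def starGrid (T : ℝ) (n k : ℕ) : ℝ := T * ((k : ℝ) / n) ^ 2

/-- The weight `φ'(x) = exp(-2 ∫_0^x b(z) dz)`, with an oriented integral when `x < 0`. -/
def driftWeight (b : ℝ → ℝ) (x : ℝ) : ℝ := Real.exp (-2 * ∫ z in (0 : ℝ)..x, b z)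

/-- The mean-square quadrature error along the grid `t_0, …, t_n`, with values in `[0, ∞]`:
`E |∫_0^r φ'(W_s + ξ) (b(W_s + ξ) - b(W_{s̲} + ξ)) ds|²`,
where `s̲` is the last grid point not after `s`. -/
def quadError {Ω : Type*} [MeasurableSpace Ω] (P : Measure Ω) (W : ℝ → Ω → ℝ) (ξ : Ω → ℝ)
    (b : ℝ → ℝ) (n : ℕ) (t : ℕ → ℝ) (r : ℝ) : ℝ≥0∞ :=
  ∫⁻ ω, ENNReal.ofReal (|∫ s in (0 : ℝ)..r, driftWeight b (W s ω + ξ ω) *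
    (b (W s ω + ξ ω) - b (W (gridFloor n t s) ω + ξ ω))| ^ 2) ∂P

end

/-! Write `P_r` for the heat semigroup `heat r` and `w` for `driftWeight b`. The error is the mean
square of a sum of cell integrals, so everything rests on the covariance of two weighted increments
of `b`: the first over a span `σ` after a grid time `t`, the second over a span `τ` after a further
waiting time `a`. By independence of the Brownian increments this covariance, given the starting
point, is `incrementCorrelation`. All bounds on it are uniform in the starting point, so the law of
`ξ` plays no role.

The conditional mean of one increment is `g = (P_τ - 1)(w b) - b (P_τ w - w)`, and each part of `P_a
g` is small in `L²`. In the first part, the difference of two Gaussian densities is at most `τ / a`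
times a wider Gaussian density, and both have mass one, so only increments of `w b` enter; the
Sobolev seminorm bounds their Gaussian energy at scale `a` by `a ^ κ`. In the second part, `w`
formally solves `w' = -2 b w`. The first-order Taylor term of `w` averages to zero, and the
remainder only sees increments of `b` along segments and second-order terms, whence a squared norm
of order `τ ^ (1 + κ)`. Altogether `‖P_a g‖²` is at most of order `Q = τ² a ^ (κ - 2) + τ ^ (1 +
κ)`.

For the outer increment put `m = w P_a g` and let `q` be the heat kernel at time `t`. The
correlation equals `(P_{t+σ} - P_t)(m b)(x₀) + ∫ q b (m - P_σ m)`. The first term is treated by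
smoothing in `t`. The second is a Dirichlet form, `2 ∫ f (g - P_σ g) = ∬ Δf Δg`, so Cauchy–Schwarz
for the increments uses the regularity of both `q b` and `m`. This is
`WeightedDrift.abs_incrementCorrelation_le`.

The sum over cells treats four cases. The first cell is bounded trivially by the squared mesh, since
the law at time `0` has no density. Diagonal terms use the energy of `b`, and neighbouring cells are
reduced to diagonal ones by the arithmetic–geometric mean. Separated cells use the correlation bound
(`RegularGrid.sum_sum_le`). For mesh size `η` the result is `η ^ (1 + κ)` plus `η ^ ((1 + κ) / 2) *
∑ (t_{j+1} - t_j)² t_j ^ (-5/4)`. The last sum is of order `n ^ (-3/4)` on the equidistant grid and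
`1 / n` on the quadratic one, which gives the two rates; for the quadratic grid the logarithm is not
even needed. -/

/-! ### Bounded measurable functions -/

/-- A bounded measurable real function. -/
structure BddMeas {α : Type*} [MeasurableSpace α] (f : α → ℝ) : Prop where
  meas : Measurable f
  bdd : ∃ M, ∀ x, |f x| ≤ M

namespace BddMeas

variable {α β : Type*} [MeasurableSpace α] [MeasurableSpace β] {f g : α → ℝ}

theorem const (c : ℝ) : BddMeas (fun _ : α ↦ c) := ⟨measurable_const, |c|, fun _ ↦ le_rfl⟩

theorem add (hf : BddMeas f) (hg : BddMeas g) : BddMeas (fun x ↦ f x + g x) := by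
  obtain ⟨M, hM⟩ := hf.bdd
  obtain ⟨N, hN⟩ := hg.bdd
  exact ⟨hf.meas.add hg.meas, M + N, fun x ↦ (abs_add_le _ _).trans (add_le_add (hM x) (hN x))⟩

theorem neg (hf : BddMeas f) : BddMeas (fun x ↦ -f x) := by
  obtain ⟨M, hM⟩ := hf.bdd
  exact ⟨hf.meas.neg, M, fun x ↦ by simpa using hM x⟩

theorem sub (hf : BddMeas f) (hg : BddMeas g) : BddMeas (fun x ↦ f x - g x) := by
  simpa [sub_eq_add_neg] using hf.add hg.neg

theorem mul (hf : BddMeas f) (hg : BddMeas g) : BddMeas (fun x ↦ f x * g x) := by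
  obtain ⟨M, hM⟩ := hf.bdd
  obtain ⟨N, hN⟩ := hg.bdd
  refine ⟨hf.meas.mul hg.meas, M * N, fun x ↦ ?_⟩
  rw [abs_mul]
  exact mul_le_mul (hM x) (hN x) (abs_nonneg _) ((abs_nonneg _).trans (hM x))

theorem sq (hf : BddMeas f) : BddMeas (fun x ↦ f x ^ 2) := by
  simpa [pow_two] using hf.mul hf

theorem abs (hf : BddMeas f) : BddMeas (fun x ↦ |f x|) := by
  obtain ⟨M, hM⟩ := hf.bdd
  exact ⟨hf.meas.abs, M, fun x ↦ by simpa using hM x⟩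

theorem comp (hf : BddMeas f) {φ : β → α} (hφ : Measurable φ) : BddMeas (fun x ↦ f (φ x)) := by
  obtain ⟨M, hM⟩ := hf.bdd
  exact ⟨hf.meas.comp hφ, M, fun x ↦ hM _⟩

theorem integrable (hf : BddMeas f) (μ : Measure α) [IsFiniteMeasure μ] : Integrable f μ := by
  obtain ⟨M, hM⟩ := hf.bdd
  exact Integrable.of_bound hf.meas.aestronglyMeasurable M (ae_of_all _ hM)

theorem integral {F : α × β → ℝ} (hF : BddMeas F) (ν : Measure β) [IsFiniteMeasure ν] :
    BddMeas (fun x ↦ ∫ y, F (x, y) ∂ν) := by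
  obtain ⟨M, hM⟩ := hF.bdd
  refine ⟨(hF.meas.stronglyMeasurable.integral_prod_right' (ν := ν)).measurable,
    M * ν.real Set.univ, fun x ↦ ?_⟩
  rw [← Real.norm_eq_abs]
  exact norm_integral_le_of_norm_le_const (ae_of_all _ fun y ↦ hM (x, y))

theorem integrable_mul (hf : BddMeas f) {μ : Measure α} (hg : Integrable g μ) :
    Integrable (fun x ↦ f x * g x) μ := by
  obtain ⟨M, hM⟩ := hf.bdd
  exact hg.bdd_mul hf.meas.aestronglyMeasurable (ae_of_all _ hM)

end BddMeas

/-- Jensen's inequality for the square. -/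
theorem sq_integral_le {α : Type*} [MeasurableSpace α] {f : α → ℝ} (hf : BddMeas f)
    (μ : Measure α) [IsProbabilityMeasure μ] : (∫ x, f x ∂μ) ^ 2 ≤ ∫ x, f x ^ 2 ∂μ := by
  obtain ⟨M, hM⟩ := hf.bdd
  have h2 : MemLp f 2 μ := MemLp.of_bound hf.meas.aestronglyMeasurable M (ae_of_all _ hM)
  have := variance_nonneg f μ
  rw [variance_eq_sub h2] at this
  simpa using this

theorem ofReal_integral_sq {α : Type*} [MeasurableSpace α] {f : α → ℝ} (hf : BddMeas f)
    (μ : Measure α) [IsFiniteMeasure μ] :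
    ENNReal.ofReal (∫ x, f x ^ 2 ∂μ) = ∫⁻ x, ENNReal.ofReal (f x ^ 2) ∂μ :=
  ofReal_integral_eq_lintegral_ofReal (hf.sq.integrable μ) (ae_of_all _ fun _ ↦ sq_nonneg _)

/-! ### The heat semigroup -/

/-- The centred Gaussian law with variance `r`. -/
noncomputable abbrev gaussLaw (r : ℝ) : Measure ℝ := gaussianReal 0 r.toNNReal

/-- The density of `gaussLaw r`. -/
noncomputable def heatKernel (r h : ℝ) : ℝ :=
  (√(2 * Real.pi * r))⁻¹ * Real.exp (-h ^ 2 / (2 * r))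

theorem heatKernel_nonneg (r h : ℝ) : 0 ≤ heatKernel r h := by
  unfold heatKernel; positivity

theorem measurable_heatKernel (r : ℝ) : Measurable (heatKernel r) := by
  unfold heatKernel; fun_prop

theorem heatKernel_eq {r : ℝ} (hr : 0 < r) : heatKernel r = gaussianPDFReal 0 r.toNNReal := by
  ext h
  simp [heatKernel, gaussianPDFReal, hr.le]

theorem gaussLaw_eq_withDensity {r : ℝ} (hr : 0 < r) :
    gaussLaw r = volume.withDensity (fun h ↦ ENNReal.ofReal (heatKernel r h)) := by
  have h0 : r.toNNReal ≠ 0 := by simpa using hr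
  rw [gaussLaw, gaussianReal_of_var_ne_zero _ h0, gaussianPDF_def, heatKernel_eq hr]

theorem lintegral_gaussLaw {r : ℝ} (hr : 0 < r) {f : ℝ → ℝ≥0∞} (hf : Measurable f) :
    ∫⁻ h, f h ∂(gaussLaw r) = ∫⁻ h, ENNReal.ofReal (heatKernel r h) * f h := by
  rw [gaussLaw_eq_withDensity hr, lintegral_withDensity_eq_lintegral_mul _ _ hf]
  · rfl
  · exact (measurable_heatKernel r).ennreal_ofReal

theorem integral_gaussLaw {r : ℝ} (hr : 0 < r) (f : ℝ → ℝ) :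
    ∫ h, f h ∂(gaussLaw r) = ∫ h, heatKernel r h * f h := by
  have h0 : r.toNNReal ≠ 0 := by simpa using hr
  rw [gaussLaw, integral_gaussianReal_eq_integral_smul h0, heatKernel_eq hr]
  rfl

theorem integrable_heatKernel {r : ℝ} (hr : 0 < r) : Integrable (heatKernel r) := by
  rw [heatKernel_eq hr]; exact integrable_gaussianPDFReal _ _

theorem heatKernel_le {r : ℝ} (hr : 0 < r) (h : ℝ) : heatKernel r h ≤ r ^ (-(1 / 2) : ℝ) := by
  unfold heatKernel
  rw [Real.rpow_neg hr.le, ← Real.sqrt_eq_rpow]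
  have h1 : √r ≤ √(2 * Real.pi * r) :=
    Real.sqrt_le_sqrt (by nlinarith [Real.pi_gt_three])
  have h2 : Real.exp (-h ^ 2 / (2 * r)) ≤ 1 := by
    rw [Real.exp_le_one_iff]
    exact div_nonpos_of_nonpos_of_nonneg (by nlinarith [sq_nonneg h]) (by positivity)
  have h3 : 0 < √r := Real.sqrt_pos.2 hr
  calc _ ≤ (√(2 * Real.pi * r))⁻¹ * 1 := by gcongr
    _ ≤ _ := by rw [mul_one]; gcongr

theorem hasDerivAt_heatKernel {s : ℝ} (hs : 0 < s) (h : ℝ) :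
    HasDerivAt (fun s ↦ heatKernel s h)
      (heatKernel s h * ((h ^ 2 / s - 1) / (2 * s))) s := by
  have hpi := Real.pi_pos
  have hs2 : 2 * Real.pi * s ≠ 0 := by positivity
  have hq : √(2 * Real.pi * s) ≠ 0 := by positivity
  have h1 : HasDerivAt (fun s ↦ (√(2 * Real.pi * s))⁻¹) _ s :=
    (((hasDerivAt_id s).const_mul (2 * Real.pi)).sqrt hs2).inv hq
  have h2 : HasDerivAt (fun s ↦ Real.exp (-h ^ 2 / (2 * s))) _ s :=
    ((hasDerivAt_const s (-h ^ 2)).div ((hasDerivAt_id s).const_mul 2) (by simp [hs.ne'])).exp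
  refine (h1.mul h2).congr_deriv ?_
  have hsq : √(2 * Real.pi * s) ^ 2 = 2 * Real.pi * s := Real.sq_sqrt (by positivity)
  simp only [id, heatKernel, Pi.div_apply]
  rw [hsq]
  field_simp
  ring

/-- Mean value inequality in time. On `[a, 5a]` the time derivative is the kernel times a factor of
order `(h² / a + 1) / a`. That factor costs `exp (h² / (20 a))`, and the decay `exp (-h² / (10 a))`
pays for it, leaving a Gaussian of variance `10 a`. -/
theorem abs_heatKernel_sub_le {a τ : ℝ} (ha : 0 < a) (hτ : 0 ≤ τ) (hτa : τ ≤ 4 * a) (h : ℝ) :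
    |heatKernel (a + τ) h - heatKernel a h| ≤ 40 * (τ / a) * heatKernel (10 * a) h := by
  have hpi := Real.pi_pos
  have key : ∀ s ∈ Set.Icc a (a + τ),
      ‖heatKernel s h * ((h ^ 2 / s - 1) / (2 * s))‖ ≤ 40 / a * heatKernel (10 * a) h := by
    intro s hs
    have hs0 : 0 < s := ha.trans_le hs.1
    have hs5 : s ≤ 5 * a := by linarith [hs.2]
    rw [Real.norm_eq_abs, abs_mul, abs_of_nonneg (heatKernel_nonneg _ _)]
    have e1 : |(h ^ 2 / s - 1) / (2 * s)| ≤ (h ^ 2 / a + 1) / (2 * a) := by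
      rw [abs_div, abs_of_pos (by positivity : 0 < 2 * s)]
      have : |h ^ 2 / s - 1| ≤ h ^ 2 / a + 1 := by
        have h4 : h ^ 2 / s ≤ h ^ 2 / a := by gcongr; exact hs.1
        have h5 : 0 ≤ h ^ 2 / s := by positivity
        rw [abs_le]; constructor <;> linarith
      gcongr
      exact hs.1
    have e2 : h ^ 2 / a + 1 ≤ 20 * Real.exp (h ^ 2 / (20 * a)) := by
      have := Real.add_one_le_exp (h ^ 2 / (20 * a))
      have h6 : h ^ 2 / a = 20 * (h ^ 2 / (20 * a)) := by field_simp
      have h7 : 0 ≤ h ^ 2 / (20 * a) := by positivity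
      linarith
    have e3 : heatKernel s h ≤ (√(2 * Real.pi * a))⁻¹ * Real.exp (-h ^ 2 / (10 * a)) := by
      unfold heatKernel
      have h8 : √(2 * Real.pi * a) ≤ √(2 * Real.pi * s) :=
        Real.sqrt_le_sqrt (by gcongr; exact hs.1)
      have h9 : -h ^ 2 / (2 * s) ≤ -h ^ 2 / (10 * a) := by
        rw [neg_div, neg_div, neg_le_neg_iff]
        exact div_le_div_of_nonneg_left (sq_nonneg h) (by positivity) (by linarith)
      gcongr
    -- Changing the normalisation from variance `a` to `10 a` costs `√10 ≤ 4`; with the factor `20 /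
    -- 2` from the polynomial weight this makes the constant `40`.
    have e4 : √(2 * Real.pi * (10 * a)) ≤ 4 * √(2 * Real.pi * a) := by
      rw [show (4 : ℝ) = √16 by rw [show (16 : ℝ) = 4 ^ 2 by norm_num]; simp,
        ← Real.sqrt_mul (by norm_num)]
      exact Real.sqrt_le_sqrt (by nlinarith)
    have e5 : Real.exp (-h ^ 2 / (10 * a)) * Real.exp (h ^ 2 / (20 * a))
        = Real.exp (-h ^ 2 / (2 * (10 * a))) := by
      rw [← Real.exp_add]; congr 1; field_simp; ring
    have e6 : (√(2 * Real.pi * a))⁻¹ ≤ 4 * (√(2 * Real.pi * (10 * a)))⁻¹ := by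
      have p1 : 0 < √(2 * Real.pi * a) := by positivity
      have p2 : 0 < √(2 * Real.pi * (10 * a)) := by positivity
      rw [inv_eq_one_div, ← div_eq_mul_inv, div_le_div_iff₀ p1 p2]
      linarith
    calc heatKernel s h * |(h ^ 2 / s - 1) / (2 * s)|
        ≤ ((√(2 * Real.pi * a))⁻¹ * Real.exp (-h ^ 2 / (10 * a)))
          * (20 * Real.exp (h ^ 2 / (20 * a)) / (2 * a)) := by
          have := e1.trans (div_le_div_of_nonneg_right e2 (by positivity))
          gcongr
      _ = (10 / a) * (√(2 * Real.pi * a))⁻¹ * Real.exp (-h ^ 2 / (2 * (10 * a))) := by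
          rw [← e5]; field_simp; ring
      _ ≤ (10 / a) * (4 * (√(2 * Real.pi * (10 * a)))⁻¹)
          * Real.exp (-h ^ 2 / (2 * (10 * a))) := by gcongr
      _ = _ := by unfold heatKernel; ring
  have := (convex_Icc a (a + τ)).norm_image_sub_le_of_norm_hasDerivWithin_le
    (f := fun s ↦ heatKernel s h)
    (fun s hs ↦ (hasDerivAt_heatKernel (ha.trans_le hs.1) h).hasDerivWithinAt) key
    (Set.left_mem_Icc.2 (by linarith)) (Set.right_mem_Icc.2 (by linarith))
  rw [Real.norm_eq_abs, Real.norm_eq_abs, add_sub_cancel_left, abs_of_nonneg hτ] at this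
  refine this.trans (le_of_eq ?_)
  ring

/-- The source of all smoothing gains `τ / a`. Keeping `|F|` on the right, rather than a supremum,
allows both `L²` estimates and the subtraction of constants from `F`. -/
theorem abs_integral_gaussLaw_sub_le {a τ : ℝ} (ha : 0 < a) (hτ : 0 ≤ τ) (hτa : τ ≤ 4 * a)
    {F : ℝ → ℝ} (hF : BddMeas F) :
    |∫ h, F h ∂(gaussLaw (a + τ)) - ∫ h, F h ∂(gaussLaw a)|
      ≤ 40 * (τ / a) * ∫ h, |F h| ∂(gaussLaw (10 * a)) := by
  have i (r : ℝ) (hr : 0 < r) {F : ℝ → ℝ} (hF : BddMeas F) :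
      Integrable fun h ↦ heatKernel r h * F h := by
    simpa [mul_comm] using hF.integrable_mul (integrable_heatKernel hr)
  rw [integral_gaussLaw (by positivity), integral_gaussLaw ha, integral_gaussLaw (by positivity),
    ← integral_sub (i _ (by positivity) hF) (i _ ha hF), ← integral_const_mul]
  refine (abs_integral_le_integral_abs).trans (integral_mono_of_nonneg (ae_of_all _ fun _ ↦
    abs_nonneg _) ((i _ (by positivity) hF.abs).const_mul _) (ae_of_all _ fun h ↦ ?_))
  simp only
  rw [← sub_mul, abs_mul, ← mul_assoc]
  gcongr
  exact abs_heatKernel_sub_le ha hτ hτa h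

/-- The heat semigroup `f ↦ E f(x + N(0, r))`. -/
noncomputable def heat (r : ℝ) (f : ℝ → ℝ) (x : ℝ) : ℝ := ∫ h, f (x + h) ∂(gaussLaw r)

theorem BddMeas.heat {f : ℝ → ℝ} (hf : BddMeas f) (r : ℝ) : BddMeas (heat r f) :=
  BddMeas.integral (F := fun p : ℝ × ℝ ↦ f (p.1 + p.2)) (hf.comp (by fun_prop)) _

theorem BddMeas.shift {f : ℝ → ℝ} (hf : BddMeas f) (x : ℝ) : BddMeas (fun h ↦ f (x + h)) :=
  hf.comp (by fun_prop)

theorem integral_gaussLaw_integral_gaussLaw {r s : ℝ} (hr : 0 ≤ r) (hs : 0 ≤ s) {f : ℝ → ℝ}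
    (hf : BddMeas f) :
    ∫ h, ∫ k, f (h + k) ∂(gaussLaw s) ∂(gaussLaw r) = ∫ h, f h ∂(gaussLaw (r + s)) := by
  have : gaussLaw (r + s) = gaussLaw r ∗ gaussLaw s := by
    rw [gaussLaw, gaussLaw, gaussLaw, gaussianReal_conv_gaussianReal, Real.toNNReal_add hr hs,
      add_zero]
  rw [this, integral_conv (this ▸ hf.integrable _)]

theorem heat_heat {r s : ℝ} (hr : 0 ≤ r) (hs : 0 ≤ s) {f : ℝ → ℝ} (hf : BddMeas f) (x : ℝ) :
    heat r (heat s f) x = heat (r + s) f x := by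
  have := integral_gaussLaw_integral_gaussLaw hr hs (hf.shift x)
  simpa [heat, add_assoc] using this

theorem heat_sub {f g : ℝ → ℝ} (hf : BddMeas f) (hg : BddMeas g) (r x : ℝ) :
    heat r (fun y ↦ f y - g y) x = heat r f x - heat r g x :=
  integral_sub ((hf.shift x).integrable _) ((hg.shift x).integrable _)

/-! ### Square integrals and Gaussian energies -/

/-- `f` is bounded and measurable, and `∫ f² ≤ A`. -/
structure SqBound (f : ℝ → ℝ) (A : ℝ) : Prop extends BddMeas f where
  nonneg : 0 ≤ A
  le : ∫⁻ x, ENNReal.ofReal (f x ^ 2) ≤ ENNReal.ofReal A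

/-- `∬ (f(x+h) - f(x))² N(0,r)(dh) dx ≤ A`. -/
structure EnergyLe (r : ℝ) (f : ℝ → ℝ) (A : ℝ) : Prop where
  nonneg : 0 ≤ A
  le : ∫⁻ x, ∫⁻ h, ENNReal.ofReal ((f (x + h) - f x) ^ 2) ∂(gaussLaw r) ≤ ENNReal.ofReal A

theorem abs_integral_mul_le_sqrt {α : Type*} [MeasurableSpace α] {μ : Measure α} {f g : α → ℝ}
    (hf : MemLp f 2 μ) (hg : MemLp g 2 μ) :
    |∫ x, f x * g x ∂μ| ≤ √(∫ x, f x ^ 2 ∂μ) * √(∫ x, g x ^ 2 ∂μ) := by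
  have h2 : ENNReal.ofReal (2 : ℝ) = 2 := by simp
  have := integral_mul_norm_le_Lp_mul_Lq (μ := μ) (f := f) (g := g) Real.HolderConjugate.two_two
    (by rwa [h2]) (by rwa [h2])
  simp only [Real.norm_eq_abs, Real.rpow_two, sq_abs, ← Real.sqrt_eq_rpow] at this
  refine (abs_integral_le_integral_abs).trans ?_
  simpa only [abs_mul] using this

theorem ofReal_add_sq_le (a b : ℝ) : ENNReal.ofReal ((a + b) ^ 2)
    ≤ ENNReal.ofReal 2 * ENNReal.ofReal (a ^ 2) + ENNReal.ofReal 2 * ENNReal.ofReal (b ^ 2) := by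
  rw [← ENNReal.ofReal_mul (by norm_num), ← ENNReal.ofReal_mul (by norm_num),
    ← ENNReal.ofReal_add (by positivity) (by positivity)]
  exact ENNReal.ofReal_le_ofReal (by nlinarith [sq_nonneg (a - b)])

theorem BddMeas.uncurry_sub {f : ℝ → ℝ} (hf : BddMeas f) :
    BddMeas (fun p : ℝ × ℝ ↦ f (p.1 + p.2) - f p.1) :=
  (hf.comp (by fun_prop : Measurable fun p : ℝ × ℝ ↦ p.1 + p.2)).sub (hf.comp measurable_fst)

/-- For each fixed second coordinate the map is a translation of Lebesgue measure. Hence a random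
shift is an isometry from `L²` of the line into `L²` of the product. -/
theorem measurePreserving_add_prod_volume (ν : Measure ℝ) [IsProbabilityMeasure ν] :
    MeasurePreserving (fun p : ℝ × ℝ ↦ p.1 + p.2) (volume.prod ν) volume := by
  refine ⟨by fun_prop, Measure.ext fun s hs ↦ ?_⟩
  rw [Measure.map_apply (by fun_prop) hs,
    Measure.prod_apply_symm (hs.preimage (by fun_prop : Measurable fun p : ℝ × ℝ ↦ p.1 + p.2))]
  have : ∀ y : ℝ, volume ((fun x : ℝ ↦ (x, y)) ⁻¹' ((fun p : ℝ × ℝ ↦ p.1 + p.2) ⁻¹' s))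
      = volume s := fun y ↦ measure_preimage_add_right volume y s
  simp [this]

namespace SqBound

variable {f g : ℝ → ℝ} {A B : ℝ}

theorem mono (hf : SqBound f A) (h : A ≤ B) : SqBound f B :=
  ⟨hf.toBddMeas, hf.nonneg.trans h, hf.le.trans (ENNReal.ofReal_le_ofReal h)⟩

theorem add (hf : SqBound f A) (hg : SqBound g B) :
    SqBound (fun x ↦ f x + g x) (2 * A + 2 * B) := by
  have := hf.nonneg
  have := hg.nonneg
  refine ⟨hf.toBddMeas.add hg.toBddMeas, by positivity, ?_⟩
  have m1 := (hf.meas.pow_const 2).ennreal_ofReal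
  calc _ ≤ ∫⁻ x, (ENNReal.ofReal 2 * ENNReal.ofReal (f x ^ 2)
        + ENNReal.ofReal 2 * ENNReal.ofReal (g x ^ 2)) :=
        lintegral_mono fun x ↦ ofReal_add_sq_le _ _
    _ = ENNReal.ofReal 2 * (∫⁻ x, ENNReal.ofReal (f x ^ 2))
        + ENNReal.ofReal 2 * ∫⁻ x, ENNReal.ofReal (g x ^ 2) := by
        rw [lintegral_add_left (m1.const_mul _), lintegral_const_mul' _ _ (by simp),
          lintegral_const_mul' _ _ (by simp)]
    _ ≤ ENNReal.ofReal 2 * ENNReal.ofReal A + ENNReal.ofReal 2 * ENNReal.ofReal B := by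
        gcongr
        · exact hf.le
        · exact hg.le
    _ = _ := by
        rw [ENNReal.ofReal_add (by positivity) (by positivity), ENNReal.ofReal_mul (by norm_num),
          ENNReal.ofReal_mul (by norm_num)]

theorem neg (hf : SqBound f A) : SqBound (fun x ↦ -f x) A :=
  ⟨hf.toBddMeas.neg, hf.nonneg, by simpa using hf.le⟩

theorem sub (hf : SqBound f A) (hg : SqBound g B) :
    SqBound (fun x ↦ f x - g x) (2 * A + 2 * B) := by
  simpa [sub_eq_add_neg] using hf.add hg.neg

theorem of_abs_le (hg : SqBound g B) (hf : BddMeas f) {c : ℝ} (h : ∀ x, |f x| ≤ c * |g x|) :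
    SqBound f (c ^ 2 * B) := by
  refine ⟨hf, mul_nonneg (sq_nonneg c) hg.nonneg, ?_⟩
  calc _ ≤ ∫⁻ x, ENNReal.ofReal (c ^ 2) * ENNReal.ofReal (g x ^ 2) := by
        refine lintegral_mono fun x ↦ ?_
        rw [← ENNReal.ofReal_mul (sq_nonneg c)]
        refine ENNReal.ofReal_le_ofReal ?_
        rw [← sq_abs (f x), ← sq_abs (g x), ← mul_pow]
        exact pow_le_pow_left₀ (abs_nonneg _) (h x) 2
    _ = ENNReal.ofReal (c ^ 2) * ∫⁻ x, ENNReal.ofReal (g x ^ 2) :=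
        lintegral_const_mul' _ _ (by simp)
    _ ≤ _ := by
        rw [ENNReal.ofReal_mul (sq_nonneg c)]
        gcongr
        exact hg.le

theorem bdd_mul (hg : SqBound g B) (hf : BddMeas f) {c : ℝ} (h : ∀ x, |f x| ≤ c) :
    SqBound (fun x ↦ f x * g x) (c ^ 2 * B) :=
  hg.of_abs_le (hf.mul hg.toBddMeas) fun x ↦ by rw [abs_mul]; gcongr; exact h x

theorem integrable_sq (hf : SqBound f A) : Integrable (fun x ↦ f x ^ 2) := by
  refine ⟨(hf.meas.pow_const 2).aestronglyMeasurable, ?_⟩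
  rw [hasFiniteIntegral_iff_ofReal (ae_of_all _ fun _ ↦ sq_nonneg _)]
  exact hf.le.trans_lt ENNReal.ofReal_lt_top

theorem integral_sq_le (hf : SqBound f A) : ∫ x, f x ^ 2 ≤ A := by
  have := ofReal_integral_eq_lintegral_ofReal hf.integrable_sq (ae_of_all _ fun _ ↦ sq_nonneg _)
  exact (ENNReal.ofReal_le_ofReal_iff hf.nonneg).1 (this ▸ hf.le)

theorem memLp (hf : SqBound f A) : MemLp f 2 :=
  (memLp_two_iff_integrable_sq hf.meas.aestronglyMeasurable).2 hf.integrable_sq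

theorem abs_integral_mul_le (hf : SqBound f A) (hg : SqBound g B) :
    |∫ x, f x * g x| ≤ √A * √B := by
  refine (abs_integral_mul_le_sqrt hf.memLp hg.memLp).trans ?_
  gcongr
  · exact hf.integral_sq_le
  · exact hg.integral_sq_le

theorem lintegral_shift_sq (f : ℝ → ℝ) (hf : Measurable f) (ν : Measure ℝ)
    [IsProbabilityMeasure ν] :
    ∫⁻ x, ∫⁻ h, ENNReal.ofReal (f (x + h) ^ 2) ∂ν = ∫⁻ x, ENNReal.ofReal (f x ^ 2) := by
  have hm : Measurable fun y ↦ ENNReal.ofReal (f y ^ 2) := (hf.pow_const 2).ennreal_ofReal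
  rw [← (measurePreserving_add_prod_volume ν).lintegral_comp hm,
    lintegral_prod _ (by fun_prop)]

/-- Jensen's inequality in the second variable, then integration in the first. It turns a pointwise
bound by a Gaussian mean into an `L²` bound. -/
theorem of_integral {F : ℝ × ℝ → ℝ} (hF : BddMeas F) (ν : Measure ℝ) [IsProbabilityMeasure ν]
    (hf : BddMeas f) {c : ℝ} (hA : 0 ≤ A) (h : ∀ x, |f x| ≤ c * ∫ h, |F (x, h)| ∂ν)
    (hle : ∫⁻ x, ∫⁻ h, ENNReal.ofReal (F (x, h) ^ 2) ∂ν ≤ ENNReal.ofReal A) :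
    SqBound f (c ^ 2 * A) := by
  refine ⟨hf, mul_nonneg (sq_nonneg c) hA, ?_⟩
  calc _ ≤ ∫⁻ x, ENNReal.ofReal (c ^ 2) * ∫⁻ h, ENNReal.ofReal (F (x, h) ^ 2) ∂ν := by
        refine lintegral_mono fun x ↦ ?_
        have hx : BddMeas fun h ↦ F (x, h) := hF.comp (by fun_prop)
        rw [← ofReal_integral_sq hx, ← ENNReal.ofReal_mul (sq_nonneg c)]
        refine ENNReal.ofReal_le_ofReal ?_
        have h1 := sq_integral_le hx.abs ν
        simp only [sq_abs] at h1
        calc f x ^ 2 = |f x| ^ 2 := (sq_abs _).symm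
          _ ≤ (c * ∫ h, |F (x, h)| ∂ν) ^ 2 := pow_le_pow_left₀ (abs_nonneg _) (h x) 2
          _ ≤ _ := by rw [mul_pow]; gcongr
    _ = ENNReal.ofReal (c ^ 2) * ∫⁻ x, ∫⁻ h, ENNReal.ofReal (F (x, h) ^ 2) ∂ν :=
        lintegral_const_mul' _ _ (by simp)
    _ ≤ _ := by
        rw [ENNReal.ofReal_mul (sq_nonneg c)]
        gcongr

theorem heat (hf : SqBound f A) (r : ℝ) : SqBound (heat r f) A := by
  have := SqBound.of_integral (f := _root_.heat r f) (c := 1)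
    (F := fun p : ℝ × ℝ ↦ f (p.1 + p.2)) (hf.toBddMeas.comp (by fun_prop)) (gaussLaw r)
    (hf.toBddMeas.heat r) hf.nonneg
    (fun x ↦ by rw [one_mul]; exact abs_integral_le_integral_abs)
    ((lintegral_shift_sq f hf.meas _).trans_le hf.le)
  simpa using this

/-- Analyticity of the heat semigroup in quantitative form: the `L²` norm of `(P_{a+τ} - P_a) f`
gains a factor of order `τ / a`. -/
theorem heat_sub_heat (hf : SqBound f A) {a τ : ℝ} (ha : 0 < a) (hτ : 0 ≤ τ) (hτa : τ ≤ 4 * a) :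
    SqBound (fun x ↦ _root_.heat (a + τ) f x - _root_.heat a f x) ((40 * (τ / a)) ^ 2 * A) :=
  SqBound.of_integral (F := fun p : ℝ × ℝ ↦ f (p.1 + p.2)) (hf.toBddMeas.comp (by fun_prop))
    (gaussLaw (10 * a)) ((hf.toBddMeas.heat _).sub (hf.toBddMeas.heat _)) hf.nonneg
    (fun x ↦ abs_integral_gaussLaw_sub_le ha hτ hτa (hf.toBddMeas.shift x))
    ((lintegral_shift_sq f hf.meas _).trans_le hf.le)

end SqBound

namespace EnergyLe

variable {f g : ℝ → ℝ} {A B r : ℝ}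

theorem mono (hf : EnergyLe r f A) (h : A ≤ B) : EnergyLe r f B :=
  ⟨hf.nonneg.trans h, hf.le.trans (ENNReal.ofReal_le_ofReal h)⟩

/-- If `|Δf| ≤ |u| + |v|`, then the energy of `f` is controlled by the square integrals of
`u` and `v`. -/
theorem of_abs_le {u v : ℝ × ℝ → ℝ} (hu : Measurable u)
    (h : ∀ x k, |f (x + k) - f x| ≤ |u (x, k)| + |v (x, k)|) (hA : 0 ≤ A) (hB : 0 ≤ B)
    (hle : ∫⁻ x, ∫⁻ k, ENNReal.ofReal (u (x, k) ^ 2) ∂(gaussLaw r) ≤ ENNReal.ofReal A)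
    (hle' : ∫⁻ x, ∫⁻ k, ENNReal.ofReal (v (x, k) ^ 2) ∂(gaussLaw r) ≤ ENNReal.ofReal B) :
    EnergyLe r f (2 * A + 2 * B) := by
  refine ⟨by positivity, ?_⟩
  have m1 : Measurable fun p : ℝ × ℝ ↦ ENNReal.ofReal (u p ^ 2) :=
    (hu.pow_const 2).ennreal_ofReal
  calc _ ≤ ∫⁻ x, ∫⁻ k, (ENNReal.ofReal 2 * ENNReal.ofReal (u (x, k) ^ 2)
        + ENNReal.ofReal 2 * ENNReal.ofReal (v (x, k) ^ 2)) ∂(gaussLaw r) := by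
        refine lintegral_mono fun x ↦ lintegral_mono fun k ↦ ?_
        have h1 := ofReal_add_sq_le |u (x, k)| |v (x, k)|
        rw [sq_abs, sq_abs] at h1
        refine le_trans (ENNReal.ofReal_le_ofReal ?_) h1
        rw [← sq_abs]
        exact pow_le_pow_left₀ (abs_nonneg _) (h x k) 2
    _ = ∫⁻ x, (ENNReal.ofReal 2 * ∫⁻ k, ENNReal.ofReal (u (x, k) ^ 2) ∂(gaussLaw r)
        + ENNReal.ofReal 2 * ∫⁻ k, ENNReal.ofReal (v (x, k) ^ 2) ∂(gaussLaw r)) := by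
        refine lintegral_congr fun x ↦ ?_
        have mx : Measurable fun k ↦ ENNReal.ofReal (u (x, k) ^ 2) :=
          m1.comp measurable_prodMk_left
        rw [lintegral_add_left (mx.const_mul _), lintegral_const_mul' _ _ (by simp),
          lintegral_const_mul' _ _ (by simp)]
    _ = ENNReal.ofReal 2 * (∫⁻ x, ∫⁻ k, ENNReal.ofReal (u (x, k) ^ 2) ∂(gaussLaw r))
        + ENNReal.ofReal 2 * ∫⁻ x, ∫⁻ k, ENNReal.ofReal (v (x, k) ^ 2) ∂(gaussLaw r) := by
        rw [lintegral_add_left (m1.lintegral_prod_right'.const_mul _),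
          lintegral_const_mul' _ _ (by simp), lintegral_const_mul' _ _ (by simp)]
    _ ≤ ENNReal.ofReal 2 * ENNReal.ofReal A + ENNReal.ofReal 2 * ENNReal.ofReal B := by
        gcongr
    _ = _ := by
        rw [ENNReal.ofReal_add (by positivity) (by positivity), ENNReal.ofReal_mul (by norm_num),
          ENNReal.ofReal_mul (by norm_num)]

theorem lintegral_mul_sub_le (hf : EnergyLe r f A) {w : ℝ × ℝ → ℝ} {c : ℝ}
    (hc : ∀ p, |w p| ≤ c) :
    ∫⁻ x, ∫⁻ k, ENNReal.ofReal ((w (x, k) * (f (x + k) - f x)) ^ 2) ∂(gaussLaw r)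
      ≤ ENNReal.ofReal (c ^ 2 * A) := by
  calc _ ≤ ∫⁻ x, ENNReal.ofReal (c ^ 2) *
          ∫⁻ k, ENNReal.ofReal ((f (x + k) - f x) ^ 2) ∂(gaussLaw r) := by
        refine lintegral_mono fun x ↦ ?_
        rw [← lintegral_const_mul' _ _ (by simp)]
        refine lintegral_mono fun k ↦ ?_
        rw [← ENNReal.ofReal_mul (sq_nonneg c), mul_pow, ← sq_abs (w _)]
        refine ENNReal.ofReal_le_ofReal ?_
        gcongr
        exact hc _
    _ ≤ _ := by
        rw [lintegral_const_mul' _ _ (by simp), ENNReal.ofReal_mul (sq_nonneg c)]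
        gcongr
        exact hf.le

theorem add (hf : EnergyLe r f A) (hg : EnergyLe r g B) (hfm : Measurable f) :
    EnergyLe r (fun x ↦ f x + g x) (2 * A + 2 * B) :=
  of_abs_le (u := fun p ↦ f (p.1 + p.2) - f p.1) (v := fun p ↦ g (p.1 + p.2) - g p.1)
    (by fun_prop) (fun x k ↦ by
      rw [show f (x + k) + g (x + k) - (f x + g x) = (f (x + k) - f x) + (g (x + k) - g x) by ring]
      exact abs_add_le _ _) hf.nonneg hg.nonneg hf.le hg.le

theorem neg (hf : EnergyLe r f A) : EnergyLe r (fun x ↦ -f x) A := by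
  refine ⟨hf.nonneg, ?_⟩
  have : ∀ x k, (-f (x + k) - -f x) ^ 2 = (f (x + k) - f x) ^ 2 := fun x k ↦ by ring
  simp_rw [this]
  exact hf.le

theorem sub (hf : EnergyLe r f A) (hg : EnergyLe r g B) (hfm : Measurable f) :
    EnergyLe r (fun x ↦ f x - g x) (2 * A + 2 * B) := by
  simpa [sub_eq_add_neg] using hf.add hg.neg hfm

end EnergyLe

/-- Both Gaussian laws have mass one, so `f x` may be subtracted under the integral and the
smoothing bound only sees increments of `f`. The energy at scale `10 a` thus replaces the full
square integral, which is a gain of `a ^ κ` for Sobolev functions. -/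
theorem EnergyLe.heat_sub_heat {f : ℝ → ℝ} {A a τ : ℝ} (hf : EnergyLe (10 * a) f A)
    (hfb : BddMeas f) (ha : 0 < a) (hτ : 0 ≤ τ) (hτa : τ ≤ 4 * a) :
    SqBound (fun x ↦ heat (a + τ) f x - heat a f x) ((40 * (τ / a)) ^ 2 * A) := by
  refine SqBound.of_integral (F := fun p : ℝ × ℝ ↦ f (p.1 + p.2) - f p.1) hfb.uncurry_sub
    (gaussLaw (10 * a)) ((hfb.heat _).sub (hfb.heat _)) hf.nonneg (fun x ↦ ?_) hf.le
  have h := abs_integral_gaussLaw_sub_le ha hτ hτa ((hfb.shift x).sub (BddMeas.const (f x)))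
  rw [integral_sub ((hfb.shift x).integrable _) (integrable_const _),
    integral_sub ((hfb.shift x).integrable _) (integrable_const _)] at h
  simpa [heat] using h

/-! ### The Dirichlet form of the heat semigroup -/

section Dirichlet

theorem integrable_mul_of_memLp_two {α : Type*} [MeasurableSpace α] {μ : Measure α}
    {f g : α → ℝ} (hf : MemLp f 2 μ) (hg : MemLp g 2 μ) : Integrable (fun x ↦ f x * g x) μ :=
  hf.integrable_mul hg

variable {f g : ℝ → ℝ} {A B τ : ℝ}

theorem SqBound.memLp_shift (hf : SqBound f A) (ν : Measure ℝ) [IsProbabilityMeasure ν] :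
    MemLp (fun p : ℝ × ℝ ↦ f (p.1 + p.2)) 2 (volume.prod ν) :=
  hf.memLp.comp_measurePreserving (measurePreserving_add_prod_volume ν)

theorem SqBound.memLp_fst (hf : SqBound f A) (ν : Measure ℝ) [IsProbabilityMeasure ν] :
    MemLp (fun p : ℝ × ℝ ↦ f p.1) 2 (volume.prod ν) :=
  hf.memLp.comp_measurePreserving measurePreserving_fst

theorem integral_mul_heat (hf : SqBound f A) (hg : SqBound g B) :
    ∫ p : ℝ × ℝ, f p.1 * g (p.1 + p.2) ∂(volume.prod (gaussLaw τ)) = ∫ x, f x * heat τ g x := by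
  have hi := integrable_mul_of_memLp_two (hf.memLp_fst (gaussLaw τ)) (hg.memLp_shift (gaussLaw τ))
  rw [integral_prod _ hi]
  refine integral_congr_ae (ae_of_all _ fun x ↦ ?_)
  simp [heat, integral_const_mul]

/-- Self-adjointness of the heat semigroup: translate by `-h` in the Lebesgue integral, then use the
symmetry of the Gaussian law. -/
theorem integral_heat_mul (hf : SqBound f A) (hg : SqBound g B) :
    ∫ p : ℝ × ℝ, f (p.1 + p.2) * g p.1 ∂(volume.prod (gaussLaw τ)) = ∫ x, f x * heat τ g x := by
  have hi := integrable_mul_of_memLp_two (hf.memLp_shift (gaussLaw τ)) (hg.memLp_fst (gaussLaw τ))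
  have hi' := integrable_mul_of_memLp_two (hf.memLp_fst (gaussLaw τ)) (hg.memLp_shift (gaussLaw τ))
  rw [← integral_mul_heat hf hg, integral_prod_symm _ hi, integral_prod_symm _ hi']
  have hneg : (gaussLaw τ).map (fun x ↦ -x) = gaussLaw τ := by
    rw [gaussLaw, gaussianReal_map_neg, neg_zero]
  have hme : MeasurableEmbedding (fun x : ℝ ↦ -x) := (MeasurableEquiv.neg ℝ).measurableEmbedding
  have e (h : ℝ) : ∫ x, f (x + h) * g x = ∫ x, f x * g (x + -h) := by
    rw [← integral_add_right_eq_self (fun x ↦ f x * g (x + -h)) h]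
    simp
  calc _ = ∫ h, (∫ x, f x * g (x + -h)) ∂(gaussLaw τ) := integral_congr_ae (ae_of_all _ e)
    _ = ∫ h, (∫ x, f x * g (x + h)) ∂((gaussLaw τ).map (fun x ↦ -x)) :=  
      (hme.integral_map (fun h ↦ ∫ x, f x * g (x + h))).symm
    _ = _ := by rw [hneg]

/-- The Dirichlet form identity for the heat semigroup. -/
theorem integral_increment_mul (hf : SqBound f A) (hg : SqBound g B) :
    ∫ p : ℝ × ℝ, (f (p.1 + p.2) - f p.1) * (g (p.1 + p.2) - g p.1) ∂(volume.prod (gaussLaw τ))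
      = 2 * ∫ x, f x * (g x - heat τ g x) := by
  have f1 := hf.memLp_shift (gaussLaw τ)
  have f0 := hf.memLp_fst (gaussLaw τ)
  have g1 := hg.memLp_shift (gaussLaw τ)
  have g0 := hg.memLp_fst (gaussLaw τ)
  have i11 := integrable_mul_of_memLp_two f1 g1
  have i10 := integrable_mul_of_memLp_two f1 g0
  have i01 := integrable_mul_of_memLp_two f0 g1
  have i00 := integrable_mul_of_memLp_two f0 g0
  have e : ∀ p : ℝ × ℝ, (f (p.1 + p.2) - f p.1) * (g (p.1 + p.2) - g p.1)
      = (f (p.1 + p.2) * g (p.1 + p.2) - f (p.1 + p.2) * g p.1)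
        - (f p.1 * g (p.1 + p.2) - f p.1 * g p.1) := fun p ↦ by ring
  have e11 : ∫ p : ℝ × ℝ, f (p.1 + p.2) * g (p.1 + p.2) ∂(volume.prod (gaussLaw τ))
      = ∫ x, f x * g x := by
    have hm := measurePreserving_add_prod_volume (gaussLaw τ)
    have := integral_map (μ := volume.prod (gaussLaw τ)) hm.measurable.aemeasurable
      (f := fun x ↦ f x * g x) (hf.meas.mul hg.meas).aestronglyMeasurable
    rw [hm.map_eq] at this
    exact this.symm
  have e00 : ∫ p : ℝ × ℝ, f p.1 * g p.1 ∂(volume.prod (gaussLaw τ)) = ∫ x, f x * g x := by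
    have hm := measurePreserving_fst (μ := (volume : Measure ℝ)) (ν := gaussLaw τ)
    have := integral_map (μ := volume.prod (gaussLaw τ)) hm.measurable.aemeasurable
      (f := fun x ↦ f x * g x) (hf.meas.mul hg.meas).aestronglyMeasurable
    rw [hm.map_eq] at this
    exact this.symm
  simp_rw [e]
  rw [integral_sub (by exact i11.sub i10) (by exact i01.sub i00), integral_sub i11 i10, integral_sub i01 i00,
    e11, e00, integral_heat_mul hf hg, integral_mul_heat hf hg]
  simp_rw [mul_sub]
  rw [integral_sub (integrable_mul_of_memLp_two hf.memLp hg.memLp)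
    (integrable_mul_of_memLp_two hf.memLp (hg.heat τ).memLp)]
  ring

theorem SqBound.integral_increment_sq_le (hf : SqBound f A) (hE : EnergyLe τ f B) :
    ∫ p : ℝ × ℝ, (f (p.1 + p.2) - f p.1) ^ 2 ∂(volume.prod (gaussLaw τ)) ≤ B := by
  have hi := ((hf.memLp_shift (gaussLaw τ)).sub (hf.memLp_fst (gaussLaw τ))).integrable_sq
  have := ofReal_integral_eq_lintegral_ofReal hi (ae_of_all _ fun _ ↦ sq_nonneg _)
  have hm := (hf.uncurry_sub.meas.pow_const 2).ennreal_ofReal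
  rw [lintegral_prod _ hi.1.aemeasurable.ennreal_ofReal] at this
  exact (ENNReal.ofReal_le_ofReal_iff hE.nonneg).1 (this.trans_le hE.le)

theorem SqBound.energyLe (hf : SqBound f A) (h : 2 * ∫ x, f x * (f x - _root_.heat τ f x) ≤ B) :
    EnergyLe τ f B := by
  have hi := ((hf.memLp_shift (gaussLaw τ)).sub (hf.memLp_fst (gaussLaw τ))).integrable_sq
  have e := integral_increment_mul (τ := τ) hf hf
  simp_rw [← pow_two] at e
  have h0 : 0 ≤ ∫ p : ℝ × ℝ, (f (p.1 + p.2) - f p.1) ^ 2 ∂(volume.prod (gaussLaw τ)) :=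
    integral_nonneg fun _ ↦ sq_nonneg _
  refine ⟨h0.trans (e.trans_le h), ?_⟩
  have := ofReal_integral_eq_lintegral_ofReal hi (ae_of_all _ fun _ ↦ sq_nonneg _)
  rw [lintegral_prod _ hi.1.aemeasurable.ennreal_ofReal] at this
  exact this.symm.trans_le (ENNReal.ofReal_le_ofReal (e.trans_le h))

/-- Cauchy–Schwarz applied to the increments in the Dirichlet identity, so that the regularity of
both factors is exploited. The factor `1/2` of the identity is discarded. -/
theorem abs_integral_mul_sub_heat_le {A' B' : ℝ} (hf : SqBound f A) (hg : SqBound g B)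
    (hfE : EnergyLe τ f A') (hgE : EnergyLe τ g B') :
    |∫ x, f x * (g x - _root_.heat τ g x)| ≤ √A' * √B' := by
  have e := integral_increment_mul (τ := τ) hf hg
  have := abs_integral_mul_le_sqrt
    ((hf.memLp_shift (gaussLaw τ)).sub (hf.memLp_fst (gaussLaw τ)))
    ((hg.memLp_shift (gaussLaw τ)).sub (hg.memLp_fst (gaussLaw τ)))
  simp only [Pi.sub_apply] at this
  rw [e, abs_mul, abs_two] at this
  have h1 := Real.sqrt_le_sqrt (hf.integral_increment_sq_le hfE)
  have h2 := Real.sqrt_le_sqrt (hg.integral_increment_sq_le hgE)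
  have h3 := mul_le_mul h1 h2 (Real.sqrt_nonneg _) (Real.sqrt_nonneg _)
  linarith [abs_nonneg (∫ x, f x * (g x - _root_.heat τ g x))]

/-- By the Dirichlet identity the energy of `P_a f` is `2 ∫ P_a f (P_a f - P_{a+τ} f)`.
Cauchy–Schwarz with `L²` contraction and the smoothing bound gives the constant `80 = 2 * 40`. -/
theorem SqBound.energyLe_heat (hf : SqBound f A) {a : ℝ} (ha : 0 < a) (hτ : 0 ≤ τ)
    (hτa : τ ≤ 4 * a) : EnergyLe τ (_root_.heat a f) (80 * (τ / a) * A) := by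
  refine (hf.heat a).energyLe ?_
  have h := (hf.heat a).abs_integral_mul_le (hf.heat_sub_heat ha hτ hτa).neg
  have hA := hf.nonneg
  have e : ∀ x, _root_.heat a f x * (_root_.heat a f x - _root_.heat τ (_root_.heat a f) x)
      = _root_.heat a f x * -(_root_.heat (a + τ) f x - _root_.heat a f x) := fun x ↦ by
    rw [heat_heat hτ ha.le hf.toBddMeas, add_comm τ a]; ring
  simp_rw [e]
  rw [Real.sqrt_mul (by positivity), Real.sqrt_sq (by positivity)] at h
  have h2 := (le_abs_self _).trans h
  have h3 := Real.mul_self_sqrt hA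
  calc _ ≤ 2 * (√A * (40 * (τ / a) * √A)) := by linarith
    _ = 80 * (τ / a) * (√A * √A) := by ring
    _ = _ := by rw [h3]

end Dirichlet

/-! ### Energies of Sobolev functions and of the weight -/

theorem rpow_mul_exp_neg_le {z p : ℝ} (hz : 0 ≤ z) (hp0 : 0 ≤ p) (hp : p ≤ 4) :
    z ^ p * Real.exp (-z ^ 2 / 2) ≤ 8 := by
  have h1 : z ^ p ≤ 1 + z ^ 4 := by
    rcases le_total z 1 with h | h
    · have := Real.rpow_le_one hz h hp0
      nlinarith [pow_nonneg hz 4]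
    · have := Real.rpow_le_rpow_of_exponent_le h hp
      rw [show (4 : ℝ) = ((4 : ℕ) : ℝ) by norm_num, Real.rpow_natCast] at this
      linarith
  have h2 := Real.quadratic_le_exp_of_nonneg (by positivity : 0 ≤ z ^ 2 / 2)
  have h3 : 1 + z ^ 4 ≤ 8 * Real.exp (z ^ 2 / 2) := by nlinarith [sq_nonneg z]
  calc _ ≤ 8 * Real.exp (z ^ 2 / 2) * Real.exp (-z ^ 2 / 2) := by
        gcongr; exact h1.trans h3
    _ = 8 := by rw [mul_assoc, ← Real.exp_add]; ring_nf; simp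

/-- By scaling with `z = |h| / √r`, the Gaussian density of variance `r` lies below `8 r ^ κ |h| ^
(-(2κ + 1))`. This comparison with the Slobodeckij kernel bounds Gaussian energies at every scale.
-/
theorem heatKernel_mul_rpow_le {r κ : ℝ} (hr : 0 < r) (hκ : 0 ≤ κ) (hκ1 : κ ≤ 1) (h : ℝ) :
    heatKernel r h * |h| ^ (2 * κ + 1) ≤ 8 * r ^ κ := by
  have hs : 0 < √r := Real.sqrt_pos.2 hr
  set z := |h| / √r with hz
  have hz0 : 0 ≤ z := by positivity
  have e1 : |h| = √r * z := by rw [hz]; field_simp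
  have e2 : -h ^ 2 / (2 * r) = -z ^ 2 / 2 := by
    rw [← sq_abs h, e1, mul_pow, Real.sq_sqrt hr.le]; field_simp
  have e3 : (√r) ^ (2 * κ + 1) = r ^ κ * √r := by
    rw [Real.rpow_add hs, Real.rpow_one, Real.rpow_mul hs.le, Real.rpow_two, Real.sq_sqrt hr.le]
  have e4 : (√(2 * Real.pi * r))⁻¹ ≤ (√r)⁻¹ := by
    gcongr
    nlinarith [Real.pi_gt_three]
  have e5 := rpow_mul_exp_neg_le hz0 (by linarith : 0 ≤ 2 * κ + 1) (by linarith)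
  unfold heatKernel
  rw [e2, e1, Real.mul_rpow hs.le hz0, e3]
  calc _ ≤ (√r)⁻¹ * Real.exp (-z ^ 2 / 2) * (r ^ κ * √r * z ^ (2 * κ + 1)) := by gcongr
    _ = r ^ κ * (z ^ (2 * κ + 1) * Real.exp (-z ^ 2 / 2)) := by field_simp
    _ ≤ r ^ κ * 8 := by gcongr
    _ = _ := mul_comm _ _

theorem inv_sqrt_two_pi_le {r : ℝ} (hr : 0 < r) :
    (√(2 * Real.pi * r))⁻¹ ≤ 2 * (√(2 * Real.pi * (2 * r)))⁻¹ := by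
  have hpi := Real.pi_pos
  have p1 : 0 < √(2 * Real.pi * r) := by positivity
  have p2 : 0 < √(2 * Real.pi * (2 * r)) := by positivity
  have : √(2 * Real.pi * (2 * r)) ≤ 2 * √(2 * Real.pi * r) := by
    rw [show (2 : ℝ) * √(2 * Real.pi * r) = √4 * √(2 * Real.pi * r) by
      rw [show (4 : ℝ) = 2 ^ 2 by norm_num]; simp, ← Real.sqrt_mul (by norm_num)]
    exact Real.sqrt_le_sqrt (by nlinarith [mul_pos hpi hr])
  rw [inv_eq_one_div, ← div_eq_mul_inv, div_le_div_iff₀ p1 p2]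
  linarith

theorem heatKernel_mul_sq_le {r : ℝ} (hr : 0 < r) (h : ℝ) :
    heatKernel r h * h ^ 2 ≤ 8 * r * heatKernel (2 * r) h := by
  have e1 : h ^ 2 ≤ 4 * r * Real.exp (h ^ 2 / (4 * r)) := by
    have := Real.add_one_le_exp (h ^ 2 / (4 * r))
    have e : h ^ 2 = 4 * r * (h ^ 2 / (4 * r)) := by field_simp
    nlinarith
  have e2 : Real.exp (-h ^ 2 / (2 * r)) * Real.exp (h ^ 2 / (4 * r))
      = Real.exp (-h ^ 2 / (2 * (2 * r))) := by
    rw [← Real.exp_add]; congr 1; field_simp; ring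
  have e3 := inv_sqrt_two_pi_le hr
  unfold heatKernel
  calc _ ≤ (√(2 * Real.pi * r))⁻¹ * Real.exp (-h ^ 2 / (2 * r))
          * (4 * r * Real.exp (h ^ 2 / (4 * r))) := by gcongr
    _ = 4 * r * (√(2 * Real.pi * r))⁻¹ * Real.exp (-h ^ 2 / (2 * (2 * r))) := by rw [← e2]; ring
    _ ≤ 4 * r * (2 * (√(2 * Real.pi * (2 * r)))⁻¹) * Real.exp (-h ^ 2 / (2 * (2 * r))) := by
        gcongr
    _ = _ := by ring

theorem heatKernel_mul_abs_le {r : ℝ} (hr : 0 < r) (h : ℝ) :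
    heatKernel r h * |h| ≤ 6 * √r * heatKernel (2 * r) h := by
  have hs : 0 < √r := Real.sqrt_pos.2 hr
  have h1 := heatKernel_mul_sq_le hr h
  have h2 : heatKernel r h ≤ 2 * heatKernel (2 * r) h := by
    have e3 := inv_sqrt_two_pi_le hr
    have e4 : -h ^ 2 / (2 * r) ≤ -h ^ 2 / (2 * (2 * r)) := by
      rw [neg_div, neg_div, neg_le_neg_iff]
      exact div_le_div_of_nonneg_left (sq_nonneg h) (by positivity) (by linarith)
    unfold heatKernel
    rw [← mul_assoc]
    gcongr
  -- Arithmetic–geometric mean for `√r` and `h² / √r`: the first moment is reduced to the zeroth and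
  -- the second.
  have h3 : |h| ≤ (√r + h ^ 2 / √r) / 2 := by
    have : 0 ≤ (√r - |h|) ^ 2 / √r := by positivity
    have e : (√r - |h|) ^ 2 / √r = √r + h ^ 2 / √r - 2 * |h| := by
      rw [← sq_abs h]; field_simp; ring
    linarith
  have hk := heatKernel_nonneg r h
  have hq : √r * √r = r := Real.mul_self_sqrt hr.le
  calc _ ≤ heatKernel r h * ((√r + h ^ 2 / √r) / 2) := by gcongr
    _ = (√r * heatKernel r h + (heatKernel r h * h ^ 2) / √r) / 2 := by ring
    _ ≤ (√r * (2 * heatKernel (2 * r) h) + (8 * r * heatKernel (2 * r) h) / √r) / 2 := by gcongr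
    _ = √r * heatKernel (2 * r) h + 4 * (√r * √r) / √r * heatKernel (2 * r) h := by rw [hq]; ring
    _ = 5 * √r * heatKernel (2 * r) h := by field_simp; ring
    _ ≤ _ := by
      have := heatKernel_nonneg (2 * r) h
      gcongr
      norm_num

/-- Polynomial weights against a Gaussian are absorbed by doubling the variance. -/
theorem integral_mul_gaussLaw_le {r c : ℝ} (hr : 0 < r) {ρ U : ℝ → ℝ} (hρ : ∀ h, 0 ≤ ρ h)
    (hρr : ∀ h, heatKernel r h * ρ h ≤ c * heatKernel (2 * r) h) (hU : BddMeas U)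
    (hU0 : ∀ h, 0 ≤ U h) :
    ∫ h, ρ h * U h ∂(gaussLaw r) ≤ c * ∫ h, U h ∂(gaussLaw (2 * r)) := by
  rw [integral_gaussLaw hr, integral_gaussLaw (by positivity), ← integral_const_mul]
  have i : Integrable fun h ↦ heatKernel (2 * r) h * U h := by
    simpa [mul_comm] using hU.integrable_mul (integrable_heatKernel (by positivity : 0 < 2 * r))
  refine integral_mono_of_nonneg (ae_of_all _ fun h ↦ ?_) (i.const_mul _) (ae_of_all _ fun h ↦ ?_)
  · exact mul_nonneg (heatKernel_nonneg _ _) (mul_nonneg (hρ h) (hU0 h))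
  · simp only
    rw [← mul_assoc, ← mul_assoc]
    exact mul_le_mul_of_nonneg_right (hρr h) (hU0 h)

/-- The only place where the finiteness of the seminorm is used: the kernel comparison is integrated
against `(b (x + h) - b x)²`, after the translation `y = x + h`. -/
theorem energyLe_of_slobodeckij {κ : ℝ} (hκ : κ ∈ Set.Ioo (0 : ℝ) 1) {b : ℝ → ℝ}
    (hb : Measurable b) (hs : slobodeckijSeminorm κ b < ∞) :
    ∃ C, 0 ≤ C ∧ ∀ r, 0 < r → EnergyLe r b (C * r ^ κ) := by
  set S := ∫⁻ y : ℝ, ∫⁻ x : ℝ, ENNReal.ofReal (|b x - b y| ^ 2 / |x - y| ^ (2 * κ + 1)) with hS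
  have hStop : S ≠ ∞ := by
    intro h
    rw [slobodeckijSeminorm, ← hS, h, ENNReal.top_rpow_of_pos (by norm_num)] at hs
    exact lt_irrefl _ hs
  refine ⟨8 * S.toReal, by positivity, fun r hr ↦ ⟨by positivity, ?_⟩⟩
  have hp : 2 * κ + 1 ≠ 0 := by linarith [hκ.1]
  have pt (x h : ℝ) : ENNReal.ofReal (heatKernel r h) * ENNReal.ofReal ((b (x + h) - b x) ^ 2)
      ≤ ENNReal.ofReal (8 * r ^ κ) *
        ENNReal.ofReal (|b (h + x) - b x| ^ 2 / |h + x - x| ^ (2 * κ + 1)) := by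
    rw [← ENNReal.ofReal_mul (heatKernel_nonneg _ _), ← ENNReal.ofReal_mul (by positivity),
      add_sub_cancel_right, add_comm h x, sq_abs]
    refine ENNReal.ofReal_le_ofReal ?_
    -- At `h = 0` the kernel comparison cannot be divided by `|h| ^ (2 * κ + 1)`, but the increment
    -- of `b` vanishes.
    rcases eq_or_ne h 0 with rfl | h0
    · simp
    have ha : 0 < |h| ^ (2 * κ + 1) := Real.rpow_pos_of_pos (abs_pos.2 h0) _
    have := heatKernel_mul_rpow_le hr hκ.1.le hκ.2.le h
    rw [mul_div_assoc', le_div_iff₀ ha]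
    nlinarith [sq_nonneg (b (x + h) - b x)]
  calc _ ≤ ∫⁻ x, ∫⁻ h, ENNReal.ofReal (8 * r ^ κ) *
        ENNReal.ofReal (|b (h + x) - b x| ^ 2 / |h + x - x| ^ (2 * κ + 1)) := by
        refine lintegral_mono fun x ↦ ?_
        rw [lintegral_gaussLaw hr (by fun_prop)]
        exact lintegral_mono fun h ↦ pt x h
    _ = ENNReal.ofReal (8 * r ^ κ) * S := by
        rw [hS, ← lintegral_const_mul' _ _ ENNReal.ofReal_ne_top]
        refine lintegral_congr fun x ↦ ?_
        rw [lintegral_const_mul' _ _ ENNReal.ofReal_ne_top, lintegral_add_right_eq_self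
          (fun y ↦ ENNReal.ofReal (|b y - b x| ^ 2 / |y - x| ^ (2 * κ + 1))) x]
    _ = _ := by
        rw [← ENNReal.ofReal_toReal hStop, ← ENNReal.ofReal_mul (by positivity),
          ENNReal.toReal_ofReal (by positivity)]
        congr 1; ring

theorem lintegral_sq_gaussLaw {r : ℝ} (hr : 0 ≤ r) :
    ∫⁻ h, ENNReal.ofReal (h ^ 2) ∂(gaussLaw r) = ENNReal.ofReal r := by
  have h1 := variance_id_gaussianReal (μ := 0) (v := r.toNNReal)
  have h2 : MemLp (id : ℝ → ℝ) 2 (gaussLaw r) := memLp_id_gaussianReal 2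
  rw [variance_eq_sub h2, Pi.pow_def] at h1
  simp only [id, integral_id_gaussianReal] at h1
  have h3 := ofReal_integral_eq_lintegral_ofReal h2.integrable_sq
    (ae_of_all _ fun _ ↦ sq_nonneg _)
  simp only [id] at h3
  rw [← h3]
  congr 1
  simpa [hr] using h1

/-- The product of a function with a bounded Lipschitz weight. -/
theorem EnergyLe.lipschitz_mul {w f : ℝ → ℝ} {r A E K ℓ : ℝ} (hr : 0 ≤ r) (hf : SqBound f A)
    (hE : EnergyLe r f E) (hw : Measurable w) (hwK : ∀ x, |w x| ≤ K)
    (hwℓ : ∀ x h, |w (x + h) - w x| ≤ ℓ * |h|) :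
    EnergyLe r (fun x ↦ w x * f x) (2 * (K ^ 2 * E) + 2 * (ℓ ^ 2 * A * r)) := by
  have hfm := hf.meas
  have hA := hf.nonneg
  have hE0 := hE.nonneg
  refine EnergyLe.of_abs_le (u := fun p ↦ w (p.1 + p.2) * (f (p.1 + p.2) - f p.1))
    (v := fun p ↦ f p.1 * (ℓ * p.2)) (by fun_prop) (fun x k ↦ ?_) (by positivity) (by positivity)
    (hE.lintegral_mul_sub_le (w := fun p ↦ w (p.1 + p.2)) fun p ↦ hwK _) ?_
  · rw [show w (x + k) * f (x + k) - w x * f x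
      = w (x + k) * (f (x + k) - f x) + f x * (w (x + k) - w x) by ring]
    refine (abs_add_le _ _).trans ?_
    gcongr 1
    rw [abs_mul, abs_mul, abs_mul]
    gcongr
    exact (hwℓ x k).trans (by gcongr; exact le_abs_self ℓ)
  · have e : ∀ x, ∫⁻ k, ENNReal.ofReal ((f x * (ℓ * k)) ^ 2) ∂(gaussLaw r)
        = ENNReal.ofReal (ℓ ^ 2 * r) * ENNReal.ofReal (f x ^ 2) := fun x ↦ by
      have : ∀ k : ℝ, ENNReal.ofReal ((f x * (ℓ * k)) ^ 2)
          = ENNReal.ofReal (f x ^ 2 * ℓ ^ 2) * ENNReal.ofReal (k ^ 2) := fun k ↦ by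
        rw [← ENNReal.ofReal_mul (by positivity)]; congr 1; ring
      simp_rw [this]
      rw [lintegral_const_mul' _ _ (by simp), lintegral_sq_gaussLaw hr,
        ← ENNReal.ofReal_mul (by positivity), ← ENNReal.ofReal_mul (by positivity)]
      congr 1; ring
    simp only [e]
    rw [lintegral_const_mul' _ _ (by simp), show ℓ ^ 2 * A * r = ℓ ^ 2 * r * A by ring,
      ENNReal.ofReal_mul (by positivity : 0 ≤ ℓ ^ 2 * r)]
    gcongr
    exact hf.le

theorem abs_exp_sub_one_le (u : ℝ) : |Real.exp u - 1| ≤ |u| * Real.exp |u| := by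
  have h1 := Real.add_one_le_exp u
  have h2 := Real.add_one_le_exp (-u)
  have h3 : Real.exp u * Real.exp (-u) = 1 := by rw [← Real.exp_add]; simp
  have h4 := Real.exp_pos u
  rcases le_total 0 u with hu | hu
  · rw [abs_of_nonneg hu, abs_of_nonneg (by linarith)]
    nlinarith
  · rw [abs_of_nonpos hu, abs_of_nonpos (by linarith [Real.exp_le_one_iff.2 hu])]
    have := Real.one_le_exp (by linarith : 0 ≤ -u)
    nlinarith

theorem abs_exp_sub_one_sub_le (u : ℝ) :
    |Real.exp u - 1 - u| ≤ u ^ 2 * Real.exp |u| := by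
  have h1 := Real.add_one_le_exp u
  have h2 := Real.add_one_le_exp (-u)
  have h3 : Real.exp u * Real.exp (-u) = 1 := by rw [← Real.exp_add]; simp
  have h4 := Real.exp_pos u
  rw [abs_of_nonneg (by linarith)]
  have h5 : Real.exp u - 1 - u ≤ u * (Real.exp u - 1) := by nlinarith
  calc _ ≤ |u * (Real.exp u - 1)| := h5.trans (le_abs_self _)
    _ ≤ |u| * (|u| * Real.exp |u|) := by
      rw [abs_mul]; gcongr; exact abs_exp_sub_one_le u
    _ = _ := by rw [← mul_assoc, ← sq, sq_abs]

/-! ### The drift weight and its expansion under the heat semigroup -/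

section Weight

variable {b : ℝ → ℝ} {M L : ℝ}

theorem abs_intervalIntegral_le_integral_abs (hbi : Integrable b) (x y : ℝ) :
    |∫ z in x..y, b z| ≤ ∫ z, |b z| := by
  refine (intervalIntegral.norm_integral_le_integral_norm_uIoc (f := b) (μ := volume)
    (a := x) (b := y)).trans ?_
  exact setIntegral_le_integral hbi.abs (ae_of_all _ fun _ ↦ abs_nonneg _)

theorem driftWeight_add (hbi : Integrable b) (x h : ℝ) :
    driftWeight b (x + h) = driftWeight b x * Real.exp (-2 * ∫ z in x..(x + h), b z) := by
  rw [driftWeight, driftWeight, ← Real.exp_add, ← mul_add,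
    intervalIntegral.integral_add_adjacent_intervals hbi.intervalIntegrable
      hbi.intervalIntegrable]

theorem measurable_driftWeight (hbi : Integrable b) : Measurable (driftWeight b) := by
  have := intervalIntegral.continuous_primitive
    (fun _ _ ↦ hbi.intervalIntegrable : ∀ x y, IntervalIntegrable b volume x y) 0
  exact (Real.continuous_exp.comp (continuous_const.mul this)).measurable

theorem abs_driftWeight_le (hL : ∀ x y, |∫ z in x..y, b z| ≤ L) (x : ℝ) :
    |driftWeight b x| ≤ Real.exp (2 * L) := by
  rw [driftWeight, abs_of_pos (Real.exp_pos _), Real.exp_le_exp]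
  linarith [neg_abs_le (∫ z in (0 : ℝ)..x, b z), hL 0 x]

theorem exp_abs_primitive_le (hL : ∀ x y, |∫ z in x..y, b z| ≤ L) (x y : ℝ) :
    Real.exp |-2 * ∫ z in x..y, b z| ≤ Real.exp (2 * L) := by
  rw [Real.exp_le_exp, abs_mul]
  norm_num
  exact hL x y

theorem abs_primitive_le (hM : ∀ x, |b x| ≤ M) (x h : ℝ) :
    |∫ z in x..(x + h), b z| ≤ M * |h| := by
  have := intervalIntegral.norm_integral_le_of_norm_le_const (a := x) (b := x + h) (f := b)
    (C := M) (fun z _ ↦ hM z)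
  simpa using this

theorem abs_driftWeight_sub_le (hbi : Integrable b) (hM : ∀ x, |b x| ≤ M)
    (hL : ∀ x y, |∫ z in x..y, b z| ≤ L) (x h : ℝ) :
    |driftWeight b (x + h) - driftWeight b x| ≤ 2 * M * Real.exp (2 * L) ^ 2 * |h| := by
  rw [driftWeight_add hbi, show ∀ a c : ℝ, a * c - a = a * (c - 1) by intros; ring, abs_mul]
  calc _ ≤ Real.exp (2 * L) * (2 * (M * |h|) * Real.exp (2 * L)) := by
        refine mul_le_mul (abs_driftWeight_le hL x) ((abs_exp_sub_one_le _).trans ?_)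
          (abs_nonneg _) (Real.exp_pos _).le
        refine mul_le_mul ?_ (exp_abs_primitive_le hL _ _) (Real.exp_pos _).le
          (mul_nonneg zero_le_two ((abs_nonneg _).trans (abs_primitive_le hM x h)))
        rw [abs_mul]
        norm_num
        exact abs_primitive_le hM x h
    _ = _ := by ring

/-- The uniform law on the unit interval. -/
noncomputable abbrev unitLaw : Measure ℝ := volume.restrict (Set.Ioc 0 1)

instance : IsProbabilityMeasure unitLaw := ⟨by simp⟩

/-- The mean increment of `b` along the segment from `x` to `x + h`. -/
noncomputable def meanIncrement (b : ℝ → ℝ) (p : ℝ × ℝ) : ℝ :=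
  ∫ θ, |b (p.1 + p.2 * θ) - b p.1| ∂unitLaw

theorem meanIncrement_nonneg (p : ℝ × ℝ) : 0 ≤ meanIncrement b p :=
  integral_nonneg fun _ ↦ abs_nonneg _

theorem BddMeas.meanIncrement (hb : BddMeas b) : BddMeas (meanIncrement b) :=
  BddMeas.integral (F := fun q : (ℝ × ℝ) × ℝ ↦ |b (q.1.1 + q.1.2 * q.2) - b q.1.1|)
    ((hb.comp (by fun_prop)).sub (hb.comp (by fun_prop))).abs _

/-- The primitive over the segment is `h` times the mean of `b` there. Comparing with `h * b x`
measures how far `b` is from its value at the base point, without any pointwise regularity. -/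
theorem abs_primitive_sub_le (hb : BddMeas b) (x h : ℝ) :
    |(∫ z in x..(x + h), b z) - h * b x| ≤ |h| * meanIncrement b (x, h) := by
  have e : ∫ z in x..(x + h), b z = h * ∫ θ, b (x + h * θ) ∂unitLaw := by
    have := intervalIntegral.smul_integral_comp_add_mul (a := 0) (b := 1) b h x
    rw [intervalIntegral.integral_of_le zero_le_one] at this
    simpa using this.symm
  have i : BddMeas fun θ ↦ b (x + h * θ) := hb.comp (by fun_prop)
  have e2 : (∫ z in x..(x + h), b z) - h * b x = h * ∫ θ, (b (x + h * θ) - b x) ∂unitLaw := by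
    rw [e, integral_sub (i.integrable _) (integrable_const _)]
    simp [mul_sub]
  rw [e2, abs_mul]
  gcongr
  exact abs_integral_le_integral_abs

/-- Jensen in `θ` and Tonelli reduce to a fixed `θ`. If `N` has variance `r` then `θ N` has variance
`θ² r ≤ r`, so the energy of `b` at a smaller scale applies. -/
theorem lintegral_meanIncrement_sq_le (hb : BddMeas b) {κ C r : ℝ} (hr : 0 < r) (hκ : 0 < κ)
    (hE : ∀ r, 0 < r → EnergyLe r b (C * r ^ κ)) :
    ∫⁻ x, ∫⁻ h, ENNReal.ofReal (meanIncrement b (x, h) ^ 2) ∂(gaussLaw r)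
      ≤ ENNReal.ofReal (C * r ^ κ) := by
  have hm : Measurable b := hb.meas
  have hC : 0 ≤ C := by simpa using (hE 1 one_pos).nonneg
  have mF : Measurable fun q : (ℝ × ℝ) × ℝ ↦
      ENNReal.ofReal ((b (q.1.1 + q.1.2 * q.2) - b q.1.1) ^ 2) := by fun_prop
  have step (θ : ℝ) (hθ : θ ∈ Set.Ioc (0 : ℝ) 1) :
      ∫⁻ x, ∫⁻ h, ENNReal.ofReal ((b (x + h * θ) - b x) ^ 2) ∂(gaussLaw r)
        ≤ ENNReal.ofReal (C * r ^ κ) := by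
    have hθr : 0 < θ ^ 2 * r := mul_pos (pow_pos hθ.1 2) hr
    have hmap : (gaussLaw r).map (fun h ↦ h * θ) = gaussLaw (θ ^ 2 * r) := by
      rw [gaussLaw, gaussianReal_map_mul_const, gaussLaw]
      congr 1
      · simp
      · ext; simp [hr.le, hθr.le]
    have hle := (hE (θ ^ 2 * r) hθr).le
    rw [← hmap] at hle
    have e (x : ℝ) : ∫⁻ h, ENNReal.ofReal ((b (x + h) - b x) ^ 2)
        ∂((gaussLaw r).map (fun h ↦ h * θ))
        = ∫⁻ h, ENNReal.ofReal ((b (x + h * θ) - b x) ^ 2) ∂(gaussLaw r) :=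
      lintegral_map (by fun_prop) (by fun_prop)
    simp only [e] at hle
    refine hle.trans (ENNReal.ofReal_le_ofReal ?_)
    have : θ ^ 2 * r ≤ r := mul_le_of_le_one_left hr.le (pow_le_one₀ hθ.1.le hθ.2)
    gcongr
  have hs : Measurable fun q : (ℝ × ℝ) × ℝ ↦
      ENNReal.ofReal ((b (q.1.1 + q.2 * q.1.2) - b q.1.1) ^ 2) := by fun_prop
  have hs2 : Measurable fun q : ℝ × ℝ ↦
      ∫⁻ h, ENNReal.ofReal ((b (q.1 + h * q.2) - b q.1) ^ 2) ∂(gaussLaw r) :=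
    hs.lintegral_prod_right'
  calc _ ≤ ∫⁻ x, ∫⁻ h, ∫⁻ θ, ENNReal.ofReal ((b (x + h * θ) - b x) ^ 2) ∂unitLaw
          ∂(gaussLaw r) := by
        refine lintegral_mono fun x ↦ lintegral_mono fun h ↦ ?_
        have i : BddMeas fun θ ↦ b (x + h * θ) - b x :=
          (hb.comp (by fun_prop)).sub (BddMeas.const _)
        rw [← ofReal_integral_sq i]
        have := sq_integral_le i.abs unitLaw
        simp only [sq_abs] at this
        exact ENNReal.ofReal_le_ofReal this
    _ = ∫⁻ x, ∫⁻ θ, ∫⁻ h, ENNReal.ofReal ((b (x + h * θ) - b x) ^ 2) ∂(gaussLaw r)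
          ∂unitLaw := by
        refine lintegral_congr fun x ↦ lintegral_lintegral_swap ?_
        exact Measurable.aemeasurable (by fun_prop)
    _ = ∫⁻ θ, (∫⁻ x, ∫⁻ h, ENNReal.ofReal ((b (x + h * θ) - b x) ^ 2) ∂(gaussLaw r))
          ∂unitLaw := lintegral_lintegral_swap hs2.aemeasurable
    _ ≤ ∫⁻ _, ENNReal.ofReal (C * r ^ κ) ∂unitLaw :=
        lintegral_mono_ae (ae_restrict_of_forall_mem measurableSet_Ioc step)
    _ = _ := by simp

/-- Taylor expansion of `w (x + h) = w x * exp (-2 I)` with `I` the integral of `b` over the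
segment. The linear term `-2 b(x) h` has mean zero under the Gaussian, so what is left is the error
in `I ≈ h b(x)` and the quadratic term of the exponential. The moments `|h|` and `h²` in front of
the mean increment are absorbed by doubling the variance. -/
theorem abs_heat_driftWeight_sub_le (hb : BddMeas b) (hbi : Integrable b)
    (hM : ∀ x, |b x| ≤ M) (hL : ∀ x y, |∫ z in x..y, b z| ≤ L) {τ : ℝ} (hτ : 0 < τ) (x : ℝ) :
    |heat τ (driftWeight b) x - driftWeight b x| ≤ Real.exp (2 * L) *
      ((12 * √τ + 32 * M * Real.exp (2 * L) * τ)
        * (∫ h, meanIncrement b (x, h) ∂(gaussLaw (2 * τ)))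
        + 4 * M * Real.exp (2 * L) * τ * |b x|) := by
  set K := Real.exp (2 * L) with hK
  have hK0 : 0 < K := Real.exp_pos _
  have hM0 : 0 ≤ M := (abs_nonneg _).trans (hM 0)
  have hw : BddMeas (driftWeight b) :=
    ⟨measurable_driftWeight hbi, K, abs_driftWeight_le hL⟩
  let I : ℝ → ℝ := fun h ↦ ∫ z in x..(x + h), b z
  have hI : BddMeas I := by
    refine ⟨?_, L, fun h ↦ hL _ _⟩
    have := intervalIntegral.continuous_primitive
      (fun _ _ ↦ hbi.intervalIntegrable : ∀ x y, IntervalIntegrable b volume x y) x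
    exact (this.comp (continuous_const.add continuous_id)).measurable
  let U : ℝ → ℝ := fun h ↦ meanIncrement b (x, h)
  have hU : BddMeas U := hb.meanIncrement.comp (by fun_prop)
  have hU0 (h : ℝ) : 0 ≤ U h := meanIncrement_nonneg _
  let X : ℝ → ℝ := fun h ↦ Real.exp (-2 * I h)
  have hX : BddMeas X := by
    have hm := hI.meas
    refine ⟨by fun_prop, K, fun h ↦ ?_⟩
    rw [abs_of_pos (Real.exp_pos _)]
    exact (Real.exp_le_exp.2 (le_abs_self _)).trans (exp_abs_primitive_le hL x (x + h))
  have hid : Integrable (fun h : ℝ ↦ h) (gaussLaw τ) :=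
    (memLp_id_gaussianReal 1).integrable (by simp)
  have hsq : Integrable (fun h : ℝ ↦ h ^ 2) (gaussLaw τ) :=
    (memLp_id_gaussianReal 2 : MemLp id (2 : NNReal) (gaussLaw τ)).integrable_sq
  have hsq_int : ∫ h, h ^ 2 ∂(gaussLaw τ) = τ := by
    have := ofReal_integral_eq_lintegral_ofReal hsq (ae_of_all _ fun _ ↦ sq_nonneg _)
    rw [lintegral_sq_gaussLaw hτ.le] at this
    exact (ENNReal.ofReal_eq_ofReal_iff (integral_nonneg fun _ ↦ sq_nonneg _) hτ.le).1 this
  -- The centred term `2 * b x * h` is inserted for free; it cancels the first-order part of the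
  -- exponential.
  have e1 : heat τ (driftWeight b) x - driftWeight b x
      = driftWeight b x * ∫ h, (X h - 1 + 2 * b x * h) ∂(gaussLaw τ) := by
    have i1 : Integrable (fun h ↦ X h - 1) (gaussLaw τ) :=
      (hX.integrable _).sub (integrable_const _)
    rw [integral_add i1 (hid.const_mul _), integral_const_mul,
      show ∫ h, h ∂(gaussLaw τ) = 0 from integral_id_gaussianReal, mul_zero, add_zero,
      integral_sub (hX.integrable _) (integrable_const _)]
    simp only [heat, driftWeight_add hbi, integral_const_mul]
    simp [X, I]
    ring
  have e2 (h : ℝ) : |X h - 1 + 2 * b x * h|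
      ≤ 2 * (|h| * U h) + 4 * M * K * (h ^ 2 * U h) + 4 * M * K * |b x| * h ^ 2 := by
    have a1 : |I h - h * b x| ≤ |h| * U h := abs_primitive_sub_le hb x h
    have a2 : |I h| ≤ M * |h| := abs_primitive_le hM x h
    have a3 : |I h| ≤ |h| * U h + |h| * |b x| := by
      calc |I h| = |(I h - h * b x) + h * b x| := by ring_nf
        _ ≤ _ := (abs_add_le _ _).trans (by rw [abs_mul h]; gcongr)
    have a4 : |X h - 1 - -2 * I h| ≤ (-2 * I h) ^ 2 * K :=
      (abs_exp_sub_one_sub_le _).trans (by gcongr; exact exp_abs_primitive_le hL _ _)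
    -- One factor is bounded by `M * |h|`, the other keeps its dependence on `b`, so that the result
    -- is square integrable in `x`.
    have a5 : I h ^ 2 ≤ M * |h| * (|h| * U h + |h| * |b x|) := by
      rw [← sq_abs, sq]
      exact mul_le_mul a2 a3 (abs_nonneg _) (by positivity)
    have a6 : M * |h| * (|h| * U h + |h| * |b x|) = M * (h ^ 2 * U h + h ^ 2 * |b x|) := by
      rw [← sq_abs h]; ring
    calc |X h - 1 + 2 * b x * h|
        = |(X h - 1 - -2 * I h) + -2 * (I h - h * b x)| := by ring_nf
      _ ≤ (-2 * I h) ^ 2 * K + 2 * (|h| * U h) := by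
        refine (abs_add_le _ _).trans (add_le_add a4 ?_)
        rw [abs_mul]; norm_num; exact a1
      _ = 4 * K * I h ^ 2 + 2 * (|h| * U h) := by ring
      _ ≤ 4 * K * (M * (h ^ 2 * U h + h ^ 2 * |b x|)) + 2 * (|h| * U h) := by
        rw [← a6]; gcongr
      _ = _ := by ring
  have i1 : Integrable (fun h ↦ |h| * U h) (gaussLaw τ) := by
    simpa [mul_comm] using hU.integrable_mul hid.abs
  have i2 : Integrable (fun h ↦ h ^ 2 * U h) (gaussLaw τ) := by
    simpa [mul_comm] using hU.integrable_mul hsq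
  have b1 : ∫ h, |h| * U h ∂(gaussLaw τ) ≤ 6 * √τ * ∫ h, U h ∂(gaussLaw (2 * τ)) :=
    integral_mul_gaussLaw_le hτ (fun _ ↦ abs_nonneg _) (heatKernel_mul_abs_le hτ) hU hU0
  have b2 : ∫ h, h ^ 2 * U h ∂(gaussLaw τ) ≤ 8 * τ * ∫ h, U h ∂(gaussLaw (2 * τ)) :=
    integral_mul_gaussLaw_le hτ (fun _ ↦ sq_nonneg _) (heatKernel_mul_sq_le hτ) hU hU0
  rw [e1, abs_mul]
  refine mul_le_mul (abs_driftWeight_le hL x) ?_ (abs_nonneg _) hK0.le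
  calc _ ≤ ∫ h, (2 * (|h| * U h) + 4 * M * K * (h ^ 2 * U h) + 4 * M * K * |b x| * h ^ 2)
          ∂(gaussLaw τ) :=
        (abs_integral_le_integral_abs).trans (integral_mono_of_nonneg
          (ae_of_all _ fun _ ↦ abs_nonneg _)
          (((i1.const_mul 2).add (i2.const_mul _)).add (hsq.const_mul _)) (ae_of_all _ e2))
    _ = 2 * (∫ h, |h| * U h ∂(gaussLaw τ)) + 4 * M * K * (∫ h, h ^ 2 * U h ∂(gaussLaw τ))
          + 4 * M * K * |b x| * τ := by
        rw [integral_add (by exact (i1.const_mul 2).add (i2.const_mul _)) (hsq.const_mul _),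
          integral_add (i1.const_mul 2) (i2.const_mul _), integral_const_mul, integral_const_mul,
          integral_const_mul, hsq_int]
    _ ≤ 2 * (6 * √τ * ∫ h, U h ∂(gaussLaw (2 * τ)))
          + 4 * M * K * (8 * τ * ∫ h, U h ∂(gaussLaw (2 * τ))) + 4 * M * K * |b x| * τ := by
        gcongr
    _ = _ := by ring

/-- Squaring the pointwise bound, `√τ` times the mean increment gives `τ * τ ^ κ`, and `τ * |b|`
gives `τ²`, which is at most `R ^ (1 - κ) * τ ^ (1 + κ)` for `τ ≤ R`. -/
theorem sqBound_heat_driftWeight_sub (hb : BddMeas b) (hbi : Integrable b)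
    (hM : ∀ x, |b x| ≤ M) (hL : ∀ x y, |∫ z in x..y, b z| ≤ L) {κ C B R : ℝ}
    (hκ : κ ∈ Set.Ioo (0 : ℝ) 1) (hR : 0 < R) (hE : ∀ r, 0 < r → EnergyLe r b (C * r ^ κ))
    (hB : SqBound b B) :
    ∃ D, 0 ≤ D ∧ ∀ τ, 0 < τ → τ ≤ R →
      SqBound (fun x ↦ heat τ (driftWeight b) x - driftWeight b x) (D * τ ^ (1 + κ)) := by
  have hM0 : 0 ≤ M := (abs_nonneg _).trans (hM 0)
  have hC : 0 ≤ C := by simpa using (hE 1 one_pos).nonneg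
  have hB0 := hB.nonneg
  have hw : BddMeas (driftWeight b) :=
    ⟨measurable_driftWeight hbi, _, abs_driftWeight_le hL⟩
  set K := Real.exp (2 * L) with hK
  have hK0 : 0 < K := Real.exp_pos _
  set c₁ := K * (12 + 32 * M * K * √R) with hc₁
  set c₂ := K * (4 * M * K) with hc₂
  refine ⟨2 * (c₁ ^ 2 * (C * 2 ^ κ)) + 2 * (c₂ ^ 2 * R ^ (1 - κ) * B), by positivity,
    fun τ hτ hτR ↦ ?_⟩
  have s1 : SqBound (fun x ↦ c₁ * √τ * ∫ h, meanIncrement b (x, h) ∂(gaussLaw (2 * τ)))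
      ((c₁ * √τ) ^ 2 * (C * (2 * τ) ^ κ)) := by
    refine SqBound.of_integral hb.meanIncrement (gaussLaw (2 * τ))
      ((BddMeas.const _).mul (hb.meanIncrement.integral _)) (by positivity) (fun x ↦ ?_)
      (lintegral_meanIncrement_sq_le hb (by positivity) hκ.1 hE)
    rw [abs_mul, abs_of_nonneg (by positivity : 0 ≤ c₁ * √τ)]
    gcongr
    exact abs_integral_le_integral_abs
  have s2 : SqBound (fun x ↦ c₂ * τ * |b x|) ((c₂ * τ) ^ 2 * B) :=
    hB.of_abs_le ((BddMeas.const _).mul hb.abs) fun x ↦ by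
      rw [abs_mul, abs_abs, abs_of_nonneg (by positivity : 0 ≤ c₂ * τ)]
  have s3 := (s1.add s2).of_abs_le (c := 1) ((hw.heat τ).sub hw) fun x ↦ by
    have hu : 0 ≤ ∫ h, meanIncrement b (x, h) ∂(gaussLaw (2 * τ)) :=
      integral_nonneg fun _ ↦ meanIncrement_nonneg _
    refine (abs_heat_driftWeight_sub_le hb hbi hM hL hτ x).trans
      (le_trans (Eq.trans_le (b := K * (12 * √τ + 32 * M * K * (√τ * √τ))
        * (∫ h, meanIncrement b (x, h) ∂(gaussLaw (2 * τ))) + c₂ * τ * |b x|) ?_ ?_)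
        ((le_abs_self _).trans_eq (one_mul _).symm))
    · rw [Real.mul_self_sqrt hτ.le, hc₂]; ring
    · have : K * (12 * √τ + 32 * M * K * (√τ * √τ)) ≤ c₁ * √τ := by
        rw [hc₁]
        calc _ ≤ K * (12 * √τ + 32 * M * K * (√R * √τ)) := by gcongr
          _ = _ := by ring
      gcongr
  refine s3.mono (Eq.trans_le
    (b := 2 * (c₁ ^ 2 * (C * 2 ^ κ)) * τ ^ (1 + κ) + 2 * (c₂ ^ 2 * B) * τ ^ 2) ?_ ?_)
  · rw [mul_pow, Real.sq_sqrt hτ.le, Real.mul_rpow (by norm_num) hτ.le, Real.rpow_add hτ,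
      Real.rpow_one]
    ring
  · have : τ ^ 2 ≤ R ^ (1 - κ) * τ ^ (1 + κ) := by
      calc τ ^ 2 = τ ^ (1 - κ) * τ ^ (1 + κ) := by
            rw [← Real.rpow_add hτ, ← Real.rpow_natCast]; norm_num
        _ ≤ _ := by
          have := hκ.2
          gcongr
    calc _ ≤ 2 * (c₁ ^ 2 * (C * 2 ^ κ)) * τ ^ (1 + κ)
          + 2 * (c₂ ^ 2 * B) * (R ^ (1 - κ) * τ ^ (1 + κ)) := by gcongr
      _ = _ := by ring

/-- Product rule: the weight is bounded and Lipschitz. Its own increments contribute a term linear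
in `r`, which is of lower order than `r ^ κ` on bounded ranges. -/
theorem energyLe_driftWeight_mul (hbi : Integrable b) (hM : ∀ x, |b x| ≤ M)
    (hL : ∀ x y, |∫ z in x..y, b z| ≤ L) {κ C B R : ℝ} (hκ : κ ∈ Set.Ioo (0 : ℝ) 1)
    (hE : ∀ r, 0 < r → EnergyLe r b (C * r ^ κ)) (hB : SqBound b B) :
    ∃ D, 0 ≤ D ∧ ∀ r, 0 < r → r ≤ R →
      EnergyLe r (fun x ↦ driftWeight b x * b x) (D * r ^ κ) := by
  have hC : 0 ≤ C := by simpa using (hE 1 one_pos).nonneg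
  have hB0 := hB.nonneg
  rcases le_or_gt R 0 with hR | hR
  · exact ⟨0, le_rfl, fun r hr hrR ↦ absurd (hr.trans_le hrR) hR.not_gt⟩
  set K := Real.exp (2 * L)
  set ℓ := 2 * M * K ^ 2
  refine ⟨2 * (K ^ 2 * C) + 2 * (ℓ ^ 2 * B) * R ^ (1 - κ), by positivity, fun r hr hrR ↦ ?_⟩
  refine (EnergyLe.lipschitz_mul hr.le hB (hE r hr) (measurable_driftWeight hbi)
    (abs_driftWeight_le hL) (abs_driftWeight_sub_le hbi hM hL)).mono ?_
  have : r ≤ R ^ (1 - κ) * r ^ κ := by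
    calc r = r ^ (1 - κ) * r ^ κ := by rw [← Real.rpow_add hr]; norm_num
      _ ≤ _ := by
        have := hκ.2
        gcongr
  calc _ = 2 * (K ^ 2 * (C * r ^ κ)) + 2 * (ℓ ^ 2 * B) * r := by ring
    _ ≤ 2 * (K ^ 2 * (C * r ^ κ)) + 2 * (ℓ ^ 2 * B) * (R ^ (1 - κ) * r ^ κ) := by gcongr
    _ = _ := by ring

end Weight

/-! ### The four-point correlation estimate -/

/-- The quantitative hypotheses on a drift `b` and a weight `w` which enter the correlation
estimates, all with the same constant `C`. -/
structure WeightedDrift (κ R C : ℝ) (b w : ℝ → ℝ) : Prop where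
  κ_mem : κ ∈ Set.Ioo (0 : ℝ) 1
  one_le : 1 ≤ C
  abs_b_le : ∀ x, |b x| ≤ C
  meas_w : Measurable w
  abs_w_le : ∀ x, |w x| ≤ C
  lipschitz_w : ∀ x h, |w (x + h) - w x| ≤ C * |h|
  sq_b : SqBound b C
  energy_b : ∀ r, 0 < r → EnergyLe r b (C * r ^ κ)
  energy_mul : ∀ r, 0 < r → r ≤ R → EnergyLe r (fun x ↦ w x * b x) (C * r ^ κ)
  heat_w : ∀ r, 0 < r → r ≤ R → SqBound (fun x ↦ heat r w x - w x) (C * r ^ (1 + κ))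

/-- The `L¹` norm of `b` bounds all its oriented integrals, hence `w`. Boundedness together with
integrability makes `b` square integrable. -/
theorem exists_weightedDrift {κ R : ℝ} (hR : 0 < R) (hκ : κ ∈ Set.Ioo (0 : ℝ) 1) {b : ℝ → ℝ}
    (hb_meas : Measurable b) (hb_bdd : ∃ M : ℝ, ∀ x, |b x| ≤ M) (hb_int : Integrable b)
    (hb_sob : slobodeckijSeminorm κ b < ∞) : ∃ C, WeightedDrift κ R C b (driftWeight b) := by
  obtain ⟨M, hM⟩ := hb_bdd
  have hb : BddMeas b := ⟨hb_meas, M, hM⟩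
  have hM0 : 0 ≤ M := (abs_nonneg _).trans (hM 0)
  have hL := abs_intervalIntegral_le_integral_abs hb_int
  set L := ∫ z, |b z|
  have hsq : Integrable fun x ↦ b x ^ 2 := by
    simpa [sq] using hb.integrable_mul hb_int
  have hB : SqBound b (∫ x, b x ^ 2) := ⟨hb, integral_nonneg fun _ ↦ sq_nonneg _,
    (ofReal_integral_eq_lintegral_ofReal hsq (ae_of_all _ fun _ ↦ sq_nonneg _)).ge⟩
  set B := ∫ x, b x ^ 2
  obtain ⟨C₁, hC₁, hE⟩ := energyLe_of_slobodeckij hκ hb_meas hb_sob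
  obtain ⟨C₂, hC₂, hE₂⟩ := energyLe_driftWeight_mul (R := R) hb_int hM hL hκ hE hB
  obtain ⟨C₃, hC₃, hE₃⟩ := sqBound_heat_driftWeight_sub hb hb_int hM hL hκ hR hE hB
  have hB0 := hB.nonneg
  have hK := Real.exp_pos (2 * L)
  set K := Real.exp (2 * L)
  set ℓ := 2 * M * K ^ 2
  have hℓ : 0 ≤ ℓ := by positivity
  refine ⟨1 + M + B + K + ℓ + C₁ + C₂ + C₃, hκ, by linarith, fun x ↦ (hM x).trans (by linarith),
    measurable_driftWeight hb_int, fun x ↦ (abs_driftWeight_le hL x).trans (by linarith),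
    fun x h ↦ (abs_driftWeight_sub_le hb_int hM hL x h).trans ?_, hB.mono (by linarith),
    fun r hr ↦ (hE r hr).mono ?_, fun r hr hrR ↦ (hE₂ r hr hrR).mono ?_,
    fun r hr hrR ↦ (hE₃ r hr hrR).mono ?_⟩ <;> gcongr <;> linarith

/-- `E[w(y + N) (b(y + N) - b(y))]` for `N ∼ N(0, τ)`. -/
noncomputable def weightedIncrement (b w : ℝ → ℝ) (τ y : ℝ) : ℝ :=
  heat τ (fun x ↦ w x * b x) y - b y * heat τ w y

/-- The covariance of two weighted increments of `b` along a Brownian path issued from `x₀`: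
the first over a time span `σ` after time `t`, the second over a time span `τ` after a further
waiting time `a`. -/
noncomputable def incrementCorrelation (b w : ℝ → ℝ) (t σ a τ x₀ : ℝ) : ℝ :=
  heat t (weightedIncrement b (fun x ↦ w x * heat a (weightedIncrement b w τ) x) σ) x₀

theorem abs_sqrt_le_of_sq_le {x A c : ℝ} (hc : 0 ≤ c) (h : x ^ 2 ≤ c * A) :
    |x| ≤ √c * √A := by
  rw [← Real.sqrt_mul hc, ← Real.sqrt_sq_eq_abs]
  exact Real.sqrt_le_sqrt h

theorem heat_eq_integral_heatKernel {t : ℝ} (ht : 0 < t) (F : ℝ → ℝ) (x₀ : ℝ) :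
    heat t F x₀ = ∫ x, heatKernel t (x - x₀) * F x := by
  rw [heat, integral_gaussLaw ht,
    ← integral_add_right_eq_self (fun x ↦ heatKernel t (x - x₀) * F x) x₀]
  simp [add_comm]

/-- The density is at most `t ^ (-1/2)` everywhere, which trades the starting point for Lebesgue
measure. -/
theorem SqBound.heat_sq_le {f : ℝ → ℝ} {A t : ℝ} (hf : SqBound f A) (ht : 0 < t) (x₀ : ℝ) :
    _root_.heat t (fun x ↦ f x ^ 2) x₀ ≤ t ^ (-(1 / 2) : ℝ) * A := by
  rw [heat_eq_integral_heatKernel ht]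
  calc _ ≤ ∫ x, t ^ (-(1 / 2) : ℝ) * f x ^ 2 := by
        refine integral_mono_of_nonneg (ae_of_all _ fun x ↦ ?_) (hf.integrable_sq.const_mul _)
          (ae_of_all _ fun x ↦ ?_)
        · exact mul_nonneg (heatKernel_nonneg _ _) (sq_nonneg _)
        · exact mul_le_mul_of_nonneg_right (heatKernel_le ht _) (sq_nonneg _)
    _ ≤ _ := by
        rw [integral_const_mul]
        gcongr
        exact hf.integral_sq_le

theorem sqBound_heatKernel {t : ℝ} (ht : 0 < t) (x₀ : ℝ) :
    SqBound (fun x ↦ heatKernel t (x - x₀)) (t ^ (-(1 / 2) : ℝ)) := by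
  have hm := measurable_heatKernel t
  refine ⟨⟨by fun_prop, t ^ (-(1 / 2) : ℝ), fun x ↦ ?_⟩, by positivity, ?_⟩
  · rw [abs_of_nonneg (heatKernel_nonneg _ _)]; exact heatKernel_le ht _
  · have i : Integrable fun x ↦ heatKernel t (x - x₀) := (integrable_heatKernel ht).comp_sub_right x₀
    have i1 : ∫ x, heatKernel t (x - x₀) = 1 := by
      have := heat_eq_integral_heatKernel ht (fun _ ↦ 1) x₀
      simpa [heat] using this.symm
    calc _ ≤ ∫⁻ x, ENNReal.ofReal (t ^ (-(1 / 2) : ℝ) * heatKernel t (x - x₀)) := by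
          refine lintegral_mono fun x ↦ ENNReal.ofReal_le_ofReal ?_
          rw [sq]
          exact mul_le_mul_of_nonneg_right (heatKernel_le ht _) (heatKernel_nonneg _ _)
      _ = _ := by
          rw [← ofReal_integral_eq_lintegral_ofReal (i.const_mul _)
            (ae_of_all _ fun x ↦ mul_nonneg (by positivity) (heatKernel_nonneg _ _)),
            integral_const_mul, i1, mul_one]

/-- Pairing with the kernel `q` is evaluation of `P_t` at `x₀`, so the Dirichlet form of `q` is `P_t
q (x₀) - P_{t+τ} q (x₀)`. The smoothing bound and `q ≤ t ^ (-1/2)` conclude. -/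
theorem energyLe_heatKernel {t τ : ℝ} (ht : 0 < t) (hτ : 0 ≤ τ) (hτt : τ ≤ 4 * t) (x₀ : ℝ) :
    EnergyLe τ (fun x ↦ heatKernel t (x - x₀)) (80 * τ * t ^ (-(3 / 2) : ℝ)) := by
  have hq := sqBound_heatKernel ht x₀
  set q : ℝ → ℝ := fun x ↦ heatKernel t (x - x₀) with hqdef
  refine hq.energyLe ?_
  have e : ∫ x, q x * (q x - heat τ q x) = heat t q x₀ - heat (t + τ) q x₀ := by
    rw [← heat_heat ht.le hτ hq.toBddMeas, ← heat_sub hq.toBddMeas (hq.toBddMeas.heat τ),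
      heat_eq_integral_heatKernel ht]
  have h1 := abs_integral_gaussLaw_sub_le ht hτ hτt (hq.toBddMeas.shift x₀)
  have h2 : ∫ h, |q (x₀ + h)| ∂(gaussLaw (10 * t)) ≤ t ^ (-(1 / 2) : ℝ) := by
    calc _ ≤ ∫ _, t ^ (-(1 / 2) : ℝ) ∂(gaussLaw (10 * t)) := by
          refine integral_mono ((hq.toBddMeas.shift x₀).abs.integrable _) (integrable_const _)
            fun h ↦ ?_
          simp only [hqdef]
          rw [abs_of_nonneg (heatKernel_nonneg _ _)]; exact heatKernel_le ht _
      _ = _ := by simp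
  have h3 : t ^ (-(3 / 2) : ℝ) = t⁻¹ * t ^ (-(1 / 2) : ℝ) := by
    rw [← Real.rpow_neg_one, ← Real.rpow_add ht]; norm_num
  rw [e, h3]
  have h4 : heat t q x₀ - heat (t + τ) q x₀ ≤ 40 * (τ / t) * t ^ (-(1 / 2) : ℝ) := by
    calc _ ≤ |heat (t + τ) q x₀ - heat t q x₀| := by rw [abs_sub_comm]; exact le_abs_self _
      _ ≤ _ := h1
      _ ≤ _ := by gcongr
  calc _ ≤ 2 * (40 * (τ / t) * t ^ (-(1 / 2) : ℝ)) := by linarith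
    _ = _ := by ring

/-! ### Smoothing of weighted increments and the correlation bound -/

namespace WeightedDrift

variable {κ R C : ℝ} {b w : ℝ → ℝ}

theorem bddMeas_b (H : WeightedDrift κ R C b w) : BddMeas b := H.sq_b.toBddMeas

theorem bddMeas_w (H : WeightedDrift κ R C b w) : BddMeas w := ⟨H.meas_w, C, H.abs_w_le⟩

/-- The increment of `w b` is separated from the defect `P_τ w - w`. The waiting time is split in
two: one half makes the difference of semigroups small, the other stays outside to control the
energy of the result. -/
theorem heat_weightedIncrement (H : WeightedDrift κ R C b w) {a τ : ℝ} (ha : 0 < a)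
    (hτ : 0 < τ) (x : ℝ) :
    heat a (weightedIncrement b w τ) x =
      heat (a / 2) (fun y ↦ heat (a / 2 + τ) (fun z ↦ w z * b z) y
        - heat (a / 2) (fun z ↦ w z * b z) y) x
      - heat a (fun y ↦ b y * (heat τ w y - w y)) x := by
  have hb := H.bddMeas_b
  have hw := H.bddMeas_w
  have hψ := hw.mul hb
  have e : heat (a / 2) (fun y ↦ heat (a / 2 + τ) (fun z ↦ w z * b z) y
      - heat (a / 2) (fun z ↦ w z * b z) y) x
      = heat a (fun y ↦ heat τ (fun z ↦ w z * b z) y - w y * b y) x := by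
    rw [heat_sub (hψ.heat _) (hψ.heat _), heat_sub (hψ.heat _) hψ,
      heat_heat (by positivity) (by positivity) hψ, heat_heat (by positivity) (by positivity) hψ,
      heat_heat (by positivity) (by positivity) hψ]
    ring_nf
  rw [e, ← heat_sub ((hψ.heat _).sub hψ) (hb.mul ((hw.heat _).sub hw))]
  congr 1
  ext y
  simp only [weightedIncrement]
  ring

/-- Square integral and energy of the conditional expectation of a weighted increment. -/
theorem exists_heat_weightedIncrement_bound (H : WeightedDrift κ R C b w) :
    ∃ D, 0 ≤ D ∧ ∀ a τ, 0 < a → 5 * a ≤ R → 0 < τ → τ ≤ R → τ ≤ 2 * a →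
      SqBound (heat a (weightedIncrement b w τ)) (D * (τ ^ 2 * a ^ (κ - 2) + τ ^ (1 + κ))) ∧
      ∀ σ, 0 ≤ σ → σ ≤ 2 * a → EnergyLe σ (heat a (weightedIncrement b w τ))
        (D * (σ / a) * (τ ^ 2 * a ^ (κ - 2) + τ ^ (1 + κ))) := by
  have hC := H.one_le
  set D₁ := 80 ^ 2 * C * 5 ^ κ with hD₁
  set D₂ := C ^ 3 with hD₂
  have hD₁0 : 0 ≤ D₁ := by positivity
  have hD₂0 : 0 ≤ D₂ := by positivity
  -- The energy bound dictates `320 = 2 * 80 * 2`: a factor `2` from the difference, `80` from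
  -- smoothing, and `2` from smoothing over `a / 2` only.
  refine ⟨320 * D₁ + 320 * D₂, by positivity, fun a τ ha haR hτ hτR hτa ↦ ?_⟩
  have hψ := H.bddMeas_w.mul H.bddMeas_b
  -- The energy is taken at scale `10 * (a / 2) = 5 * a`, which is why `5 * a ≤ R` is required.
  have s1 := (H.energy_mul (10 * (a / 2)) (by positivity) (by linarith)).heat_sub_heat hψ
    (by positivity : 0 < a / 2) hτ.le (by linarith)
  have s2 := (H.heat_w τ hτ hτR).bdd_mul H.bddMeas_b H.abs_b_le
  have e1 : (40 * (τ / (a / 2))) ^ 2 * (C * (10 * (a / 2)) ^ κ) = D₁ * (τ ^ 2 * a ^ (κ - 2)) := by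
    rw [show 10 * (a / 2) = 5 * a by ring, Real.mul_rpow (by norm_num) ha.le, Real.rpow_sub ha,
      Real.rpow_two, hD₁]
    field_simp
    ring
  have e2 : C ^ 2 * (C * τ ^ (1 + κ)) = D₂ * τ ^ (1 + κ) := by rw [hD₂]; ring
  rw [e1] at s1
  rw [e2] at s2
  have eV : heat a (weightedIncrement b w τ) = fun x ↦ heat (a / 2) (fun y ↦
      heat (a / 2 + τ) (fun z ↦ w z * b z) y - heat (a / 2) (fun z ↦ w z * b z) y) x
      - heat a (fun y ↦ b y * (heat τ w y - w y)) x :=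
    funext fun x ↦ H.heat_weightedIncrement ha hτ x
  rw [eV]
  have p1 : 0 ≤ τ ^ 2 * a ^ (κ - 2) := by positivity
  have p2 : 0 ≤ τ ^ (1 + κ) := by positivity
  refine ⟨((s1.heat _).sub (s2.heat _)).mono ?_, fun σ hσ hσa ↦ ?_⟩
  · nlinarith [mul_nonneg hD₁0 p1, mul_nonneg hD₂0 p1, mul_nonneg hD₁0 p2, mul_nonneg hD₂0 p2]
  · refine ((s1.energyLe_heat (by positivity : 0 < a / 2) hσ (by linarith)).sub
      (s2.energyLe_heat ha hσ (by linarith)) (s1.toBddMeas.heat _).meas).mono ?_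
    have e3 : σ / (a / 2) = 2 * (σ / a) := by field_simp
    have p3 : 0 ≤ σ / a := by positivity
    rw [e3]
    have := mul_nonneg p3 (add_nonneg (mul_nonneg hD₂0 p1) (mul_nonneg hD₁0 p2))
    have := mul_nonneg p3 (mul_nonneg hD₂0 p2)
    nlinarith

theorem abs_incrementCorrelation_le (H : WeightedDrift κ R C b w) :
    ∃ D, 0 ≤ D ∧ ∀ t σ a τ x₀, 0 < t → t ≤ R → 0 < σ → σ ≤ 4 * t → σ ≤ 2 * a → σ ≤ R →
      0 < a → 5 * a ≤ R → 0 < τ → τ ≤ R → τ ≤ 2 * a →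
      |incrementCorrelation b w t σ a τ x₀| ≤
        D * (σ / t * √(t ^ (-(1 / 2) : ℝ)) * √(τ ^ 2 * a ^ (κ - 2) + τ ^ (1 + κ))
          + √(σ ^ κ * t ^ (-(3 / 2) : ℝ)) * √(σ / a * (τ ^ 2 * a ^ (κ - 2) + τ ^ (1 + κ)))) := by
  obtain ⟨D, hD, hV⟩ := H.exists_heat_weightedIncrement_bound
  have hC := H.one_le
  rcases le_or_gt R 0 with hR | hR
  · exact ⟨0, le_rfl, fun t _ _ _ _ ht htR ↦ absurd (ht.trans_le htR) hR.not_gt⟩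
  set c₁ := 40 * C * √(C ^ 2 * D) with hc₁
  set c₂ := 2 * (C * √R) + 2 * (C ^ 2 * (80 * R ^ (1 - κ))) with hc₂
  set c₃ := 2 * (C ^ 2 * D) + 2 * (C ^ 2 * D * R) with hc₃
  have hκ := H.κ_mem
  refine ⟨c₁ + √c₂ * √c₃, by positivity, fun t σ a τ x₀ ht htR hσ hσt hσa hσR ha haR hτ hτR hτa ↦ ?_⟩
  obtain ⟨hVs, hVe⟩ := hV a τ ha haR hτ hτR hτa
  have hVe := hVe σ hσ.le hσa
  set Q := τ ^ 2 * a ^ (κ - 2) + τ ^ (1 + κ) with hQ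
  have hQ0 : 0 ≤ Q := by positivity
  set V := heat a (weightedIncrement b w τ) with hVdef
  set m : ℝ → ℝ := fun x ↦ w x * V x with hm
  have hb := H.bddMeas_b
  have hms : SqBound m (C ^ 2 * (D * Q)) := hVs.bdd_mul H.bddMeas_w H.abs_w_le
  have hmb := hms.toBddMeas
  -- The increments of `w` contribute `Q * σ`, which is absorbed since `a ≤ R` gives `σ ≤ R * (σ /
  -- a)`.
  have hme : EnergyLe σ m (c₃ * (σ / a * Q)) := by
    refine (EnergyLe.lipschitz_mul hσ.le hVs hVe H.meas_w H.abs_w_le H.lipschitz_w).mono ?_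
    have : σ ≤ R * (σ / a) := by
      rw [mul_div_assoc', le_div_iff₀ ha]; nlinarith
    calc _ = 2 * (C ^ 2 * D) * (σ / a * Q) + 2 * (C ^ 2 * D) * Q * σ := by ring
      _ ≤ 2 * (C ^ 2 * D) * (σ / a * Q) + 2 * (C ^ 2 * D) * Q * (R * (σ / a)) := by gcongr
      _ = _ := by rw [hc₃]; ring
  set q : ℝ → ℝ := fun x ↦ heatKernel t (x - x₀) with hq
  have hqs := sqBound_heatKernel ht x₀
  have hqe := energyLe_heatKernel ht hσ.le hσt x₀
  have hqle (x : ℝ) : |q x| ≤ t ^ (-(1 / 2) : ℝ) := by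
    rw [hq, abs_of_nonneg (heatKernel_nonneg _ _)]; exact heatKernel_le ht _
  have hqm : Measurable q := hqs.meas
  have hbm : Measurable b := hb.meas
  have hqbs : SqBound (fun x ↦ q x * b x) ((t ^ (-(1 / 2) : ℝ)) ^ 2 * C) :=
    H.sq_b.bdd_mul hqs.toBddMeas hqle
  -- Product rule for `q b`: the sup bound of `q` multiplies the energy of `b`, and the sup bound of
  -- `b` multiplies the energy of `q`. Both are brought to the common size `σ ^ κ * t ^ (-3/2)`.
  have hqbe : EnergyLe σ (fun x ↦ q x * b x) (c₂ * (σ ^ κ * t ^ (-(3 / 2) : ℝ))) := by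
    refine (EnergyLe.of_abs_le (u := fun p ↦ q (p.1 + p.2) * (b (p.1 + p.2) - b p.1))
      (v := fun p ↦ b p.1 * (q (p.1 + p.2) - q p.1)) (by fun_prop) (fun x k ↦ ?_)
      (mul_nonneg (sq_nonneg _) (H.energy_b σ hσ).nonneg)
      (mul_nonneg (sq_nonneg _) hqe.nonneg)
      ((H.energy_b σ hσ).lintegral_mul_sub_le (w := fun p ↦ q (p.1 + p.2)) fun p ↦ hqle _)
      (hqe.lintegral_mul_sub_le (w := fun p ↦ b p.1) fun p ↦ H.abs_b_le _)).mono ?_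
    · rw [show q (x + k) * b (x + k) - q x * b x
        = q (x + k) * (b (x + k) - b x) + b x * (q (x + k) - q x) by ring]
      exact abs_add_le _ _
    · have r1 : (t ^ (-(1 / 2) : ℝ)) ^ 2 ≤ √R * t ^ (-(3 / 2) : ℝ) := by
        calc (t ^ (-(1 / 2) : ℝ)) ^ 2 = t ^ (1 / 2 : ℝ) * t ^ (-(3 / 2) : ℝ) := by
              rw [← Real.rpow_natCast, ← Real.rpow_mul ht.le, ← Real.rpow_add ht]; norm_num
          _ ≤ _ := by rw [Real.sqrt_eq_rpow]; gcongr
      have r2 : σ ≤ R ^ (1 - κ) * σ ^ κ := by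
        calc σ = σ ^ (1 - κ) * σ ^ κ := by rw [← Real.rpow_add hσ]; norm_num
          _ ≤ _ := by
            have := hκ.2
            gcongr
      calc _ = 2 * (C * (t ^ (-(1 / 2) : ℝ)) ^ 2 * σ ^ κ)
            + 2 * (C ^ 2 * 80 * t ^ (-(3 / 2) : ℝ) * σ) := by ring
        _ ≤ 2 * (C * (√R * t ^ (-(3 / 2) : ℝ)) * σ ^ κ)
            + 2 * (C ^ 2 * 80 * t ^ (-(3 / 2) : ℝ) * (R ^ (1 - κ) * σ ^ κ)) := by gcongr
        _ = _ := by rw [hc₂]; ring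
  have hbmb : BddMeas fun x ↦ m x * b x := hmb.mul hb
  -- Adding and subtracting `m b` inside `P_σ (m b) - b P_σ m` gives a time difference of the
  -- semigroup and a Dirichlet form of `q b` and `m`.
  have split : incrementCorrelation b w t σ a τ x₀
      = (heat (t + σ) (fun x ↦ m x * b x) x₀ - heat t (fun x ↦ m x * b x) x₀)
        + ∫ x, (q x * b x) * (m x - heat σ m x) := by
    have e1 : ∫ x, (q x * b x) * (m x - heat σ m x)
        = heat t (fun x ↦ m x * b x - b x * heat σ m x) x₀ := by
      rw [heat_eq_integral_heatKernel ht]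
      refine integral_congr_ae (ae_of_all _ fun x ↦ ?_)
      simp only [hq]; ring
    rw [e1, heat_sub hbmb (hb.mul (hmb.heat σ)), incrementCorrelation,
      show heat (t + σ) (fun x ↦ m x * b x) x₀ = heat t (heat σ fun x ↦ m x * b x) x₀ from
        (heat_heat ht.le hσ.le hbmb x₀).symm]
    have := heat_sub (hbmb.heat σ) (hb.mul (hmb.heat σ)) t x₀
    rw [show weightedIncrement b (fun x ↦ w x * heat a (weightedIncrement b w τ) x) σ
      = fun x ↦ heat σ (fun x ↦ m x * b x) x - b x * heat σ m x from rfl, this]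
    ring
  have first : |heat (t + σ) (fun x ↦ m x * b x) x₀ - heat t (fun x ↦ m x * b x) x₀|
      ≤ c₁ * (σ / t * √(t ^ (-(1 / 2) : ℝ)) * √Q) := by
    refine (abs_integral_gaussLaw_sub_le ht hσ.le hσt (hbmb.shift x₀)).trans ?_
    have f1 : ∫ h, |m (x₀ + h) * b (x₀ + h)| ∂(gaussLaw (10 * t))
        ≤ C * ∫ h, |m (x₀ + h)| ∂(gaussLaw (10 * t)) := by
      rw [← integral_const_mul]
      refine integral_mono ((hbmb.shift x₀).abs.integrable _)
        (((hmb.shift x₀).abs.integrable _).const_mul _) fun h ↦ ?_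
      simp only
      rw [abs_mul, mul_comm]
      gcongr
      exact H.abs_b_le _
    have f2 : (∫ h, |m (x₀ + h)| ∂(gaussLaw (10 * t))) ^ 2
        ≤ (C ^ 2 * D) * (t ^ (-(1 / 2) : ℝ) * Q) := by
      have j := sq_integral_le (hmb.shift x₀).abs (gaussLaw (10 * t))
      simp only [sq_abs] at j
      refine (j.trans (hms.heat_sq_le (by positivity : 0 < 10 * t) x₀)).trans ?_
      calc _ ≤ t ^ (-(1 / 2) : ℝ) * (C ^ 2 * (D * Q)) := by
            gcongr 1
            exact Real.rpow_le_rpow_of_nonpos ht (by linarith) (by norm_num)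
        _ = _ := by ring
    have f3 := (le_abs_self _).trans (abs_sqrt_le_of_sq_le (by positivity) f2)
    rw [Real.sqrt_mul (by positivity : 0 ≤ t ^ (-(1 / 2) : ℝ))] at f3
    calc _ ≤ 40 * (σ / t) * (C * (√(C ^ 2 * D) * (√(t ^ (-(1 / 2) : ℝ)) * √Q))) := by
          gcongr
          exact f1.trans (by gcongr)
      _ = _ := by rw [hc₁]; ring
  have second := abs_integral_mul_sub_heat_le hqbs hms hqbe hme
  rw [Real.sqrt_mul (by positivity : 0 ≤ c₂), Real.sqrt_mul (by positivity : 0 ≤ c₃)] at second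
  rw [split]
  refine (abs_add_le _ _).trans ((add_le_add first second).trans ?_)
  have n1 : 0 ≤ σ / t * √(t ^ (-(1 / 2) : ℝ)) * √Q := by positivity
  have n2 : 0 ≤ √(σ ^ κ * t ^ (-(3 / 2) : ℝ)) * √(σ / a * Q) := by positivity
  have n3 : 0 ≤ c₁ := by positivity
  have n4 : 0 ≤ √c₂ * √c₃ := by positivity
  nlinarith [mul_nonneg n3 n2, mul_nonneg n4 n1]

end WeightedDrift

/-! ### Expectations along a Brownian path -/

/-- Integrating out an independent variable of known law. -/
theorem integral_of_indepFun_hasLaw {Ω α β : Type*} [MeasurableSpace Ω] [MeasurableSpace α]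
    [MeasurableSpace β] {P : Measure Ω} [IsProbabilityMeasure P] {ν : Measure β} {Z : Ω → α}
    {Y : Ω → β} (hZ : Measurable Z) (hY : HasLaw Y ν P) (h : IndepFun Z Y P) {F : α × β → ℝ}
    (hF : BddMeas F) :
    ∫ ω, F (Z ω, Y ω) ∂P = ∫ ω, (∫ y, F (Z ω, y) ∂ν) ∂P := by
  have hYm := hY.aemeasurable
  have hν : IsProbabilityMeasure ν := hY.map_eq ▸ Measure.isProbabilityMeasure_map hYm
  have hZP : IsProbabilityMeasure (P.map Z) := Measure.isProbabilityMeasure_map hZ.aemeasurable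
  have e1 := integral_map (μ := P) (hZ.aemeasurable.prodMk hYm) (f := F)
    hF.meas.aestronglyMeasurable
  rw [(indepFun_iff_map_prod_eq_prod_map_map hZ.aemeasurable hYm).1 h, hY.map_eq,
    integral_prod _ (hF.integrable _)] at e1
  rw [← e1, integral_map hZ.aemeasurable (hF.integral ν).meas.aestronglyMeasurable]

section Brownian

variable {Ω : Type*} [MeasurableSpace Ω] {P : Measure Ω} [IsProbabilityMeasure P] {T : ℝ}
  {W : ℝ → Ω → ℝ} {ξ : Ω → ℝ}

/-- The expectation of a function of four independent variables as an iterated integral. -/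
theorem integral_four_of_iIndepFun {D : ℕ → Ω → ℝ} (hD : iIndepFun D P)
    (hDm : ∀ i, Measurable (D i)) {ν : ℕ → Measure ℝ} [∀ i, IsProbabilityMeasure (ν i)]
    (hl : ∀ i < 4, HasLaw (D i) (ν i) P) {F : ℝ × ℝ × ℝ × ℝ → ℝ} (hF : BddMeas F) :
    ∫ ω, F (D 0 ω, D 1 ω, D 2 ω, D 3 ω) ∂P
      = ∫ h₀, ∫ h₁, ∫ h₂, ∫ h₃, F (h₀, h₁, h₂, h₃) ∂(ν 3) ∂(ν 2) ∂(ν 1) ∂(ν 0) := by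
  have i1 : IndepFun (D 0) (D 1) P := iIndepFun.indepFun hD (i := 0) (j := 1) (by decide)
  have i2 : IndepFun (fun ω ↦ (D 0 ω, D 1 ω)) (D 2) P :=
    hD.indepFun_prodMk hDm 0 1 2 (by decide) (by decide)
  have i3 : IndepFun (fun ω ↦ (D 0 ω, D 1 ω, D 2 ω)) (D 3) P := by
    have h := hD.indepFun_finset {0, 1, 2} {3} (by decide) hDm
    have m1 : Measurable fun f : ({0, 1, 2} : Finset ℕ) → ℝ ↦
        (f ⟨0, by decide⟩, f ⟨1, by decide⟩, f ⟨2, by decide⟩) := by fun_prop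
    have m2 : Measurable fun f : ({3} : Finset ℕ) → ℝ ↦ f ⟨3, by decide⟩ := by fun_prop
    exact h.comp m1 m2
  let F₃ : (ℝ × ℝ × ℝ) × ℝ → ℝ := fun p ↦ F (p.1.1, p.1.2.1, p.1.2.2, p.2)
  have b3 : BddMeas F₃ := hF.comp (by fun_prop)
  let F₂ : (ℝ × ℝ) × ℝ → ℝ := fun p ↦ ∫ h, F₃ ((p.1.1, p.1.2, p.2), h) ∂(ν 3)
  have b2 : BddMeas F₂ := (b3.integral (ν 3)).comp
    (φ := fun p : (ℝ × ℝ) × ℝ ↦ (p.1.1, p.1.2, p.2)) (by fun_prop)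
  let F₁ : ℝ × ℝ → ℝ := fun p ↦ ∫ h, F₂ ((p.1, p.2), h) ∂(ν 2)
  have b1 : BddMeas F₁ := b2.integral (ν 2)
  have b0 := b1.integral (ν 1)
  have s3 := integral_of_indepFun_hasLaw ((hDm 0).prodMk ((hDm 1).prodMk (hDm 2)))
    (hl 3 (by decide)) i3 b3
  have s2 := integral_of_indepFun_hasLaw ((hDm 0).prodMk (hDm 1)) (hl 2 (by decide)) i2 b2
  have s1 := integral_of_indepFun_hasLaw (hDm 0) (hl 1 (by decide)) i1 b1
  have s0 := (hl 0 (by decide)).integral_comp b0.meas.aestronglyMeasurable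
  exact s3.trans (s2.trans (s1.trans s0))

omit [IsProbabilityMeasure P] in
theorem IsBrownianMotionOn.exists_increments (hW : IsBrownianMotionOn T W P)
    (hind : IndepFun ξ (fun ω (t : Set.Icc (0 : ℝ) T) ↦ W t ω) P)
    {t u v s : ℝ} (ht : 0 ≤ t) (htu : t ≤ u) (huv : u ≤ v) (hvs : v ≤ s) (hs : s ≤ T) :
    ∃ (D : ℕ → Ω → ℝ) (ν : ℕ → Measure ℝ), iIndepFun D P ∧ (∀ i, Measurable (D i)) ∧
      (∀ i, IsProbabilityMeasure (ν i)) ∧ (∀ i < 4, HasLaw (D i) (ν i) P) ∧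
      ν 0 = gaussLaw t ∧ ν 1 = gaussLaw (u - t) ∧ ν 2 = gaussLaw (v - u) ∧
      ν 3 = gaussLaw (s - v) ∧
      IndepFun ξ (fun ω ↦ (D 0 ω, D 1 ω, D 2 ω, D 3 ω)) P ∧
      ∀ᵐ ω ∂P, W t ω = D 0 ω ∧ W u ω = D 0 ω + D 1 ω ∧ W v ω = D 0 ω + D 1 ω + D 2 ω ∧
        W s ω = D 0 ω + D 1 ω + D 2 ω + D 3 ω := by
  have m0 : (0 : ℝ) ∈ Set.Icc 0 T := ⟨le_rfl, by linarith⟩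
  have mt : t ∈ Set.Icc 0 T := ⟨ht, by linarith⟩
  have mu : u ∈ Set.Icc 0 T := ⟨by linarith, by linarith⟩
  have mv : v ∈ Set.Icc 0 T := ⟨by linarith, by linarith⟩
  have ms : s ∈ Set.Icc 0 T := ⟨by linarith, hs⟩
  -- Time `0` is prepended so that the first increment is `W t` almost surely. From index `4` on the
  -- sequence is frozen at `s`, which keeps it monotone on all of `ℕ`.
  let τ : ℕ → Set.Icc (0 : ℝ) T
    | 0 => ⟨0, m0⟩
    | 1 => ⟨t, mt⟩
    | 2 => ⟨u, mu⟩
    | 3 => ⟨v, mv⟩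
    | _ => ⟨s, ms⟩
  have hτ : Monotone τ := by
    refine monotone_nat_of_le_succ fun n ↦ ?_
    match n with
    | 0 => exact ht
    | 1 => exact htu
    | 2 => exact huv
    | 3 => exact hvs
    | n + 4 => exact le_rfl
  have hm : Measurable fun p : Set.Icc (0 : ℝ) T → ℝ ↦ (p (τ 1) - p (τ 0), p (τ 2) - p (τ 1),
      p (τ 3) - p (τ 2), p (τ 4) - p (τ 3)) := by fun_prop
  refine ⟨fun i ω ↦ W (τ (i + 1)) ω - W (τ i) ω,
    fun i ↦ gaussLaw ((τ (i + 1) : ℝ) - τ i), hW.indepIncrements.nat hτ,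
    fun i ↦ (hW.measurable _ (τ (i + 1)).2).sub (hW.measurable _ (τ i).2),
    fun i ↦ inferInstance, fun i _ ↦ hW.hasLaw_sub _ _ (τ i).2.1 (hτ i.le_succ) (τ (i + 1)).2.2,
    by simp [τ], rfl, rfl, rfl, hind.comp measurable_id hm, ?_⟩
  filter_upwards [hW.zero] with ω hω
  simp only [τ, hω]
  refine ⟨by ring, by ring, by ring, by ring⟩

/-- The law of a Brownian path, issued from an independent point, at four times. -/
theorem IsBrownianMotionOn.integral_four_times (hW : IsBrownianMotionOn T W P)
    (hξ : Measurable ξ) (hind : IndepFun ξ (fun ω (t : Set.Icc (0 : ℝ) T) ↦ W t ω) P)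
    {t u v s : ℝ} (ht : 0 ≤ t) (htu : t ≤ u) (huv : u ≤ v) (hvs : v ≤ s) (hs : s ≤ T)
    {F : ℝ × ℝ × ℝ × ℝ → ℝ} (hF : BddMeas F) :
    ∫ ω, F (W t ω + ξ ω, W u ω + ξ ω, W v ω + ξ ω, W s ω + ξ ω) ∂P
      = ∫ ω, (∫ h₀, ∫ h₁, ∫ h₂, ∫ h₃, F (ξ ω + h₀, ξ ω + h₀ + h₁, ξ ω + h₀ + h₁ + h₂,
          ξ ω + h₀ + h₁ + h₂ + h₃) ∂(gaussLaw (s - v)) ∂(gaussLaw (v - u)) ∂(gaussLaw (u - t))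
          ∂(gaussLaw t)) ∂P := by
  obtain ⟨D, ν, hD, hDm, hν, hl, e0, e1, e2, e3, iξ, hWD⟩ :=
    hW.exists_increments hind ht htu huv hvs hs
  have hDD : Measurable fun ω ↦ (D 0 ω, D 1 ω, D 2 ω, D 3 ω) := by
    have := hDm 0; have := hDm 1; have := hDm 2; have := hDm 3
    fun_prop
  let G : ℝ × (ℝ × ℝ × ℝ × ℝ) → ℝ := fun p ↦ F (p.1 + p.2.1, p.1 + p.2.1 + p.2.2.1,
    p.1 + p.2.1 + p.2.2.1 + p.2.2.2.1, p.1 + p.2.1 + p.2.2.1 + p.2.2.2.1 + p.2.2.2.2)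
  have bG : BddMeas G := hF.comp (by fun_prop)
  have bGx (x : ℝ) : BddMeas fun y ↦ G (x, y) := bG.comp (by fun_prop)
  have hξe := integral_of_indepFun_hasLaw hξ (HasLaw.mk hDD.aemeasurable rfl) iξ bG
  have start : ∫ ω, F (W t ω + ξ ω, W u ω + ξ ω, W v ω + ξ ω, W s ω + ξ ω) ∂P
      = ∫ ω, G (ξ ω, (D 0 ω, D 1 ω, D 2 ω, D 3 ω)) ∂P := by
    refine integral_congr_ae ?_
    filter_upwards [hWD] with ω ⟨h0, h1, h2, h3⟩
    simp only [G, h0, h1, h2, h3]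
    congr 2
    · ring
    · congr 1
      · ring
      · congr 1 <;> ring
  rw [start, hξe]
  refine integral_congr_ae (ae_of_all _ fun ω ↦ ?_)
  simp only
  rw [integral_map hDD.aemeasurable (bGx _).meas.aestronglyMeasurable,
    integral_four_of_iIndepFun hD hDm hl (bGx _), e0, e1, e2, e3]

theorem abs_integral_le_of_forall {f : Ω → ℝ} {B : ℝ} (h : ∀ ω, |f ω| ≤ B) :
    |∫ ω, f ω ∂P| ≤ B := by
  have := norm_integral_le_of_norm_le_const (μ := P) (f := f) (C := B) (ae_of_all _ h)
  simpa using this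

theorem weightedIncrement_eq {b w : ℝ → ℝ} (hb : BddMeas b) (hw : BddMeas w) (τ y : ℝ) :
    ∫ h, w (y + h) * (b (y + h) - b y) ∂(gaussLaw τ) = weightedIncrement b w τ y := by
  have i1 := ((hw.mul hb).shift y).integrable (gaussLaw τ)
  have i2 := (hw.shift y).integrable (gaussLaw τ)
  simp_rw [mul_sub]
  rw [integral_sub i1 (i2.mul_const _), integral_mul_const, weightedIncrement, heat, heat]
  ring

/-- The correlation of two weighted increments of `b` along the path. -/
theorem IsBrownianMotionOn.abs_integral_increments_le (hW : IsBrownianMotionOn T W P)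
    (hξ : Measurable ξ) (hind : IndepFun ξ (fun ω (t : Set.Icc (0 : ℝ) T) ↦ W t ω) P)
    {t u v s : ℝ} (ht : 0 ≤ t) (htu : t ≤ u) (huv : u ≤ v) (hvs : v ≤ s) (hs : s ≤ T)
    {b w : ℝ → ℝ} (hb : BddMeas b) (hw : BddMeas w) {B : ℝ}
    (hB : ∀ x₀, |incrementCorrelation b w t (u - t) (v - u) (s - v) x₀| ≤ B) :
    |∫ ω, (w (W u ω + ξ ω) * (b (W u ω + ξ ω) - b (W t ω + ξ ω))) *
      (w (W s ω + ξ ω) * (b (W s ω + ξ ω) - b (W v ω + ξ ω))) ∂P| ≤ B := by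
  have hbm := hb.meas
  have hwm := hw.meas
  let F : ℝ × ℝ × ℝ × ℝ → ℝ := fun p ↦ (w p.2.1 * (b p.2.1 - b p.1)) *
    (w p.2.2.2 * (b p.2.2.2 - b p.2.2.1))
  have hF : BddMeas F :=
    ((hw.comp (by fun_prop)).mul ((hb.comp (by fun_prop)).sub (hb.comp (by fun_prop)))).mul
      ((hw.comp (by fun_prop)).mul ((hb.comp (by fun_prop)).sub (hb.comp (by fun_prop))))
  have e := hW.integral_four_times hξ hind ht htu huv hvs hs hF
  simp only [F] at e
  rw [e]
  refine abs_integral_le_of_forall fun ω ↦ ?_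
  have hg : BddMeas (weightedIncrement b w (s - v)) :=
    ((hw.mul hb).heat _).sub (hb.mul (hw.heat _))
  have e2 : ∀ x : ℝ, ∫ h₁, ∫ h₂, ∫ h₃, w (x + h₁) * (b (x + h₁) - b x) *
      (w (x + h₁ + h₂ + h₃) * (b (x + h₁ + h₂ + h₃) - b (x + h₁ + h₂)))
      ∂(gaussLaw (s - v)) ∂(gaussLaw (v - u)) ∂(gaussLaw (u - t))
      = weightedIncrement b (fun y ↦ w y * heat (v - u) (weightedIncrement b w (s - v)) y)
        (u - t) x := fun x ↦ by
    rw [← weightedIncrement_eq hb (hw.mul (hg.heat _))]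
    refine integral_congr_ae (ae_of_all _ fun h₁ ↦ ?_)
    simp only [integral_const_mul, weightedIncrement_eq hb hw]
    rw [heat]
    ring
  simp only [e2]
  exact hB (ξ ω)

/-- Whatever the starting point, the position at time `t > 0` has density at most `t ^ (-1/2)`, so
the mean is bounded by the Gaussian energy of `b`. -/
theorem IsBrownianMotionOn.integral_sq_increment_le (hW : IsBrownianMotionOn T W P)
    (hξ : Measurable ξ) (hind : IndepFun ξ (fun ω (t : Set.Icc (0 : ℝ) T) ↦ W t ω) P)
    {t u : ℝ} (ht : 0 < t) (htu : t ≤ u) (hu : u ≤ T) {b : ℝ → ℝ} (hb : BddMeas b) {E : ℝ}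
    (hE : EnergyLe (u - t) b E) :
    ∫ ω, (b (W u ω + ξ ω) - b (W t ω + ξ ω)) ^ 2 ∂P ≤ t ^ (-(1 / 2) : ℝ) * E := by
  have hbm := hb.meas
  let F : ℝ × ℝ × ℝ × ℝ → ℝ := fun p ↦ (b p.2.1 - b p.1) ^ 2
  have hF : BddMeas F := ((hb.comp (by fun_prop)).sub (hb.comp (by fun_prop))).sq
  -- The last three times coincide; the two superfluous increments integrate out.
  have e := hW.integral_four_times hξ hind ht.le htu le_rfl le_rfl hu hF
  simp only [F] at e
  rw [e]
  have hg : BddMeas fun x ↦ ∫ h, (b (x + h) - b x) ^ 2 ∂(gaussLaw (u - t)) :=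
    hb.uncurry_sub.sq.integral _
  have hlin : ∫⁻ x, ENNReal.ofReal (∫ h, (b (x + h) - b x) ^ 2 ∂(gaussLaw (u - t)))
      ≤ ENNReal.ofReal E := by
    refine (lintegral_congr fun x ↦ ?_).trans_le hE.le
    exact ofReal_integral_sq ((hb.shift x).sub (BddMeas.const _)) _
  have hnn (x : ℝ) : 0 ≤ ∫ h, (b (x + h) - b x) ^ 2 ∂(gaussLaw (u - t)) :=
    integral_nonneg fun _ ↦ sq_nonneg _
  have hint : Integrable fun x ↦ ∫ h, (b (x + h) - b x) ^ 2 ∂(gaussLaw (u - t)) :=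
    ⟨hg.meas.aestronglyMeasurable, by
      rw [hasFiniteIntegral_iff_ofReal (ae_of_all _ hnn)]
      exact hlin.trans_lt ENNReal.ofReal_lt_top⟩
  have hle : ∫ x, (∫ h, (b (x + h) - b x) ^ 2 ∂(gaussLaw (u - t))) ≤ E := by
    have := ofReal_integral_eq_lintegral_ofReal hint (ae_of_all _ hnn)
    exact (ENNReal.ofReal_le_ofReal_iff hE.nonneg).1 (this ▸ hlin)
  refine (le_abs_self _).trans (abs_integral_le_of_forall fun ω ↦ ?_)
  simp only [integral_const, probReal_univ, one_smul]
  have e3 := heat_eq_integral_heatKernel ht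
    (fun x ↦ ∫ h, (b (x + h) - b x) ^ 2 ∂(gaussLaw (u - t))) (ξ ω)
  rw [heat] at e3
  rw [e3, abs_of_nonneg (integral_nonneg fun x ↦ mul_nonneg (heatKernel_nonneg _ _) (hnn x))]
  calc _ ≤ ∫ x, t ^ (-(1 / 2) : ℝ) * ∫ h, (b (x + h) - b x) ^ 2 ∂(gaussLaw (u - t)) := by
        refine integral_mono_of_nonneg (ae_of_all _ fun x ↦ ?_) (hint.const_mul _)
          (ae_of_all _ fun x ↦ ?_)
        · exact mul_nonneg (heatKernel_nonneg _ _) (hnn x)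
        · exact mul_le_mul_of_nonneg_right (heatKernel_le ht _) (hnn x)
    _ ≤ _ := by
        rw [integral_const_mul]
        gcongr

end Brownian

/-! ### Cell integrals -/

section Cells

variable {Ω : Type*} [MeasurableSpace Ω] {P : Measure Ω} [IsProbabilityMeasure P]

theorem BddMeas.intervalIntegral {Y : ℝ × Ω → ℝ} (hY : BddMeas Y) {p q : ℝ} (hpq : p ≤ q) :
    BddMeas fun ω ↦ ∫ s in p..q, Y (s, ω) := by
  simp_rw [intervalIntegral.integral_of_le hpq]
  exact BddMeas.integral (F := fun z : Ω × ℝ ↦ Y (z.2, z.1)) (hY.comp measurable_swap)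
    (volume.restrict (Set.Ioc p q))

/-- By Fubini the expectation passes inside the double time integral, which is then at most the area
of the rectangle times the supremum. -/
theorem abs_integral_mul_intervalIntegral_le {Y Z : ℝ × Ω → ℝ} (hY : BddMeas Y)
    (hZ : BddMeas Z) {p q p' q' B : ℝ} (hpq : p ≤ q) (hpq' : p' ≤ q')
    (h : ∀ u ∈ Set.Ioc p q, ∀ s ∈ Set.Ioc p' q', |∫ ω, Y (u, ω) * Z (s, ω) ∂P| ≤ B) :
    |∫ ω, (∫ u in p..q, Y (u, ω)) * (∫ s in p'..q', Z (s, ω)) ∂P|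
      ≤ (q - p) * (q' - p') * B := by
  set μ := volume.restrict (Set.Ioc p q) with hμ
  set μ' := volume.restrict (Set.Ioc p' q') with hμ'
  have e1 (ω : Ω) : (∫ u in p..q, Y (u, ω)) * (∫ s in p'..q', Z (s, ω))
      = ∫ z, Y (z.1, ω) * Z (z.2, ω) ∂(μ.prod μ') := by
    rw [intervalIntegral.integral_of_le hpq, intervalIntegral.integral_of_le hpq']
    exact (integral_prod_mul (fun u ↦ Y (u, ω)) fun s ↦ Z (s, ω)).symm
  have hb : BddMeas fun z : Ω × (ℝ × ℝ) ↦ Y (z.2.1, z.1) * Z (z.2.2, z.1) :=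
    (hY.comp (by fun_prop)).mul (hZ.comp (by fun_prop))
  simp_rw [e1]
  rw [integral_integral_swap (hb.integrable (P.prod (μ.prod μ')))]
  have hprod : μ.prod μ' = (volume.prod volume).restrict (Set.Ioc p q ×ˢ Set.Ioc p' q') :=
    Measure.prod_restrict _ _
  rw [hprod]
  have := norm_setIntegral_le_of_norm_le_const (μ := (volume : Measure ℝ).prod volume)
    (s := Set.Ioc p q ×ˢ Set.Ioc p' q') (C := B)
    (f := fun z : ℝ × ℝ ↦ ∫ ω, Y (z.1, ω) * Z (z.2, ω) ∂P)
    (by rw [Measure.prod_prod]; simp [ENNReal.mul_lt_top])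
    (fun z hz ↦ h z.1 hz.1 z.2 hz.2)
  rw [Real.norm_eq_abs] at this
  refine this.trans_eq ?_
  rw [measureReal_def, Measure.prod_prod]
  simp [hpq, hpq']
  ring

theorem abs_integral_mul_le_half {f g : Ω → ℝ} (hf : BddMeas f) (hg : BddMeas g) :
    |∫ ω, f ω * g ω ∂P| ≤ ((∫ ω, f ω ^ 2 ∂P) + ∫ ω, g ω ^ 2 ∂P) / 2 := by
  have i1 := hf.sq.integrable P
  have i2 := hg.sq.integrable P
  rw [← integral_add i1 i2, ← integral_div]
  refine abs_integral_le_integral_abs.trans (integral_mono ((hf.mul hg).abs.integrable P)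
    ((i1.add i2).div_const 2) fun ω ↦ ?_)
  simp only [abs_mul]
  nlinarith [sq_nonneg (|f ω| - |g ω|), sq_abs (f ω), sq_abs (g ω)]

/-- The weighted increment of `b` along `X` between the times `t` and `p.1`. -/
def pathIncrement (b w : ℝ → ℝ) (X : ℝ × Ω → ℝ) (t : ℝ) (p : ℝ × Ω) : ℝ :=
  w (X p) * (b (X p) - b (X (t, p.2)))

theorem BddMeas.pathIncrement {b w : ℝ → ℝ} (hb : BddMeas b) (hw : BddMeas w) {X : ℝ × Ω → ℝ}
    (hX : Measurable X) (t : ℝ) : BddMeas (pathIncrement b w X t) :=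
  (hw.comp hX).mul ((hb.comp hX).sub (hb.comp (by fun_prop : Measurable fun p : ℝ × Ω ↦
    X (t, p.2))))

omit [IsProbabilityMeasure P] in
-- Fubini needs joint measurability in time and chance, whereas `W` is only measurable at each time.
-- Replacing discontinuous paths by zero and stopping time outside `[0, T]` yields continuous paths,
-- hence joint measurability, and changes nothing on `[0, T]` off a null set.
theorem IsBrownianMotionOn.exists_measurable_modification {T : ℝ} (hT : 0 ≤ T) {W : ℝ → Ω → ℝ}
    {ξ : Ω → ℝ} (hW : IsBrownianMotionOn T W P) (hξ : Measurable ξ) :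
    ∃ X : ℝ × Ω → ℝ, Measurable X ∧ ∀ᵐ ω ∂P, ∀ s ∈ Set.Icc 0 T, X (s, ω) = W s ω + ξ ω := by
  obtain ⟨N, hN, hNm, hN0⟩ := exists_measurable_superset_of_null (ae_iff.1 hW.continuousOn)
  let Y : ℝ → Ω → ℝ := fun s ↦ Nᶜ.indicator (W (Set.projIcc 0 T hT s))
  have hc (ω : Ω) : Continuous fun s ↦ Y s ω := by
    by_cases hω : ω ∈ N
    · simp [Y, hω, continuous_const]
    · have h : ContinuousOn (fun t ↦ W t ω) (Set.Icc 0 T) := by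
        by_contra h
        exact hω (hN h)
      have : Continuous fun s ↦ W (Set.projIcc 0 T hT s) ω :=
        h.comp_continuous (continuous_subtype_val.comp continuous_projIcc)
          fun s ↦ (Set.projIcc 0 T hT s).2
      simpa [Y, hω] using this
  have hm (s : ℝ) : Measurable (Y s) :=
    (hW.measurable _ (Set.projIcc 0 T hT s).2).indicator hNm.compl
  refine ⟨fun p ↦ Y p.1 p.2 + ξ p.2,
    (measurable_uncurry_of_continuous_of_measurable hc hm).add (hξ.comp measurable_snd), ?_⟩
  have : ∀ᵐ ω ∂P, ω ∉ N := measure_eq_zero_iff_ae_notMem.1 hN0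
  filter_upwards [this] with ω hω s hs
  simp [Y, hω, Set.projIcc_of_mem hT hs]

end Cells

/-! ### Grids -/

theorem gridFloor_eq {n : ℕ} {t : ℕ → ℝ} (ht : StrictMono t) {j : ℕ} (hj : j < n) {s : ℝ}
    (h1 : t j ≤ s) (h2 : s < t (j + 1)) : gridFloor n t s = t j := by
  refine (gridFloor_isGreatest n t s ((ht.monotone j.zero_le).trans h1)).unique
    ⟨⟨j, ⟨hj.le, h1⟩, rfl⟩, ?_⟩
  rintro _ ⟨k, ⟨-, hk⟩, rfl⟩
  exact ht.monotone (Nat.lt_succ_iff.1 (ht.lt_iff_lt.1 (hk.trans_lt h2)))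

/-- Cells are cut off at `r` by `min`, so cells beyond `r` are empty. Within a cell the last grid
point is constant except at the right endpoint, a null set. -/
theorem intervalIntegral_gridFloor {n : ℕ} {t : ℕ → ℝ} (ht : StrictMono t) (ht0 : t 0 = 0)
    {r : ℝ} (hr0 : 0 ≤ r) (hr : r ≤ t n) (G : ℝ → ℝ → ℝ)
    (hG : ∀ j, IntervalIntegrable (G (t j)) volume (min (t j) r) (min (t (j + 1)) r)) :
    ∫ s in (0 : ℝ)..r, G (gridFloor n t s) s
      = ∑ j ∈ Finset.range n, ∫ s in (min (t j) r)..(min (t (j + 1)) r), G (t j) s := by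
  have hle (j : ℕ) : min (t j) r ≤ min (t (j + 1)) r :=
    min_le_min_right _ (ht.monotone j.le_succ)
  have hae (j : ℕ) (hj : j < n) : ∀ᵐ s, s ∈ Set.uIoc (min (t j) r) (min (t (j + 1)) r) →
      G (t j) s = G (gridFloor n t s) s := by
    have : ∀ᵐ s : ℝ, s ≠ t (j + 1) := Measure.ae_ne volume _
    filter_upwards [this] with s hs hmem
    rw [Set.uIoc_of_le (hle j), Set.mem_Ioc, min_lt_iff, le_min_iff] at hmem
    obtain ⟨h1, h2, h3⟩ := hmem
    have h4 : t j ≤ s := by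
      rcases h1 with h1 | h1
      · exact h1.le
      · exact absurd h3 h1.not_ge
    rw [gridFloor_eq ht hj h4 (lt_of_le_of_ne h2 hs)]
  have hGI (j : ℕ) (hj : j < n) : IntervalIntegrable (fun s ↦ G (gridFloor n t s) s) volume
      (min (t j) r) (min (t (j + 1)) r) :=
    (hG j).congr_ae ((ae_restrict_iff' measurableSet_uIoc).2 (hae j hj))
  have := intervalIntegral.sum_integral_adjacent_intervals (a := fun j ↦ min (t j) r) hGI
  simp only [ht0, min_eq_left hr0, min_eq_right hr] at this
  rw [← this]
  refine Finset.sum_congr rfl fun j hj ↦ (intervalIntegral.integral_congr_ae ?_).symm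
  exact hae j (Finset.mem_range.1 hj)

/-- Comparison of a sum over a grid of controlled mesh ratio with an integral. -/
theorem sum_mul_rpow_le {x : ℕ → ℝ} {m n : ℕ} (hmn : m ≤ n) {p : ℝ} (hp : 0 ≤ p) (hp1 : p ≠ 1)
    (hpos : ∀ k, m ≤ k → 0 < x k) (hmono : ∀ k, m ≤ k → x k ≤ x (k + 1))
    (hratio : ∀ k, m ≤ k → x (k + 1) ≤ 5 * x k) :
    ∑ k ∈ Finset.Ico m n, (x (k + 1) - x k) * x k ^ (-p)
      ≤ 5 ^ p * ((x n ^ (1 - p) - x m ^ (1 - p)) / (1 - p)) := by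
  have step (k : ℕ) (hk : m ≤ k) : (x (k + 1) - x k) * x k ^ (-p)
      ≤ 5 ^ p * ((x (k + 1) ^ (1 - p) - x k ^ (1 - p)) / (1 - p)) := by
    have hk0 := hpos k hk
    have hk1 := hmono k hk
    have e : ∫ z in x k..x (k + 1), z ^ (-p)
        = (x (k + 1) ^ (1 - p) - x k ^ (1 - p)) / (1 - p) := by
      rw [integral_rpow, show -p + 1 = 1 - p by ring]
      refine Or.inr ⟨fun h ↦ hp1 (by linarith), ?_⟩
      rw [Set.uIcc_of_le hk1]
      exact fun h ↦ absurd h.1 hk0.not_ge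
    have i : IntervalIntegrable (fun z : ℝ ↦ z ^ (-p)) volume (x k) (x (k + 1)) := by
      refine intervalIntegral.intervalIntegrable_rpow (Or.inr ?_)
      rw [Set.uIcc_of_le hk1]
      exact fun h ↦ absurd h.1 hk0.not_ge
    -- The integrand decreases, so its value at the right endpoint gives a lower bound for the
    -- integral; the ratio bound moves it to the left endpoint at the cost of `5 ^ p`.
    have lower : (x (k + 1) - x k) * x (k + 1) ^ (-p) ≤ ∫ z in x k..x (k + 1), z ^ (-p) := by
      have := intervalIntegral.integral_mono_on hk1 (intervalIntegrable_const (c := x (k + 1) ^ (-p)))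
        i fun z hz ↦ Real.rpow_le_rpow_of_nonpos (hk0.trans_le hz.1) hz.2 (by linarith)
      simpa using this
    rw [← e]
    calc _ ≤ (x (k + 1) - x k) * (5 ^ p * x (k + 1) ^ (-p)) := by
          gcongr
          have h5 : x (k + 1) / 5 ≤ x k := by linarith [hratio k hk]
          calc x k ^ (-p) ≤ (x (k + 1) / 5) ^ (-p) :=
                Real.rpow_le_rpow_of_nonpos (by linarith) h5 (by linarith)
            _ = _ := by
              rw [Real.div_rpow (by linarith) (by norm_num),
                Real.rpow_neg (by norm_num : (0 : ℝ) ≤ 5), div_inv_eq_mul, mul_comm]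
      _ = 5 ^ p * ((x (k + 1) - x k) * x (k + 1) ^ (-p)) := by ring
      _ ≤ _ := by gcongr
  calc _ ≤ ∑ k ∈ Finset.Ico m n, 5 ^ p * ((x (k + 1) ^ (1 - p) - x k ^ (1 - p)) / (1 - p)) :=
        Finset.sum_le_sum fun k hk ↦ step k (Finset.mem_Ico.1 hk).1
    _ = _ := by
        rw [← Finset.mul_sum, ← Finset.sum_div, Finset.sum_Ico_sub (fun k ↦ x k ^ (1 - p)) hmn]

/-- Expansion of the mean square of a sum into diagonal and well separated terms. -/
theorem sum_sum_le_of_symm (M : ℕ → ℕ → ℝ) (hM : ∀ j k, M j k = M k j)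
    (hdiag : ∀ j k, M j k ≤ (M j j + M k k) / 2) (hnn : ∀ j, 0 ≤ M j j) (n : ℕ) :
    ∑ j ∈ Finset.Ico 1 n, ∑ k ∈ Finset.Ico 1 n, M j k
      ≤ 3 * (∑ j ∈ Finset.Ico 1 n, M j j)
        + 2 * ∑ j ∈ Finset.Ico 1 n, ∑ k ∈ Finset.Ico (j + 2) n, M j k := by
  -- Each neighbouring pair is charged to its two diagonal terms, and the last diagonal term has
  -- been charged only once. The induction carries this spare term to pay for the next pair.
  suffices key : ∀ n, ∑ j ∈ Finset.Ico 1 (n + 2), ∑ k ∈ Finset.Ico 1 (n + 2), M j k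
      + M (n + 1) (n + 1) ≤ 3 * (∑ j ∈ Finset.Ico 1 (n + 2), M j j)
        + 2 * ∑ j ∈ Finset.Ico 1 (n + 2), ∑ k ∈ Finset.Ico (j + 2) (n + 2), M j k by
    match n with
    | 0 => simp
    | 1 => simp
    | n + 2 => linarith [key n, hnn (n + 1)]
  intro n
  induction n with
  | zero => simp; linarith [hnn 1]
  | succ n ih =>
    have e1 : ∑ j ∈ Finset.Ico 1 (n + 3), ∑ k ∈ Finset.Ico 1 (n + 3), M j k
        = ∑ j ∈ Finset.Ico 1 (n + 2), ∑ k ∈ Finset.Ico 1 (n + 2), M j k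
          + 2 * (∑ j ∈ Finset.Ico 1 (n + 1), M j (n + 2) + M (n + 1) (n + 2))
          + M (n + 2) (n + 2) := by
      have h (f : ℕ → ℝ) : ∑ j ∈ Finset.Ico 1 (n + 3), f j
          = ∑ j ∈ Finset.Ico 1 (n + 2), f j + f (n + 2) :=
        Finset.sum_Ico_succ_top (by omega) f
      simp only [h, Finset.sum_add_distrib]
      rw [Finset.sum_congr rfl fun j _ ↦ hM (n + 2) j,
        Finset.sum_Ico_succ_top (by omega : 1 ≤ n + 1) (fun j ↦ M j (n + 2))]
      ring
    have e2 : ∑ j ∈ Finset.Ico 1 (n + 3), ∑ k ∈ Finset.Ico (j + 2) (n + 3), M j k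
        = ∑ j ∈ Finset.Ico 1 (n + 2), ∑ k ∈ Finset.Ico (j + 2) (n + 2), M j k
          + ∑ j ∈ Finset.Ico 1 (n + 1), M j (n + 2) := by
      rw [Finset.sum_Ico_succ_top (by omega : 1 ≤ n + 2),
        Finset.sum_Ico_succ_top (by omega : 1 ≤ n + 1),
        Finset.sum_Ico_succ_top (by omega : 1 ≤ n + 1)]
      rw [Finset.Ico_eq_empty (by omega : ¬ n + 2 + 2 < n + 3),
        Finset.Ico_eq_empty (by omega : ¬ n + 1 + 2 < n + 3),
        Finset.Ico_eq_empty (by omega : ¬ n + 1 + 2 < n + 2)]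
      simp only [Finset.sum_empty, add_zero]
      rw [← Finset.sum_add_distrib]
      refine Finset.sum_congr rfl fun j hj ↦ ?_
      rw [Finset.mem_Ico] at hj
      exact Finset.sum_Ico_succ_top (by omega) _
    have e3 : ∑ j ∈ Finset.Ico 1 (n + 3), M j j
        = ∑ j ∈ Finset.Ico 1 (n + 2), M j j + M (n + 2) (n + 2) :=
      Finset.sum_Ico_succ_top (by omega) _
    rw [show n + 1 + 2 = n + 3 by ring, show n + 1 + 1 = n + 2 by ring, e1, e2, e3]
    linarith [hdiag (n + 1) (n + 2)]

/-! ### Summation over the cells of a grid -/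

theorem sqrt_add_le_sqrt_add_sqrt {x y : ℝ} (hx : 0 ≤ x) (hy : 0 ≤ y) :
    √(x + y) ≤ √x + √y := by
  refine Real.sqrt_le_iff.2 ⟨by positivity, ?_⟩
  nlinarith [Real.sq_sqrt hx, Real.sq_sqrt hy, mul_nonneg (Real.sqrt_nonneg x) (Real.sqrt_nonneg y)]

/-- The correlation estimate in the form that is summed over the cells. -/
theorem WeightedDrift.exists_correlation_bound {κ R C : ℝ} {b w : ℝ → ℝ}
    (H : WeightedDrift κ R C b w) :
    ∃ D, 0 ≤ D ∧ ∀ t σ a τ x₀ δ η A, 0 < t → t ≤ R → 0 < σ → σ ≤ δ → δ ≤ 4 * t → δ ≤ 2 * A →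
      δ ≤ R → 0 < A → A ≤ a → 5 * a ≤ R → 0 < τ → τ ≤ R → τ ≤ 2 * A → τ ≤ η →
      |incrementCorrelation b w t σ a τ x₀| ≤
        D * (δ * t ^ (-(5 / 4) : ℝ) * (η ^ ((1 + κ) / 2) * A ^ (-(1 / 2) : ℝ))
          + δ ^ ((1 + κ) / 2) * t ^ (-(3 / 4) : ℝ) * (η * A ^ (-(2 - (1 + κ) / 2))
            + η ^ ((1 + κ) / 2) * A ^ (-(1 / 2) : ℝ))) := by
  obtain ⟨D, hD, h⟩ := H.abs_incrementCorrelation_le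
  have hκ := H.κ_mem
  refine ⟨D * (2 + √R), by positivity, ?_⟩
  intro t σ a τ x₀ δ η A ht htR hσ hσδ hδt hδA hδR hA hAa haR hτ hτR hτA hτη
  have ha : 0 < a := hA.trans_le hAa
  have hη : 0 < η := hτ.trans_le hτη
  have hδ : 0 < δ := hσ.trans_le hσδ
  refine (h t σ a τ x₀ ht htR hσ (hσδ.trans hδt) (by linarith) (hσδ.trans hδR) ha haR hτ hτR
    (by linarith)).trans ?_
  set p := (1 + κ) / 2 with hp
  have hp0 : 0 < p := by rw [hp]; linarith [hκ.1]
  have hp1 : p < 1 := by rw [hp]; linarith [hκ.2]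
  have sqrt_rpow (x y : ℝ) (hx : 0 ≤ x) : √(x ^ y) = x ^ (y / 2) := by
    rw [Real.sqrt_eq_rpow, ← Real.rpow_mul hx]; ring_nf
  set Q := τ ^ 2 * a ^ (κ - 2) + τ ^ (1 + κ) with hQ
  have hQ0 : 0 ≤ Q := by positivity
  have sQ : √Q ≤ τ * a ^ (κ / 2 - 1) + τ ^ p := by
    refine (sqrt_add_le_sqrt_add_sqrt (by positivity) (by positivity)).trans_eq ?_
    rw [Real.sqrt_mul (by positivity), Real.sqrt_sq hτ.le, sqrt_rpow _ _ ha.le,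
      sqrt_rpow _ _ hτ.le, show (κ - 2) / 2 = κ / 2 - 1 by ring]
  have hAinv : a ^ (-(1 / 2) : ℝ) ≤ A ^ (-(1 / 2) : ℝ) :=
    Real.rpow_le_rpow_of_nonpos hA hAa (by norm_num)
  have hAinv2 : a ^ (-(2 - p)) ≤ A ^ (-(2 - p)) :=
    Real.rpow_le_rpow_of_nonpos hA hAa (by linarith)
  -- Cruder form: `τ ^ (1 - p) ≤ (2 * a) ^ (1 - p)` lowers the singularity in `a` to the integrable
  -- power `-1/2`, at the price of a lower power of `τ`.
  have sQ' : √Q ≤ (2 + √R) * (η ^ p * A ^ (-(1 / 2) : ℝ)) := by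
    have q1 : τ * a ^ (κ / 2 - 1) ≤ 2 * (τ ^ p * a ^ (-(1 / 2) : ℝ)) := by
      calc τ * a ^ (κ / 2 - 1) = τ ^ p * (τ ^ (1 - p) * a ^ (κ / 2 - 1)) := by
            rw [← mul_assoc, ← Real.rpow_add hτ]; norm_num
        _ ≤ τ ^ p * ((2 * a) ^ (1 - p) * a ^ (κ / 2 - 1)) := by
            gcongr
            linarith
        _ = 2 ^ (1 - p) * (τ ^ p * a ^ (-(1 / 2) : ℝ)) := by
            rw [Real.mul_rpow (by norm_num) ha.le, mul_assoc, ← Real.rpow_add ha,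
              show 1 - p + (κ / 2 - 1) = -(1 / 2) by rw [hp]; ring]
            ring
        _ ≤ _ := by
            gcongr
            calc (2 : ℝ) ^ (1 - p) ≤ 2 ^ (1 : ℝ) :=
                  Real.rpow_le_rpow_of_exponent_le (by norm_num) (by linarith)
              _ = 2 := Real.rpow_one 2
    have q2 : τ ^ p ≤ √R * (τ ^ p * a ^ (-(1 / 2) : ℝ)) := by
      have : 1 ≤ √R * a ^ (-(1 / 2) : ℝ) := by
        rw [Real.rpow_neg ha.le, ← Real.sqrt_eq_rpow, ← div_eq_mul_inv,
          one_le_div (Real.sqrt_pos.2 ha)]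
        exact Real.sqrt_le_sqrt (by linarith)
      calc τ ^ p = τ ^ p * 1 := (mul_one _).symm
        _ ≤ τ ^ p * (√R * a ^ (-(1 / 2) : ℝ)) := by gcongr
        _ = _ := by ring
    calc √Q ≤ (2 + √R) * (τ ^ p * a ^ (-(1 / 2) : ℝ)) := by linarith
      _ ≤ _ := by gcongr
  have first : σ / t * √(t ^ (-(1 / 2) : ℝ)) * √Q
      ≤ δ * t ^ (-(5 / 4) : ℝ) * ((2 + √R) * (η ^ p * A ^ (-(1 / 2) : ℝ))) := by
    have e : σ / t * √(t ^ (-(1 / 2) : ℝ)) = σ * t ^ (-(5 / 4) : ℝ) := by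
      rw [sqrt_rpow _ _ ht.le, div_eq_mul_inv, mul_assoc, ← Real.rpow_neg_one,
        ← Real.rpow_add ht]
      norm_num
    rw [e]
    gcongr
  have second : √(σ ^ κ * t ^ (-(3 / 2) : ℝ)) * √(σ / a * Q)
      ≤ δ ^ p * t ^ (-(3 / 4) : ℝ) * (η * A ^ (-(2 - p)) + η ^ p * A ^ (-(1 / 2) : ℝ)) := by
    rw [Real.sqrt_mul (by positivity), Real.sqrt_mul (by positivity : 0 ≤ σ / a),
      Real.sqrt_div hσ.le, sqrt_rpow _ _ hσ.le, sqrt_rpow _ _ ht.le]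
    calc _ ≤ σ ^ (κ / 2) * t ^ (-(3 / 2) / 2 : ℝ) * (√σ / √a * (τ * a ^ (κ / 2 - 1) + τ ^ p)) := by
          gcongr
      _ = (σ ^ (κ / 2) * √σ) * t ^ (-(3 / 4) : ℝ) *
          (τ * (a ^ (κ / 2 - 1) * a ^ (-(1 / 2) : ℝ)) + τ ^ p * a ^ (-(1 / 2) : ℝ)) := by
          rw [div_eq_mul_inv (√σ), Real.sqrt_eq_rpow a, ← Real.rpow_neg ha.le,
            show (-(3 / 2) / 2 : ℝ) = -(3 / 4) by norm_num]
          ring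
      _ = σ ^ p * t ^ (-(3 / 4) : ℝ) * (τ * a ^ (-(2 - p)) + τ ^ p * a ^ (-(1 / 2) : ℝ)) := by
          rw [Real.sqrt_eq_rpow, ← Real.rpow_add hσ, ← Real.rpow_add ha,
            show κ / 2 + 1 / 2 = p by rw [hp]; ring,
            show κ / 2 - 1 + -(1 / 2) = -(2 - p) by rw [hp]; ring]
      _ ≤ _ := by gcongr
  have hS : 1 ≤ 2 + √R := by linarith [Real.sqrt_nonneg R]
  have n1 : 0 ≤ δ ^ p * t ^ (-(3 / 4) : ℝ) * (η * A ^ (-(2 - p)) + η ^ p * A ^ (-(1 / 2) : ℝ)) := by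
    positivity
  rw [mul_assoc D]
  gcongr
  nlinarith

/-- Grids on `[0, T]` of mesh size at most `η` with slowly growing cells. -/
structure RegularGrid (n : ℕ) (T η : ℝ) (t : ℕ → ℝ) : Prop where
  zero : t 0 = 0
  last : t n = T
  strictMono : StrictMono t
  mesh_le : ∀ j < n, t (j + 1) - t j ≤ η
  mesh_le_mul : ∀ j, 1 ≤ j → t (j + 1) - t j ≤ 4 * t j
  mesh_mono : ∀ j, t (j + 1) - t j ≤ t (j + 2) - t (j + 1)
  mesh_ratio : ∀ j, 1 ≤ j → t (j + 2) - t (j + 1) ≤ 2 * (t (j + 1) - t j)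

namespace RegularGrid

variable {n : ℕ} {T η : ℝ} {t : ℕ → ℝ}

theorem pos (h : RegularGrid n T η t) {j : ℕ} (hj : 1 ≤ j) : 0 < t j :=
  h.zero ▸ h.strictMono (by omega : 0 < j)

theorem mesh_pos (h : RegularGrid n T η t) (j : ℕ) : 0 < t (j + 1) - t j :=
  sub_pos.2 (h.strictMono j.lt_succ_self)

theorem le_last (h : RegularGrid n T η t) {j : ℕ} (hj : j ≤ n) : t j ≤ T :=
  h.last ▸ h.strictMono.monotone hj

/-- The second cell is at least as far away as half of each of the two mesh sizes. -/
theorem mesh_le_gap (h : RegularGrid n T η t) {j k : ℕ} (hjk : j + 2 ≤ k) :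
    t (j + 1) - t j ≤ t k - t (j + 1) ∧ t (k + 1) - t k ≤ 2 * (t k - t (j + 1)) := by
  obtain ⟨i, rfl⟩ : ∃ i, k = i + 2 := ⟨k - 2, by omega⟩
  have h1 := h.strictMono.monotone (by omega : j + 2 ≤ i + 2)
  have h2 := h.mesh_mono j
  have h3 := h.mesh_ratio (i + 1) (by omega)
  have h4 := h.strictMono.monotone (by omega : j + 1 ≤ i + 1)
  constructor <;> linarith

theorem sum_mesh_mul_rpow_le (h : RegularGrid n T η t) (hn : 1 ≤ n) {q : ℝ} (hq : 0 ≤ q)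
    (hq1 : q < 1) :
    ∑ j ∈ Finset.Ico 1 n, (t (j + 1) - t j) * t j ^ (-q) ≤ 5 ^ q * (T ^ (1 - q) / (1 - q)) := by
  refine (sum_mul_rpow_le hn hq hq1.ne (fun k hk ↦ h.pos hk)
    (fun k _ ↦ (h.strictMono k.lt_succ_self).le)
    (fun k hk ↦ by linarith [h.mesh_le_mul k hk])).trans ?_
  have h1 := Real.rpow_nonneg (h.pos le_rfl).le (1 - q)
  rw [h.last]
  gcongr
  linarith

theorem sum_mesh_mul_gap_rpow_le (h : RegularGrid n T η t) {j : ℕ} {q : ℝ} (hq : 0 ≤ q)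
    (hq1 : q ≠ 1) (hjn : j + 2 ≤ n) :
    ∑ k ∈ Finset.Ico (j + 2) n, (t (k + 1) - t k) * (t k - t (j + 1)) ^ (-q)
      ≤ 5 ^ q * (((t n - t (j + 1)) ^ (1 - q) - (t (j + 2) - t (j + 1)) ^ (1 - q)) / (1 - q)) := by
  have := sum_mul_rpow_le (x := fun k ↦ t k - t (j + 1)) hjn hq hq1
    (fun k hk ↦ sub_pos.2 (h.strictMono (by omega)))
    (fun k _ ↦ by linarith [h.mesh_pos k])
    (fun k hk ↦ by
      have h1 := (h.mesh_le_gap hk).2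
      have h2 := h.strictMono (by omega : j + 1 < k)
      linarith)
  simpa using this

theorem sum_gap_half_le (h : RegularGrid n T η t) (j : ℕ) :
    ∑ k ∈ Finset.Ico (j + 2) n, (t (k + 1) - t k) * (t k - t (j + 1)) ^ (-(1 / 2) : ℝ)
      ≤ 5 * (2 * T ^ (1 / 2 : ℝ)) := by
  rcases lt_or_ge n (j + 2) with hlt | hjn
  · rw [Finset.Ico_eq_empty_of_le hlt.le, Finset.sum_empty]
    have : 0 ≤ T := h.zero ▸ h.le_last n.zero_le
    positivity
  · refine (h.sum_mesh_mul_gap_rpow_le (by norm_num) (by norm_num) hjn).trans ?_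
    have h1 := h.strictMono.monotone (by omega : j + 1 ≤ n)
    have h2 := h.strictMono (by omega : j + 1 < j + 2)
    have h3 := Real.rpow_nonneg (sub_pos.2 h2).le (1 - 1 / 2)
    have h4 : (t n - t (j + 1)) ^ (1 - 1 / 2 : ℝ) ≤ T ^ (1 / 2 : ℝ) := by
      rw [show (1 - 1 / 2 : ℝ) = 1 / 2 by norm_num, h.last]
      exact Real.rpow_le_rpow (by linarith [h.last]) (by linarith [h.pos (by omega : 1 ≤ j + 1)])
        (by norm_num)
    have h5 : (5 : ℝ) ^ (1 / 2 : ℝ) ≤ 5 := by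
      calc (5 : ℝ) ^ (1 / 2 : ℝ) ≤ 5 ^ (1 : ℝ) :=
            Real.rpow_le_rpow_of_exponent_le (by norm_num) (by norm_num)
        _ = 5 := Real.rpow_one 5
    have h6 : 0 ≤ T ^ (1 / 2 : ℝ) := Real.rpow_nonneg (h.zero ▸ h.le_last n.zero_le) _
    calc _ ≤ (5 : ℝ) ^ (1 / 2 : ℝ) * (2 * T ^ (1 / 2 : ℝ)) := by
          gcongr
          rw [show (1 - 1 / 2 : ℝ) = 1 / 2 by norm_num] at *
          rw [div_le_iff₀ (by norm_num)]
          linarith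
      _ ≤ _ := by gcongr

/-- The exponent `2 - p` exceeds one, so the sum is governed by the smallest gap, which is the cell
following `j` and at least as long as cell `j`. -/
theorem sum_gap_le (h : RegularGrid n T η t) {j : ℕ} {p : ℝ} (hp1 : p < 1) :
    ∑ k ∈ Finset.Ico (j + 2) n, (t (k + 1) - t k) * (t k - t (j + 1)) ^ (-(2 - p))
      ≤ 5 ^ (2 - p) / (1 - p) * (t (j + 1) - t j) ^ (p - 1) := by
  have hd := h.mesh_pos j
  have hp : 0 < 1 - p := by linarith
  rcases lt_or_ge n (j + 2) with hlt | hjn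
  · rw [Finset.Ico_eq_empty_of_le hlt.le, Finset.sum_empty]
    positivity
  · refine (h.sum_mesh_mul_gap_rpow_le (by linarith) (by linarith) hjn).trans ?_
    have h1 := h.strictMono.monotone (by omega : j + 1 ≤ n)
    have h3 := Real.rpow_nonneg (sub_nonneg.2 h1) (1 - (2 - p))
    have h4 : (t (j + 2) - t (j + 1)) ^ (1 - (2 - p)) ≤ (t (j + 1) - t j) ^ (p - 1) := by
      rw [show 1 - (2 - p) = p - 1 by ring]
      exact Real.rpow_le_rpow_of_nonpos hd (h.mesh_mono j) (by linarith)
    rw [show 1 - (2 - p) = -(1 - p) by ring, div_neg, ← neg_div, neg_sub, div_mul_eq_mul_div,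
      mul_div_assoc]
    gcongr
    rw [show -(1 - p) = 1 - (2 - p) by ring]
    linarith

/-- Summation of the cell covariances. -/
theorem sum_sum_le (h : RegularGrid n T η t) (hn : 1 ≤ n) {κ D D' : ℝ}
    (hκ : κ ∈ Set.Ioo (0 : ℝ) 1) (hD : 0 ≤ D) (hD' : 0 ≤ D') {M : ℕ → ℕ → ℝ}
    (hM : ∀ j k, M j k = M k j)
    (hdiag : ∀ j k, M j k ≤ (M j j + M k k) / 2) (hnn : ∀ j, 0 ≤ M j j)
    (hM1 : ∀ j, 1 ≤ j → j < n →
      M j j ≤ (t (j + 1) - t j) ^ 2 * (D' * t j ^ (-(1 / 2) : ℝ) * (t (j + 1) - t j) ^ κ))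
    (hM2 : ∀ j k, 1 ≤ j → j + 2 ≤ k → k < n → M j k ≤ (t (j + 1) - t j) * (t (k + 1) - t k) *
      (D * ((t (j + 1) - t j) * t j ^ (-(5 / 4) : ℝ)
          * (η ^ ((1 + κ) / 2) * (t k - t (j + 1)) ^ (-(1 / 2) : ℝ))
        + (t (j + 1) - t j) ^ ((1 + κ) / 2) * t j ^ (-(3 / 4) : ℝ)
          * (η * (t k - t (j + 1)) ^ (-(2 - (1 + κ) / 2))
            + η ^ ((1 + κ) / 2) * (t k - t (j + 1)) ^ (-(1 / 2) : ℝ))))) :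
    ∑ j ∈ Finset.Ico 1 n, ∑ k ∈ Finset.Ico 1 n, M j k ≤
      (3 * D' * (5 ^ (1 / 2 : ℝ) * (T ^ (1 - 1 / 2 : ℝ) / (1 - 1 / 2)))
        + 2 * D * (5 * (2 * T ^ (1 / 2 : ℝ)) + 5 ^ (2 - (1 + κ) / 2) / (1 - (1 + κ) / 2))
          * (5 ^ (3 / 4 : ℝ) * (T ^ (1 - 3 / 4 : ℝ) / (1 - 3 / 4)))) * η ^ (1 + κ)
      + 2 * D * (5 * (2 * T ^ (1 / 2 : ℝ))) * (η ^ ((1 + κ) / 2) *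
        ∑ j ∈ Finset.Ico 1 n, (t (j + 1) - t j) ^ 2 * t j ^ (-(5 / 4) : ℝ)) := by
  set p := (1 + κ) / 2 with hp
  have hp0 : 0 < p := by rw [hp]; linarith [hκ.1]
  have hp1 : p < 1 := by rw [hp]; linarith [hκ.2]
  have hp1' : 0 < 1 - p := by linarith
  have hT : 0 ≤ T := h.zero ▸ h.le_last n.zero_le
  have hη : 0 < η := (h.mesh_pos 0).trans_le (h.mesh_le 0 hn)
  set c₁ := 5 * (2 * T ^ (1 / 2 : ℝ)) with hc₁
  set c₂ := 5 ^ (2 - p) / (1 - p) with hc₂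
  have hc₁0 : 0 ≤ c₁ := by positivity
  have hc₂0 : 0 ≤ c₂ := by positivity
  have hdiagsum : ∑ j ∈ Finset.Ico 1 n, M j j ≤
      D' * η ^ (1 + κ) * (5 ^ (1 / 2 : ℝ) * (T ^ (1 - 1 / 2 : ℝ) / (1 - 1 / 2))) := by
    calc _ ≤ ∑ j ∈ Finset.Ico 1 n,
          D' * η ^ (1 + κ) * ((t (j + 1) - t j) * t j ^ (-(1 / 2) : ℝ)) := by
          refine Finset.sum_le_sum fun j hj ↦ ?_
          obtain ⟨hj1, hjn⟩ := Finset.mem_Ico.1 hj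
          have hd := h.mesh_pos j
          have htj := h.pos hj1
          refine (hM1 j hj1 hjn).trans ?_
          have e : (t (j + 1) - t j) * (t (j + 1) - t j) ^ κ ≤ η ^ (1 + κ) := by
            rw [← Real.rpow_one_add' hd.le (by linarith [hκ.1])]
            exact Real.rpow_le_rpow hd.le (h.mesh_le j hjn) (by linarith [hκ.1])
          calc _ = D' * ((t (j + 1) - t j) * (t (j + 1) - t j) ^ κ)
                * ((t (j + 1) - t j) * t j ^ (-(1 / 2) : ℝ)) := by ring
            _ ≤ _ := by gcongr
      _ ≤ _ := by
          rw [← Finset.mul_sum]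
          gcongr
          exact h.sum_mesh_mul_rpow_le hn (by norm_num) (by norm_num)
  have hoff (j : ℕ) (hj1 : 1 ≤ j) (hjn : j < n) : ∑ k ∈ Finset.Ico (j + 2) n, M j k ≤
      D * c₁ * η ^ p * ((t (j + 1) - t j) ^ 2 * t j ^ (-(5 / 4) : ℝ))
        + D * (c₁ + c₂) * η ^ (1 + κ) * ((t (j + 1) - t j) * t j ^ (-(3 / 4) : ℝ)) := by
    set δ := t (j + 1) - t j with hδ
    have hd : 0 < δ := h.mesh_pos j
    have hdη : δ ≤ η := h.mesh_le j hjn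
    have htj := h.pos hj1
    have s1 := h.sum_gap_half_le j
    have s2 := h.sum_gap_le (j := j) hp1
    set S₁ := ∑ k ∈ Finset.Ico (j + 2) n, (t (k + 1) - t k) * (t k - t (j + 1)) ^ (-(1 / 2) : ℝ)
    set S₂ := ∑ k ∈ Finset.Ico (j + 2) n, (t (k + 1) - t k) * (t k - t (j + 1)) ^ (-(2 - p))
    have step : ∑ k ∈ Finset.Ico (j + 2) n, M j k ≤
        δ * D * (δ * t j ^ (-(5 / 4) : ℝ) * η ^ p + δ ^ p * t j ^ (-(3 / 4) : ℝ) * η ^ p) * S₁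
          + δ * D * (δ ^ p * t j ^ (-(3 / 4) : ℝ) * η) * S₂ := by
      rw [Finset.mul_sum, Finset.mul_sum, ← Finset.sum_add_distrib]
      refine Finset.sum_le_sum fun k hk ↦ ?_
      obtain ⟨hk1, hkn⟩ := Finset.mem_Ico.1 hk
      refine (hM2 j k hj1 hk1 hkn).trans_eq ?_
      ring
    have e1 : δ ^ p * η ^ p ≤ η ^ (1 + κ) := by
      calc δ ^ p * η ^ p ≤ η ^ p * η ^ p := by gcongr
        _ = _ := by rw [← Real.rpow_add hη]; congr 1; rw [hp]; ring
    -- The divergence `δ ^ (p - 1)` of the gap sum is harmless: the exponents of `δ` add up to `2 *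
    -- p - 1 = κ`.
    have e2 : δ ^ p * η * δ ^ (p - 1) ≤ η ^ (1 + κ) := by
      calc δ ^ p * η * δ ^ (p - 1) = η * δ ^ κ := by
            rw [mul_comm (δ ^ p), mul_assoc, ← Real.rpow_add hd]
            congr 2
            rw [hp]; ring
        _ ≤ η * η ^ κ := by
            have := hκ.1
            gcongr
        _ = _ := by rw [Real.rpow_add hη, Real.rpow_one]
    have g1 : 0 ≤ t j ^ (-(5 / 4) : ℝ) := by positivity
    have g2 : 0 ≤ t j ^ (-(3 / 4) : ℝ) := by positivity
    calc _ ≤ δ * D * (δ * t j ^ (-(5 / 4) : ℝ) * η ^ p + δ ^ p * t j ^ (-(3 / 4) : ℝ) * η ^ p) * c₁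
          + δ * D * (δ ^ p * t j ^ (-(3 / 4) : ℝ) * η) * (c₂ * δ ^ (p - 1)) := by
          refine step.trans ?_
          gcongr
      _ = D * c₁ * η ^ p * (δ ^ 2 * t j ^ (-(5 / 4) : ℝ))
          + (D * c₁ * (δ ^ p * η ^ p) + D * c₂ * (δ ^ p * η * δ ^ (p - 1)))
            * (δ * t j ^ (-(3 / 4) : ℝ)) := by ring
      _ ≤ D * c₁ * η ^ p * (δ ^ 2 * t j ^ (-(5 / 4) : ℝ))
          + (D * c₁ * η ^ (1 + κ) + D * c₂ * η ^ (1 + κ)) * (δ * t j ^ (-(3 / 4) : ℝ)) := by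
          gcongr
      _ = _ := by ring
  have hoffsum : ∑ j ∈ Finset.Ico 1 n, ∑ k ∈ Finset.Ico (j + 2) n, M j k ≤
      D * c₁ * η ^ p * (∑ j ∈ Finset.Ico 1 n, (t (j + 1) - t j) ^ 2 * t j ^ (-(5 / 4) : ℝ))
        + D * (c₁ + c₂) * η ^ (1 + κ) *
          (5 ^ (3 / 4 : ℝ) * (T ^ (1 - 3 / 4 : ℝ) / (1 - 3 / 4))) := by
    calc _ ≤ ∑ j ∈ Finset.Ico 1 n,
          (D * c₁ * η ^ p * ((t (j + 1) - t j) ^ 2 * t j ^ (-(5 / 4) : ℝ))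
          + D * (c₁ + c₂) * η ^ (1 + κ) * ((t (j + 1) - t j) * t j ^ (-(3 / 4) : ℝ))) :=
          Finset.sum_le_sum fun j hj ↦ hoff j (Finset.mem_Ico.1 hj).1 (Finset.mem_Ico.1 hj).2
      _ ≤ _ := by
          rw [Finset.sum_add_distrib, ← Finset.mul_sum, ← Finset.mul_sum]
          gcongr
          exact h.sum_mesh_mul_rpow_le hn (by norm_num) (by norm_num)
  refine (sum_sum_le_of_symm M hM hdiag hnn n).trans ?_
  calc _ ≤ 3 * (D' * η ^ (1 + κ) * (5 ^ (1 / 2 : ℝ) * (T ^ (1 - 1 / 2 : ℝ) / (1 - 1 / 2))))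
        + 2 * (D * c₁ * η ^ p *
            (∑ j ∈ Finset.Ico 1 n, (t (j + 1) - t j) ^ 2 * t j ^ (-(5 / 4) : ℝ))
          + D * (c₁ + c₂) * η ^ (1 + κ) *
            (5 ^ (3 / 4 : ℝ) * (T ^ (1 - 3 / 4 : ℝ) / (1 - 3 / 4)))) := by gcongr
    _ = _ := by ring

end RegularGrid

/-! ### The quadrature error -/

theorem BddMeas.sum {α ι : Type*} [MeasurableSpace α] (s : Finset ι) {f : ι → α → ℝ}
    (hf : ∀ i ∈ s, BddMeas (f i)) : BddMeas fun x ↦ ∑ i ∈ s, f i x := by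
  classical
  induction s using Finset.induction_on with
  | empty => simpa using BddMeas.const 0
  | insert i s hi ih =>
    simp_rw [Finset.sum_insert hi]
    exact (hf i (s.mem_insert_self i)).add (ih fun j hj ↦ hf j (Finset.mem_insert_of_mem hj))

theorem mem_cell {p q r u : ℝ} (hu : u ∈ Set.Ioc (min p r) (min q r)) :
    p < u ∧ u ≤ q ∧ u ≤ r := by
  obtain ⟨h1, h2⟩ := hu
  rw [min_lt_iff] at h1
  rw [le_min_iff] at h2
  exact ⟨h1.resolve_right h2.2.not_gt, h2⟩

theorem min_sub_min_le {p q r : ℝ} (h : p ≤ q) : min q r - min p r ≤ q - p := by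
  rcases le_total p r with h1 | h1
  · rw [min_eq_left h1]; linarith [min_le_left q r]
  · rw [min_eq_right h1, min_eq_right (h1.trans h)]; linarith

/-! ### Moments of the cell integrals -/

section

variable {Ω : Type*} [MeasurableSpace Ω] {P : Measure Ω} [IsProbabilityMeasure P] {T : ℝ}
  {W : ℝ → Ω → ℝ} {ξ : Ω → ℝ} {X : ℝ × Ω → ℝ} {κ C : ℝ} {b w : ℝ → ℝ}

/-- The contribution of the cell from `p` to `q`, stopped at `r`. -/
noncomputable def cellIntegral (b w : ℝ → ℝ) (X : ℝ × Ω → ℝ) (p q r : ℝ) (ω : Ω) : ℝ :=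
  ∫ s in (min p r)..(min q r), pathIncrement b w X p (s, ω)

theorem BddMeas.cellIntegral (hb : BddMeas b) (hw : BddMeas w) (hX : Measurable X) {p q : ℝ}
    (hpq : p ≤ q) (r : ℝ) : BddMeas (cellIntegral b w X p q r) :=
  (hb.pathIncrement hw hX p).intervalIntegral (min_le_min_right r hpq)

variable (H : WeightedDrift κ (5 * T) C b w) (hX : Measurable X)
  (hXW : ∀ᵐ ω ∂P, ∀ s ∈ Set.Icc 0 T, X (s, ω) = W s ω + ξ ω)

omit [MeasurableSpace Ω] in
include H in
theorem WeightedDrift.abs_pathIncrement_le (t : ℝ) (p : ℝ × Ω) :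
    |pathIncrement b w X t p| ≤ 2 * C ^ 2 := by
  have hC := H.one_le
  rw [pathIncrement, abs_mul]
  have := abs_sub (b (X p)) (b (X (t, p.2)))
  calc _ ≤ C * (C + C) := by
        refine mul_le_mul (H.abs_w_le _) (this.trans ?_) (abs_nonneg _) (by linarith)
        exact add_le_add (H.abs_b_le _) (H.abs_b_le _)
    _ = _ := by ring

include H in
-- Boundedness alone. It serves the first cell, where the density bound `p ^ (-1/2)` is not
-- available.
theorem WeightedDrift.integral_cellIntegral_sq_le {p q r η : ℝ} (hpq : p ≤ q) (hη : q - p ≤ η) :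
    ∫ ω, cellIntegral b w X p q r ω ^ 2 ∂P ≤ 4 * C ^ 4 * η ^ 2 := by
  refine (le_abs_self _).trans (abs_integral_le_of_forall fun ω ↦ ?_)
  have h1 := intervalIntegral.norm_integral_le_of_norm_le_const (a := min p r) (b := min q r)
    (f := fun s ↦ pathIncrement b w X p (s, ω)) (C := 2 * C ^ 2)
    fun s _ ↦ H.abs_pathIncrement_le p (s, ω)
  rw [abs_of_nonneg (sub_nonneg.2 (min_le_min_right r hpq)), Real.norm_eq_abs] at h1
  have h2 : |cellIntegral b w X p q r ω| ≤ 2 * C ^ 2 * η :=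
    h1.trans (by gcongr; exact (min_sub_min_le hpq).trans hη)
  rw [abs_of_nonneg (sq_nonneg _), ← sq_abs]
  calc _ ≤ (2 * C ^ 2 * η) ^ 2 := pow_le_pow_left₀ (abs_nonneg _) h2 2
    _ = _ := by ring

include H hX hXW in
theorem IsBrownianMotionOn.cellIntegral_sq_le (hW : IsBrownianMotionOn T W P) (hξ : Measurable ξ)
    (hind : IndepFun ξ (fun ω (t : Set.Icc (0 : ℝ) T) ↦ W t ω) P) {p q r : ℝ} (hp : 0 < p)
    (hpq : p < q) (hq : q ≤ T) :
    ∫ ω, cellIntegral b w X p q r ω * cellIntegral b w X p q r ω ∂P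
      ≤ (q - p) ^ 2 * (C ^ 3 * p ^ (-(1 / 2) : ℝ) * (q - p) ^ κ) := by
  have hC := H.one_le
  have hb := H.bddMeas_b
  have hw := H.bddMeas_w
  have hY := hb.pathIncrement hw hX p
  set B := C ^ 3 * p ^ (-(1 / 2) : ℝ) * (q - p) ^ κ with hB
  have hpq0 : 0 < q - p := sub_pos.2 hpq
  have hB0 : 0 ≤ B := by positivity
  have sq_le (u : ℝ) (hu : u ∈ Set.Ioc (min p r) (min q r)) :
      ∫ ω, pathIncrement b w X p (u, ω) ^ 2 ∂P ≤ B := by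
    obtain ⟨h1, h2, -⟩ := mem_cell hu
    have hup : 0 < u - p := by linarith
    have e := hW.integral_sq_increment_le hξ hind hp h1.le (h2.trans hq) hb (H.energy_b _ hup)
    have hc : ∫ ω, (b (W u ω + ξ ω) - b (W p ω + ξ ω)) ^ 2 ∂P
        = ∫ ω, (b (X (u, ω)) - b (X (p, ω))) ^ 2 ∂P := by
      refine integral_congr_ae ?_
      filter_upwards [hXW] with ω hω
      rw [hω u ⟨by linarith, by linarith⟩, hω p ⟨by linarith, by linarith⟩]
    rw [hc] at e
    have hd : BddMeas fun ω ↦ b (X (u, ω)) - b (X (p, ω)) :=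
      (hb.comp (by fun_prop)).sub (hb.comp (by fun_prop))
    calc _ ≤ ∫ ω, C ^ 2 * (b (X (u, ω)) - b (X (p, ω))) ^ 2 ∂P := by
          refine integral_mono ((hY.comp (by fun_prop : Measurable fun ω ↦ (u, ω))).sq.integrable P)
            ((hd.sq.integrable P).const_mul _) fun ω ↦ ?_
          simp only [pathIncrement, mul_pow]
          rw [← sq_abs (w _)]
          gcongr
          exact H.abs_w_le _
      _ ≤ C ^ 2 * (p ^ (-(1 / 2) : ℝ) * (C * (u - p) ^ κ)) := by
          rw [integral_const_mul]; gcongr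
      _ ≤ C ^ 2 * (p ^ (-(1 / 2) : ℝ) * (C * (q - p) ^ κ)) := by
          have := H.κ_mem.1
          gcongr
      _ = B := by rw [hB]; ring
  have main := abs_integral_mul_intervalIntegral_le (P := P) hY hY (min_le_min_right r hpq.le)
    (min_le_min_right r hpq.le) (B := B) fun u hu s hs ↦ by
      refine (abs_integral_mul_le_half (hY.comp (by fun_prop : Measurable fun ω ↦ (u, ω)))
        (hY.comp (by fun_prop : Measurable fun ω ↦ (s, ω)))).trans ?_
      linarith [sq_le u hu, sq_le s hs]
  refine (le_abs_self _).trans (main.trans ?_)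
  have h0 : 0 ≤ min q r - min p r := sub_nonneg.2 (min_le_min_right r hpq.le)
  have h1 := min_sub_min_le (r := r) hpq.le
  rw [sq]
  gcongr

include H hX hXW in
theorem IsBrownianMotionOn.cellIntegral_mul_le (hW : IsBrownianMotionOn T W P)
    (hξ : Measurable ξ) (hind : IndepFun ξ (fun ω (t : Set.Icc (0 : ℝ) T) ↦ W t ω) P)
    {p q p' q' r B : ℝ} (hp : 0 < p) (hpq : p < q) (hqp : q ≤ p') (hpq' : p' < q') (hq' : q' ≤ T)
    (hB0 : 0 ≤ B)
    (hB : ∀ u ∈ Set.Ioc p q, ∀ s ∈ Set.Ioc p' q', ∀ x₀,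
      |incrementCorrelation b w p (u - p) (p' - u) (s - p') x₀| ≤ B) :
    ∫ ω, cellIntegral b w X p q r ω * cellIntegral b w X p' q' r ω ∂P
      ≤ (q - p) * (q' - p') * B := by
  have hb := H.bddMeas_b
  have hw := H.bddMeas_w
  have main := abs_integral_mul_intervalIntegral_le (P := P) (hb.pathIncrement hw hX p)
    (hb.pathIncrement hw hX p') (min_le_min_right r hpq.le) (min_le_min_right r hpq'.le)
    (B := B) fun u hu s hs ↦ by
      obtain ⟨u1, u2, -⟩ := mem_cell hu
      obtain ⟨s1, s2, -⟩ := mem_cell hs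
      have e := hW.abs_integral_increments_le hξ hind hp.le u1.le (u2.trans hqp) s1.le
        (s2.trans hq') hb hw (hB u ⟨u1, u2⟩ s ⟨s1, s2⟩)
      refine (le_of_eq (congrArg _ (integral_congr_ae ?_))).trans e
      filter_upwards [hXW] with ω hω
      simp only [pathIncrement]
      rw [hω u ⟨by linarith, by linarith⟩, hω p ⟨by linarith, by linarith⟩,
        hω s ⟨by linarith, by linarith⟩, hω p' ⟨by linarith, by linarith⟩]
  refine (le_abs_self _).trans (main.trans ?_)
  have h0 : 0 ≤ min q' r - min p' r := sub_nonneg.2 (min_le_min_right r hpq'.le)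
  have h1 := min_sub_min_le (r := r) hpq.le
  have h2 := min_sub_min_le (r := r) hpq'.le
  gcongr

include H hX hXW in
/-- The quadrature error is the mean square of the sum of the cell integrals. -/
theorem lintegral_quadrature_eq {n : ℕ} {η : ℝ} {t : ℕ → ℝ} (h : RegularGrid n T η t) {r : ℝ}
    (hr : r ∈ Set.Icc 0 T) :
    ∫⁻ ω, ENNReal.ofReal (|∫ s in (0 : ℝ)..r, w (W s ω + ξ ω) *
        (b (W s ω + ξ ω) - b (W (gridFloor n t s) ω + ξ ω))| ^ 2) ∂P
      = ENNReal.ofReal (∫ ω, (∑ j ∈ Finset.range n,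
          cellIntegral b w X (t j) (t (j + 1)) r ω) ^ 2 ∂P) := by
  have hb := H.bddMeas_b
  have hw := H.bddMeas_w
  have hI (j : ℕ) : BddMeas (cellIntegral b w X (t j) (t (j + 1)) r) :=
    hb.cellIntegral hw hX (h.strictMono j.lt_succ_self).le r
  have hS : BddMeas fun ω ↦ ∑ j ∈ Finset.range n, cellIntegral b w X (t j) (t (j + 1)) r ω :=
    BddMeas.sum _ fun j _ ↦ hI j
  rw [ofReal_integral_sq hS]
  refine lintegral_congr_ae ?_
  filter_upwards [hXW] with ω hω
  rw [sq_abs]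
  congr 2
  have e := intervalIntegral_gridFloor (n := n) h.strictMono h.zero hr.1 (hr.2.trans h.last.ge)
    (fun p s ↦ pathIncrement b w X p (s, ω)) fun j ↦ by
      have : BddMeas fun s ↦ pathIncrement b w X (t j) (s, ω) :=
        (hb.pathIncrement hw hX (t j)).comp (by fun_prop)
      exact ⟨this.integrable _, this.integrable _⟩
  simp only [cellIntegral]
  rw [← e]
  refine intervalIntegral.integral_congr fun s hs ↦ ?_
  rw [Set.uIcc_of_le hr.1] at hs
  -- The last grid point before `s` is itself one of the times in `[0, T]`, so the modification
  -- agrees with the path there too.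
  obtain ⟨k, ⟨hkn, -⟩, hk⟩ := (gridFloor_isGreatest n t s (h.zero.trans_le hs.1)).1
  have hk0 : 0 ≤ t k := h.zero ▸ h.strictMono.monotone k.zero_le
  simp only [pathIncrement]
  rw [← hk, hω s ⟨hs.1, hs.2.trans hr.2⟩, hω (t k) ⟨hk0, h.le_last hkn⟩]

end

/-- The scale `5 * T` covers the energy of `w b` at scale `5 * a` for every waiting time `a ≤ T`.
The remaining sum is left explicit because it is the only term sensitive to the shape of the grid
near `0`. -/
theorem WeightedDrift.exists_quadrature_bound {κ T C : ℝ} (hT : 0 < T) {b w : ℝ → ℝ}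
    (H : WeightedDrift κ (5 * T) C b w) :
    ∃ D : ℝ, 0 < D ∧ ∀ (Ω : Type*) [MeasurableSpace Ω] (P : Measure Ω) [IsProbabilityMeasure P]
      (W : ℝ → Ω → ℝ) (ξ : Ω → ℝ), IsBrownianMotionOn T W P → Measurable ξ →
      IndepFun ξ (fun ω (t : Set.Icc (0 : ℝ) T) ↦ W t ω) P →
      ∀ (n : ℕ) (η : ℝ) (t : ℕ → ℝ), 1 ≤ n → η ≤ 2 * T → RegularGrid n T η t →
      ∀ r ∈ Set.Icc 0 T,
        ∫⁻ ω, ENNReal.ofReal (|∫ s in (0 : ℝ)..r, w (W s ω + ξ ω) *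
          (b (W s ω + ξ ω) - b (W (gridFloor n t s) ω + ξ ω))| ^ 2) ∂P
        ≤ ENNReal.ofReal (D * (η ^ (1 + κ) + η ^ ((1 + κ) / 2) *
          ∑ j ∈ Finset.Ico 1 n, (t (j + 1) - t j) ^ 2 * t j ^ (-(5 / 4) : ℝ))) := by
  obtain ⟨D, hD, hcorr⟩ := H.exists_correlation_bound
  have hκ := H.κ_mem
  have hC := H.one_le
  have hp1 : 0 < 1 - (1 + κ) / 2 := by linarith [hκ.2]
  set c := 3 * C ^ 3 * (5 ^ (1 / 2 : ℝ) * (T ^ (1 - 1 / 2 : ℝ) / (1 - 1 / 2)))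
        + 2 * D * (5 * (2 * T ^ (1 / 2 : ℝ)) + 5 ^ (2 - (1 + κ) / 2) / (1 - (1 + κ) / 2))
          * (5 ^ (3 / 4 : ℝ) * (T ^ (1 - 3 / 4 : ℝ) / (1 - 3 / 4))) with hc
  have hc0 : 0 ≤ c := by
    have : (0 : ℝ) < 1 - 1 / 2 := by norm_num
    have : (0 : ℝ) < 1 - 3 / 4 := by norm_num
    positivity
  set c' := 2 * D * (5 * (2 * T ^ (1 / 2 : ℝ))) with hc'
  have hc'0 : 0 ≤ c' := by positivity
  -- Splitting off the first cell doubles both parts: `8 = 2 * 4` for that cell, `2 * c` and `2 *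
  -- c'` for the others. The summand `1` ensures positivity.
  refine ⟨1 + 8 * C ^ 4 * (2 * T) ^ (1 - κ) + 2 * c + 2 * c', by positivity, ?_⟩
  intro Ω _ P _ W ξ hW hξ hind n η t hn hη2 h r hr
  obtain ⟨X, hX, hXW⟩ := hW.exists_measurable_modification hT.le hξ
  rw [lintegral_quadrature_eq H hX hXW h hr]
  refine ENNReal.ofReal_le_ofReal ?_
  have hη : 0 < η := (h.mesh_pos 0).trans_le (h.mesh_le 0 hn)
  set I : ℕ → Ω → ℝ := fun j ↦ cellIntegral b w X (t j) (t (j + 1)) r with hIdef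
  have hI (j : ℕ) : BddMeas (I j) :=
    H.bddMeas_b.cellIntegral H.bddMeas_w hX (h.strictMono j.lt_succ_self).le r
  set M : ℕ → ℕ → ℝ := fun j k ↦ ∫ ω, I j ω * I k ω ∂P with hM
  have hS : ∑ j ∈ Finset.Ico 1 n, ∑ k ∈ Finset.Ico 1 n, M j k ≤ c * η ^ (1 + κ)
      + c' * (η ^ ((1 + κ) / 2) *
        ∑ j ∈ Finset.Ico 1 n, (t (j + 1) - t j) ^ 2 * t j ^ (-(5 / 4) : ℝ)) := by
    refine h.sum_sum_le hn hκ hD (by positivity : 0 ≤ C ^ 3) (fun j k ↦ ?_) (fun j k ↦ ?_)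
      (fun j ↦ ?_) (fun j hj1 hjn ↦ ?_) (fun j k hj1 hjk hkn ↦ ?_)
    · simp only [hM, mul_comm]
    · refine ((le_abs_self _).trans (abs_integral_mul_le_half (hI j) (hI k))).trans_eq ?_
      simp only [hM, sq]
    · exact integral_nonneg fun ω ↦ mul_self_nonneg _
    · exact hW.cellIntegral_sq_le H hX hXW hξ hind (h.pos hj1) (h.strictMono j.lt_succ_self)
        (h.le_last hjn)
    · have hjn : j < n := by omega
      have hA : 0 < t k - t (j + 1) := sub_pos.2 (h.strictMono (by omega))
      have htj := h.pos hj1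
      have hd := h.mesh_pos j
      have hdk := h.mesh_pos k
      have hjT := h.le_last (by omega : j + 1 ≤ n)
      have hkT := h.le_last (by omega : k + 1 ≤ n)
      have hgap := h.mesh_le_gap hjk
      have hkη := h.mesh_le k hkn
      refine hW.cellIntegral_mul_le H hX hXW hξ hind htj (h.strictMono j.lt_succ_self)
        (h.strictMono.monotone (by omega)) (h.strictMono k.lt_succ_self) hkT (by positivity)
        fun u hu s hs x₀ ↦ ?_
      have hu1 := hu.1
      have hu2 := hu.2
      have hs1 := hs.1
      have hs2 := hs.2
      refine hcorr _ _ _ _ _ _ _ _ htj ?_ ?_ ?_ (h.mesh_le_mul j hj1) ?_ ?_ hA ?_ ?_ ?_ ?_ ?_ ?_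
        <;> linarith
  have h0 : ∫ ω, I 0 ω ^ 2 ∂P ≤ 4 * C ^ 4 * η ^ 2 :=
    H.integral_cellIntegral_sq_le (h.strictMono Nat.zero_lt_one).le (h.mesh_le 0 hn)
  have hη2' : η ^ 2 ≤ (2 * T) ^ (1 - κ) * η ^ (1 + κ) := by
    calc η ^ 2 = η ^ (1 - κ) * η ^ (1 + κ) := by
          rw [← Real.rpow_add hη, ← Real.rpow_natCast]; norm_num
      _ ≤ _ := by
        have := hκ.2
        gcongr
  have hsum (s : Finset ℕ) : BddMeas fun ω ↦ ∑ j ∈ s, I j ω := BddMeas.sum s fun j _ ↦ hI j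
  have hexp : ∫ ω, (∑ j ∈ Finset.Ico 1 n, I j ω) ^ 2 ∂P
      = ∑ j ∈ Finset.Ico 1 n, ∑ k ∈ Finset.Ico 1 n, M j k := by
    have i (j k : ℕ) : Integrable (fun ω ↦ I j ω * I k ω) P := ((hI j).mul (hI k)).integrable P
    simp_rw [sq, Finset.sum_mul_sum]
    rw [integral_finsetSum _ fun j _ ↦ integrable_finsetSum _ fun k _ ↦ i j k]
    exact Finset.sum_congr rfl fun j _ ↦ integral_finsetSum _ fun k _ ↦ i j k
  have hsplit : ∫ ω, (∑ j ∈ Finset.range n, I j ω) ^ 2 ∂P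
      ≤ 2 * (∫ ω, I 0 ω ^ 2 ∂P) + 2 * ∫ ω, (∑ j ∈ Finset.Ico 1 n, I j ω) ^ 2 ∂P := by
    rw [← integral_const_mul, ← integral_const_mul, ← integral_add
      (((hI 0).sq.integrable P).const_mul 2) (((hsum _).sq.integrable P).const_mul 2)]
    refine integral_mono ((hsum _).sq.integrable P) ((((hI 0).sq.integrable P).const_mul 2).add
      (((hsum _).sq.integrable P).const_mul 2)) fun ω ↦ ?_
    simp only
    rw [Finset.range_eq_Ico, Finset.sum_eq_sum_Ico_succ_bot (by omega : 0 < n)]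
    nlinarith [sq_nonneg (I 0 ω - ∑ j ∈ Finset.Ico (0 + 1) n, I j ω)]
  rw [hexp] at hsplit
  set S := η ^ ((1 + κ) / 2) *
    ∑ j ∈ Finset.Ico 1 n, (t (j + 1) - t j) ^ 2 * t j ^ (-(5 / 4) : ℝ) with hSdef
  have hS0 : 0 ≤ S := by
    refine mul_nonneg (by positivity) (Finset.sum_nonneg fun j hj ↦ ?_)
    have := h.pos (Finset.mem_Ico.1 hj).1
    positivity
  have hE0 : 0 ≤ η ^ (1 + κ) := by positivity
  have g1 : 4 * C ^ 4 * η ^ 2 ≤ 4 * C ^ 4 * ((2 * T) ^ (1 - κ) * η ^ (1 + κ)) := by gcongr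
  have g2 : 0 ≤ 8 * C ^ 4 * (2 * T) ^ (1 - κ) := by positivity
  nlinarith [mul_nonneg g2 hS0, mul_nonneg hc0 hS0, mul_nonneg hc'0 hE0]

/-! ### The equidistant and the quadratic grid -/

theorem equiGrid_succ_sub (T : ℝ) (n k : ℕ) : equiGrid T n (k + 1) - equiGrid T n k = T / n := by
  simp only [equiGrid, Nat.cast_add, Nat.cast_one]
  ring

theorem starGrid_succ_sub (T : ℝ) (n k : ℕ) :
    starGrid T n (k + 1) - starGrid T n k = T / n ^ 2 * (2 * k + 1) := by
  simp only [starGrid, Nat.cast_add, Nat.cast_one]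
  ring

theorem starGrid_eq (T : ℝ) (n k : ℕ) : starGrid T n k = T / n ^ 2 * k ^ 2 := by
  simp only [starGrid]
  ring

theorem regularGrid_equiGrid {T : ℝ} (hT : 0 < T) {n : ℕ} (hn : 1 ≤ n) :
    RegularGrid n T (T / n) (equiGrid T n) := by
  have hn0 : (0 : ℝ) < n := by exact_mod_cast hn
  have hd : 0 < T / n := by positivity
  refine ⟨by simp [equiGrid], by simp [equiGrid, hn0.ne'], strictMono_nat_of_lt_succ fun k ↦ ?_,
    fun j _ ↦ (equiGrid_succ_sub T n j).le, fun j hj ↦ ?_, fun j ↦ ?_, fun j _ ↦ ?_⟩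
  · exact sub_pos.1 (by rwa [equiGrid_succ_sub])
  · have hj' : (1 : ℝ) ≤ j := by exact_mod_cast hj
    rw [equiGrid_succ_sub, equiGrid, show T * ((j : ℝ) / n) = T / n * j by ring]
    nlinarith
  · rw [equiGrid_succ_sub, equiGrid_succ_sub T n (j + 1)]
  · rw [equiGrid_succ_sub, equiGrid_succ_sub]
    linarith

theorem regularGrid_starGrid {T : ℝ} (hT : 0 < T) {n : ℕ} (hn : 1 ≤ n) :
    RegularGrid n T (2 * T / n) (starGrid T n) := by
  have hn0 : (0 : ℝ) < n := by exact_mod_cast hn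
  have hd : 0 < T / n ^ 2 := by positivity
  refine ⟨by simp [starGrid], by simp [starGrid, hn0.ne'], strictMono_nat_of_lt_succ fun k ↦ ?_,
    fun j hj ↦ ?_, fun j hj ↦ ?_, fun j ↦ ?_, fun j hj ↦ ?_⟩
  · exact sub_pos.1 (by rw [starGrid_succ_sub]; positivity)
  · have hj' : (j : ℝ) + 1 ≤ n := by exact_mod_cast hj
    rw [starGrid_succ_sub, show 2 * T / n = T / n ^ 2 * (2 * n) by field_simp]
    gcongr
    linarith
  · have hj' : (1 : ℝ) ≤ j := by exact_mod_cast hj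
    rw [starGrid_succ_sub, starGrid_eq, show 4 * (T / n ^ 2 * (j : ℝ) ^ 2)
      = T / n ^ 2 * (4 * j ^ 2) by ring]
    gcongr
    nlinarith
  · rw [starGrid_succ_sub, starGrid_succ_sub T n (j + 1)]
    gcongr
    simp
  · have hj' : (1 : ℝ) ≤ j := by exact_mod_cast hj
    rw [starGrid_succ_sub, starGrid_succ_sub, show 2 * (T / n ^ 2 * (2 * (j : ℝ) + 1))
      = T / n ^ 2 * (2 * (2 * j + 1)) by ring]
    gcongr
    push_cast
    linarith

/-- One factor `T / n` comes out. The exponent `5/4` exceeds one, so the rest is dominated by the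
first grid point and is of order `(T / n) ^ (-1/4)`. -/
theorem sum_equiGrid_le {T : ℝ} (hT : 0 < T) {n : ℕ} (hn : 1 ≤ n) :
    ∑ j ∈ Finset.Ico 1 n, (equiGrid T n (j + 1) - equiGrid T n j) ^ 2
        * equiGrid T n j ^ (-(5 / 4) : ℝ) ≤ 4 * 5 ^ (5 / 4 : ℝ) * (T / n) ^ (3 / 4 : ℝ) := by
  have hn0 : (0 : ℝ) < n := by exact_mod_cast hn
  have hd : 0 < T / n := by positivity
  have h := regularGrid_equiGrid hT hn
  have main := sum_mul_rpow_le (x := equiGrid T n) hn (p := 5 / 4) (by norm_num) (by norm_num)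
    (fun k hk ↦ h.pos hk) (fun k _ ↦ (h.strictMono k.lt_succ_self).le)
    (fun k hk ↦ by linarith [h.mesh_le_mul k hk])
  have e1 : equiGrid T n 1 = T / n := by simp [equiGrid, div_eq_mul_inv]
  calc ∑ j ∈ Finset.Ico 1 n, (equiGrid T n (j + 1) - equiGrid T n j) ^ 2
          * equiGrid T n j ^ (-(5 / 4) : ℝ)
      = T / n * ∑ j ∈ Finset.Ico 1 n, (equiGrid T n (j + 1) - equiGrid T n j)
          * equiGrid T n j ^ (-(5 / 4) : ℝ) := by
        rw [Finset.mul_sum]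
        refine Finset.sum_congr rfl fun j _ ↦ ?_
        rw [equiGrid_succ_sub]
        ring
    _ ≤ T / n * (5 ^ (5 / 4 : ℝ) * (4 * (T / n) ^ (-(1 / 4) : ℝ))) := by
        refine mul_le_mul_of_nonneg_left (main.trans ?_) hd.le
        gcongr
        rw [h.last, e1]
        norm_num
        have : 0 ≤ T ^ (-(1 / 4) : ℝ) := by positivity
        linarith
    _ = _ := by
        rw [show (3 / 4 : ℝ) = 1 + -(1 / 4) by norm_num, Real.rpow_add hd, Real.rpow_one]
        ring

/-- The cells shrink near zero like `√(t_j) / n`. One mesh factor therefore lowers the exponent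
`5/4` to the integrable `3/4` and supplies `1 / n`. -/
theorem sum_starGrid_le {T : ℝ} (hT : 0 < T) {n : ℕ} (hn : 1 ≤ n) :
    ∑ j ∈ Finset.Ico 1 n, (starGrid T n (j + 1) - starGrid T n j) ^ 2
        * starGrid T n j ^ (-(5 / 4) : ℝ)
      ≤ 3 * √T * (5 ^ (3 / 4 : ℝ) * (T ^ (1 - 3 / 4 : ℝ) / (1 - 3 / 4))) / n := by
  have hn0 : (0 : ℝ) < n := by exact_mod_cast hn
  have h := regularGrid_starGrid hT hn
  have main := h.sum_mesh_mul_rpow_le hn (q := 3 / 4) (by norm_num) (by norm_num)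
  calc ∑ j ∈ Finset.Ico 1 n, (starGrid T n (j + 1) - starGrid T n j) ^ 2
          * starGrid T n j ^ (-(5 / 4) : ℝ)
      ≤ ∑ j ∈ Finset.Ico 1 n, 3 * √T / n * ((starGrid T n (j + 1) - starGrid T n j)
          * starGrid T n j ^ (-(3 / 4) : ℝ)) := by
        refine Finset.sum_le_sum fun j hj ↦ ?_
        have hj1 := (Finset.mem_Ico.1 hj).1
        have hj' : (1 : ℝ) ≤ j := by exact_mod_cast hj1
        have ht := h.pos hj1
        have hd := h.mesh_pos j
        have hroot : √(starGrid T n j) = √T * (j / n) := by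
          rw [starGrid, Real.sqrt_mul hT.le, Real.sqrt_sq (by positivity)]
        have hmesh : starGrid T n (j + 1) - starGrid T n j
            ≤ 3 * √T / n * starGrid T n j ^ (1 / 2 : ℝ) := by
          rw [← Real.sqrt_eq_rpow, hroot, starGrid_succ_sub, show 3 * √T / n * (√T * (j / n))
            = √T * √T / n ^ 2 * (3 * j) by ring, Real.mul_self_sqrt hT.le]
          gcongr
          linarith
        calc _ ≤ (starGrid T n (j + 1) - starGrid T n j)
              * (3 * √T / n * starGrid T n j ^ (1 / 2 : ℝ)) * starGrid T n j ^ (-(5 / 4) : ℝ) := by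
              rw [sq]
              gcongr
          _ = _ := by
              rw [show (-(3 / 4) : ℝ) = 1 / 2 + -(5 / 4) by norm_num, Real.rpow_add ht]
              ring
    _ = 3 * √T / n * ∑ j ∈ Finset.Ico 1 n, (starGrid T n (j + 1) - starGrid T n j)
          * starGrid T n j ^ (-(3 / 4) : ℝ) := by rw [Finset.mul_sum]
    _ ≤ 3 * √T / n * (5 ^ (3 / 4 : ℝ) * (T ^ (1 - 3 / 4 : ℝ) / (1 - 3 / 4))) := by gcongr
    _ = _ := by ring

theorem exists_equiGrid_rate {T : ℝ} (hT : 0 < T) {κ : ℝ} (hκ : κ ∈ Set.Ioo (0 : ℝ) 1) :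
    ∃ K : ℝ, 0 < K ∧ ∀ n : ℕ, 1 ≤ n → (T / n) ^ (1 + κ) + (T / n) ^ ((1 + κ) / 2) *
      ∑ j ∈ Finset.Ico 1 n, (equiGrid T n (j + 1) - equiGrid T n j) ^ 2
        * equiGrid T n j ^ (-(5 / 4) : ℝ)
      ≤ K * (1 / (n : ℝ) ^ (1 + κ) + 1 / (n : ℝ) ^ (3 / 2 : ℝ)) := by
  have hκ0 := hκ.1
  set c : ℝ := 2 * 5 ^ (5 / 4 : ℝ)
  have hc : 0 < c := by positivity
  refine ⟨(1 + c) * (T ^ (1 + κ) + T ^ (3 / 2 : ℝ)), by positivity, fun n hn ↦ ?_⟩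
  have hn0 : (0 : ℝ) < n := by exact_mod_cast hn
  have hd : 0 < T / n := by positivity
  have hS := sum_equiGrid_le hT hn
  have hsq (q : ℝ) : (T / n) ^ q = ((T / n) ^ (q / 2)) ^ 2 := by
    rw [← Real.rpow_natCast, ← Real.rpow_mul hd.le]
    norm_num
  -- The mixed power is the geometric mean of the two claimed rates.
  have hprod : (T / n) ^ ((1 + κ) / 2) * (4 * 5 ^ (5 / 4 : ℝ) * (T / n) ^ (3 / 4 : ℝ))
      ≤ c * ((T / n) ^ (1 + κ) + (T / n) ^ (3 / 2 : ℝ)) := by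
    rw [hsq (1 + κ), hsq (3 / 2), show (3 / 2 / 2 : ℝ) = 3 / 4 by norm_num]
    have := two_mul_le_add_sq ((T / n) ^ ((1 + κ) / 2)) ((T / n) ^ (3 / 4 : ℝ))
    calc _ = c * (2 * (T / n) ^ ((1 + κ) / 2) * (T / n) ^ (3 / 4 : ℝ)) := by ring
      _ ≤ _ := by gcongr
  have h1 : (T / n) ^ (1 + κ) = T ^ (1 + κ) * (1 / (n : ℝ) ^ (1 + κ)) := by
    rw [Real.div_rpow hT.le hn0.le]; ring
  have h2 : (T / n) ^ (3 / 2 : ℝ) = T ^ (3 / 2 : ℝ) * (1 / (n : ℝ) ^ (3 / 2 : ℝ)) := by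
    rw [Real.div_rpow hT.le hn0.le]; ring
  have hT1 : 0 < T ^ (1 + κ) := by positivity
  have hT2 : 0 < T ^ (3 / 2 : ℝ) := by positivity
  calc _ ≤ (T / n) ^ (1 + κ) + c * ((T / n) ^ (1 + κ) + (T / n) ^ (3 / 2 : ℝ)) := by
        refine add_le_add_right ?_ _
        exact (mul_le_mul_of_nonneg_left hS (by positivity)).trans hprod
    _ ≤ (1 + c) * ((T / n) ^ (1 + κ) + (T / n) ^ (3 / 2 : ℝ)) := by
        have : 0 < (T / n) ^ (3 / 2 : ℝ) := by positivity
        linarith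
    _ ≤ _ := by
        rw [h1, h2, mul_assoc]
        gcongr
        have a1 : 0 < 1 / (n : ℝ) ^ (1 + κ) := by positivity
        have a2 : 0 < 1 / (n : ℝ) ^ (3 / 2 : ℝ) := by positivity
        nlinarith [mul_pos hT1 a2, mul_pos hT2 a1]

theorem exists_starGrid_rate {T : ℝ} (hT : 0 < T) {κ : ℝ} (hκ : κ ∈ Set.Ioo (0 : ℝ) 1) :
    ∃ K : ℝ, 0 < K ∧ ∀ n : ℕ, 1 ≤ n → (2 * T / n) ^ (1 + κ) + (2 * T / n) ^ ((1 + κ) / 2) *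
      ∑ j ∈ Finset.Ico 1 n, (starGrid T n (j + 1) - starGrid T n j) ^ 2
        * starGrid T n j ^ (-(5 / 4) : ℝ)
      ≤ K * ((1 + Real.log n) / (n : ℝ) ^ (1 + κ)) := by
  have hκ0 := hκ.1
  have hκ1 := hκ.2
  set c : ℝ := 3 * √T * (5 ^ (3 / 4 : ℝ) * (T ^ (1 - 3 / 4 : ℝ) / (1 - 3 / 4)))
  have hc : 0 < c := by
    have : (0 : ℝ) < 1 - 3 / 4 := by norm_num
    positivity
  refine ⟨(2 * T) ^ (1 + κ) + (2 * T) ^ ((1 + κ) / 2) * c, by positivity, fun n hn ↦ ?_⟩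
  have hn1 : (1 : ℝ) ≤ n := by exact_mod_cast hn
  have hn0 : (0 : ℝ) < n := by linarith
  have hS := sum_starGrid_le hT hn
  -- Since `κ < 1`, the exponent `(1 + κ) / 2 + 1` beats `1 + κ`. The rate thus holds without a
  -- logarithm, which enters only through `1 ≤ 1 + log n`.
  have hpow : (n : ℝ) ^ (1 + κ) ≤ (n : ℝ) ^ ((1 + κ) / 2) * n := by
    rw [← Real.rpow_add_one hn0.ne']
    exact Real.rpow_le_rpow_of_exponent_le hn1 (by linarith)
  calc _ ≤ (2 * T / n) ^ (1 + κ) + (2 * T / n) ^ ((1 + κ) / 2) * (c / n) := by gcongr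
    _ = (2 * T) ^ (1 + κ) * (1 / (n : ℝ) ^ (1 + κ))
        + (2 * T) ^ ((1 + κ) / 2) * c * (1 / ((n : ℝ) ^ ((1 + κ) / 2) * n)) := by
        rw [Real.div_rpow (by positivity) hn0.le, Real.div_rpow (by positivity) hn0.le]
        field_simp
    _ ≤ (2 * T) ^ (1 + κ) * (1 / (n : ℝ) ^ (1 + κ))
        + (2 * T) ^ ((1 + κ) / 2) * c * (1 / (n : ℝ) ^ (1 + κ)) := by gcongr
    _ = ((2 * T) ^ (1 + κ) + (2 * T) ^ ((1 + κ) / 2) * c) * (1 / (n : ℝ) ^ (1 + κ)) := by ring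
    _ ≤ _ := by
        gcongr
        linarith [Real.log_nonneg hn1]

theorem theorem3p6 (T : ℝ) (hT : 0 < T) (κ : ℝ) (hκ : κ ∈ Set.Ioo (0 : ℝ) 1)
    (b : ℝ → ℝ) (hb_meas : Measurable b) (hb_bdd : ∃ M : ℝ, ∀ x, |b x| ≤ M)
    (hb_int : Integrable b volume) (hb_sob : slobodeckijSeminorm κ b < ∞) :
    ∃ Cequi : ℝ, 0 < Cequi ∧ ∃ Cstar : ℝ, 0 < Cstar ∧
      ∀ (Ω : Type*) [MeasurableSpace Ω] (P : Measure Ω) [IsProbabilityMeasure P]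
        (W : ℝ → Ω → ℝ) (ξ : Ω → ℝ),
        IsBrownianMotionOn T W P → Measurable ξ →
        IndepFun ξ (fun ω (t : Set.Icc (0 : ℝ) T) ↦ W t ω) P →
        ∀ n : ℕ, 1 ≤ n →
          (⨆ r ∈ Set.Icc (0 : ℝ) T, quadError P W ξ b n (equiGrid T n) r) ≤
              ENNReal.ofReal
                (Cequi * (1 / (n : ℝ) ^ (1 + κ) + 1 / (n : ℝ) ^ (3 / 2 : ℝ))) ∧
          (⨆ r ∈ Set.Icc (0 : ℝ) T, quadError P W ξ b n (starGrid T n) r) ≤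
              ENNReal.ofReal
                (Cstar * ((1 + Real.log n) / (n : ℝ) ^ (1 + κ))) := by
  obtain ⟨C, H⟩ := exists_weightedDrift (R := 5 * T) (by linarith) hκ hb_meas hb_bdd hb_int hb_sob
  obtain ⟨D, hD, hquad⟩ := H.exists_quadrature_bound hT
  obtain ⟨K, hK, hequi⟩ := exists_equiGrid_rate hT hκ
  obtain ⟨L, hL, hstar⟩ := exists_starGrid_rate hT hκ
  refine ⟨D * K, by positivity, D * L, by positivity, ?_⟩
  intro Ω _ P _ W ξ hW hξ hind n hn
  have hn1 : (1 : ℝ) ≤ n := by exact_mod_cast hn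
  have hTn : T / n ≤ T := div_le_self hT.le hn1
  have hTn2 : 2 * T / n ≤ 2 * T := div_le_self (by linarith) hn1
  constructor
  · refine iSup₂_le fun r hr ↦ (hquad Ω P W ξ hW hξ hind n (T / n) _ hn (by linarith)
      (regularGrid_equiGrid hT hn) r hr).trans (ENNReal.ofReal_le_ofReal ?_)
    rw [mul_assoc D K]
    exact mul_le_mul_of_nonneg_left (hequi n hn) hD.le
  · refine iSup₂_le fun r hr ↦ (hquad Ω P W ξ hW hξ hind n (2 * T / n) _ hn hTn2
      (regularGrid_starGrid hT hn) r hr).trans (ENNReal.ofReal_le_ofReal ?_)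
    rw [mul_assoc D L]
    exact mul_le_mul_of_nonneg_left (hstar n hn) hD.le
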